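/- Let $\mathcal A$ and $\mathcal I$ be finite sets of agents and incentives with $|\mathcal A|=|\mathcal I|=m\ge 1$, and let $\mathcal P=\mathcal A\times\mathcal I$. The edges in $\mathcal P$ are partitioned into classes $\xi$ with capacities $b_\xi\in\mathbb N$. A set of edges is \emph{feasible} if every agent and every incentive lies on at most one of its edges and it contains at most $b_\xi$ edges of each class $\xi$. Assume that every inclusion-maximal feasible set matches every agent. Agent $a$ has a type in a finite set $\Theta_a$. For each $(a,i)\in\mathcal P$, let $P_{a,i}$ be an irreducible aperiodic stochastic matrix on $\Theta_a$ with stationary distribution $\pi_{a,i}$, and for each $\theta\in\Theta_a$ let a reward distribution on $[0,1]$ be given. Let $\mu_{a,i}$ be the expected reward when $\theta\sim\pi_{a,i}$. In epoch $k=1,2,\dots$ a matching $\alpha(k)$, chosen from the past, is played for $\tau_k=\tau_0+\zeta k$ iterations, with integers $\tau_0\ge1$, $\zeta\ge1$. In each iteration, every $(a,i)\in\alpha(k)$ yields a reward drawn from the distribution of the current type of $a$, and this type makes an independent step of $P_{a,i}$; types of unmatched agents may evolve arbitrarily. Let $\mathbf r_{a,i}(k)$ be the average reward of $(a,i)\in\alpha(k)$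 over the iterations of epoch $k$. The greedy algorithm with weights $w$ repeatedly takes a remaining edge of maximal weight (ties broken arbitrarily). If the class of this edge is not yet full, the edge is selected and all remaining edges sharing its agent or incentive are removed; otherwise only this edge is removed. Let $G^*=\{g_1^*,\dots,g_m^*\}$, $\mu_{g_1^*}\ge\dots\ge\mu_{g_m^*}$, be its output for the weights $\mu$, and let $i^*(a)$ be the incentive of $a$ in $G^*$. Let $\mathcal S=\{(a,i):\mu_{a,i}<\mu_{a,i^*(a)}\}$. Let $H_j$ be the set of edges whose addition to $\{g^*_1,\dots,g^*_j\}$ is infeasible, $L_1=H_1$, and $L_j=H_j\setminus H_{j-1}$ for $j\ge2$. Define the gaps by $\Delta_{a,i}=\mu_{a,i^*(a)}-\mu_{a,i}$ on $\mathcal S$; $\Delta_{a,i}=\mu_{g^*_j}-\mu_{a,i}$ if $(a,i)\in L_j$ and $(a,i)\notin G^*\cup\mathcal S$; and $\Delta_{g_j^*}=\mu_{g^*_{j-1}}-\mu_{g^*_j}$ for $j\ge2$. Assume $\Delta_{a,i}>0$ for all $(a,i)\ne g_1^*$. Call $C_{a,i}$ a mixing constant of $(a,i)$ if $\sum_{s=0}^{N-1}\|\beta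 P_{a,i}^s-\pi_{a,i}\|_1\le C_{a,i}$ for all $N$ and all distributions $\beta$ on $\Theta_a$. Then every edge has a mixing constant. Moreover, fix mixing constants $C_{a,i}$ and put $\rho_{a,i}=\big(\frac{\zeta}{\zeta+\tau_0}+1\big)\frac{C_{a,i}}{2\sqrt\zeta}$ and $C_*=\max_{(a,i)\notin\mathcal S}C_{a,i}$. Let $\alpha$ be MG-EUCB. First it plays $M_1,\dots,M_p$, each $M_j$ being an inclusion-maximal feasible set of edges not in $M_1\cup\dots\cup M_{j-1}$, until all edges are covered. In each epoch $t>p$ it plays a greedy matching for the weights $\bar R_{a,i}+c_{a,i}$, where $k$ is the number of earlier epochs in which $(a,i)$ was played, $\bar R_{a,i}$ is the mean of the corresponding $k$ averages $\mathbf r_{a,i}$, and $$c_{a,i}=\frac{C_{a,i}}{2k}\Big(\frac1{\zeta+\tau_0}+\frac1\zeta\log\big(1+\tfrac{k\zeta}{\tau_0}\big)\Big)+\sqrt{\tfrac6k\log t+\tfrac4k\log m}.$$ Then for every horizon $n\ge1$ and arbitrary initial types, the expected regret $$R^\alpha(n)=n\sum_{(a,i)\in G^*}\mu_{a,i}-\sum_{k=1}^n\mathbb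 E\Big[\sum_{(a,i)\in\alpha(k)}\mathbf r_{a,i}(k)\Big]$$ satisfies $$R^\alpha(n)\le\sum_{(a,i)\in\mathcal S}\Big(\frac{4m^2}{\Delta_{a^*,i^*}^2}\Big(\frac{\rho_{a^*,i^*}}{\sqrt{\tau_0}}+\sqrt{6\log n+4\log m}\Big)^2+2(1+\log n)\Big)\Big(\Delta_{a,i}+\frac{C_{a,i}}{\tau_0}\Big)+\frac{mC_*}{\zeta}\Big(1+\log\Big(\frac{\zeta(n-1)}{\tau_0}+1\Big)\Big),$$ where $(a^*,i^*)$ is any maximizer of $\Big\lceil\frac{4}{\Delta_{a,i}^2}\big(\frac{\rho_{a,i}}{\sqrt{\tau_0}}+\sqrt{6\log n+4\log m}\big)^2\Big\rceil$ over $(a,i)\in\mathcal P\setminus\{g_1^*\}$ (for $m=1$ the set $\mathcal S$ is empty and $(a^*,i^*)$ is not needed). The right-hand side is $O(\log n)$ as $n\to\infty$, so the regret grows at most logarithmically in $n$. -/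

import Mathlib

open MeasureTheory Filter
open scoped Matrix

/-! ### Finite Markov chains -/

/-- A finite Markov chain is aperiodic if, at each state, the greatest common divisor of the
possible return times is one. -/
def IsAperiodicChain {S : Type*} [Fintype S] [DecidableEq S] (P : Matrix S S ℝ) : Prop :=
  ∀ x : S, ∀ d : ℕ, (∀ k : ℕ, 0 < k → 0 < (P ^ k) x x → d ∣ k) → d = 1

/-- `c` is a mixing constant of the chain `P` with stationary distribution `π`: whatever the
initial distribution `β`, the `ℓ¹`-distances between the law after `s` steps and `π`, added up
over any number of initial steps, never exceed `c`. -/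
def IsMixingConstant {S : Type*} [Fintype S] [DecidableEq S]
    (P : Matrix S S ℝ) (π : S → ℝ) (c : ℝ) : Prop :=
  ∀ β ∈ stdSimplex ℝ S, ∀ N : ℕ,
    ∑ s ∈ Finset.range N, ∑ x, |(β ᵥ* (P ^ s)) x - π x| ≤ c

/-! ### The environment -/

/-- Agents `A`, incentives `I`, type spaces `Θ a`.  The edge classes are the fibres of `cls`, with
capacities `cap`.  Each edge `e = (a, i)` has a transition matrix `P e` on the types of `a` with
stationary distribution `stat e`, and for each type a reward distribution on `[0, 1]`. -/
structure MatchingEnv (A I K : Type*) (Θ : A → Type*)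
    [∀ a, Fintype (Θ a)] [∀ a, DecidableEq (Θ a)] where
  cls : A × I → K
  cap : K → ℕ
  P : ∀ e : A × I, Matrix (Θ e.1) (Θ e.1) ℝ
  stat : ∀ e : A × I, Θ e.1 → ℝ
  reward : ∀ e : A × I, Θ e.1 → Measure ℝ
  stochastic : ∀ e, P e ∈ Matrix.rowStochastic ℝ (Θ e.1)
  irreducible : ∀ e, (P e).IsIrreducible
  aperiodic : ∀ e, IsAperiodicChain (P e)
  stat_mem : ∀ e, stat e ∈ stdSimplex ℝ (Θ e.1)
  stationary : ∀ e, stat e ᵥ* P e = stat e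
  reward_prob : ∀ e x, IsProbabilityMeasure (reward e x)
  reward_supp : ∀ e x, reward e x (Set.Icc (0 : ℝ) 1)ᶜ = 0

/-- The expected stationary reward `μ e` of an edge. -/
noncomputable def MatchingEnv.mean {A I K : Type*} {Θ : A → Type*}
    [∀ a, Fintype (Θ a)] [∀ a, DecidableEq (Θ a)] (E : MatchingEnv A I K Θ) (e : A × I) : ℝ :=
  ∑ x, E.stat e x * ∫ r, r ∂(E.reward e x)

/-! ### Capacitated matchings and the greedy algorithm -/

/-- Feasible solutions of the capacitated matching problem. -/
def IsFeasible {A I K : Type*} [DecidableEq K] (cls : A × I → K) (cap : K → ℕ)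
    (M : Finset (A × I)) : Prop :=
  (∀ e ∈ M, ∀ f ∈ M, e.1 = f.1 → e = f) ∧ (∀ e ∈ M, ∀ f ∈ M, e.2 = f.2 → e = f) ∧
    ∀ ξ : K, (M.filter (fun e => cls e = ξ)).card ≤ cap ξ

/-- `GreedyRun cls cap w G E' out`: the while loop of the capacitated greedy algorithm with edge
weights `w`, in the state where the edges `G` have been selected and the edges `E'` remain, can
return `out`. Ties in the arg max are broken arbitrarily. -/
inductive GreedyRun {A I K : Type*} [DecidableEq A] [DecidableEq I] [DecidableEq K]
    (cls : A × I → K) (cap : K → ℕ) (w : A × I → ℝ) :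
    Finset (A × I) → Finset (A × I) → Finset (A × I) → Prop
  | done (G : Finset (A × I)) : GreedyRun cls cap w G ∅ G
  | take (G E' out : Finset (A × I)) (e : A × I) (he : e ∈ E') (hmax : ∀ f ∈ E', w f ≤ w e)
      (hcap : (G.filter (fun f => cls f = cls e)).card < cap (cls e))
      (hrun : GreedyRun cls cap w (insert e G)
        (E'.filter (fun f => ¬ (f.1 = e.1 ∨ f.2 = e.2))) out) :
      GreedyRun cls cap w G E' out
  | skip (G E' out : Finset (A × I)) (e : A × I) (he : e ∈ E') (hmax : ∀ f ∈ E', w f ≤ w e)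
      (hcap : ¬ (G.filter (fun f => cls f = cls e)).card < cap (cls e))
      (hrun : GreedyRun cls cap w G (E'.erase e) out) :
      GreedyRun cls cap w G E' out

/-- `M` is an output of the greedy algorithm, started from no selected edge and all edges
available. -/
def IsGreedyMatching {A I K : Type*} [Fintype A] [Fintype I]
    [DecidableEq A] [DecidableEq I] [DecidableEq K]
    (cls : A × I → K) (cap : K → ℕ) (w : A × I → ℝ) (M : Finset (A × I)) : Prop :=
  GreedyRun cls cap w ∅ Finset.univ M

/-- The edges not covered by the matchings `M 1, …, M (j - 1)`. -/
def remainingEdges {A I : Type*} [Fintype A] [Fintype I] [DecidableEq A] [DecidableEq I]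
    (M : ℕ → Finset (A × I)) (j : ℕ) : Finset (A × I) :=
  Finset.univ \ (Finset.Ico 1 j).biUnion M

/-- `M 1, …, M p` is an output of the greedy covering procedure: as long as there are uncovered
edges, the next matching is an inclusion-maximal feasible set of uncovered edges. Thus every edge
is in exactly one of them. -/
structure IsInitialPlay {A I K : Type*} [Fintype A] [Fintype I]
    [DecidableEq A] [DecidableEq I] [DecidableEq K]
    (cls : A × I → K) (cap : K → ℕ) (M : ℕ → Finset (A × I)) (p : ℕ) : Prop where
  nonempty : ∀ j ∈ Finset.Icc 1 p, (remainingEdges M j).Nonempty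
  maximal : ∀ j ∈ Finset.Icc 1 p,
    Maximal (fun N => IsFeasible cls cap N ∧ N ⊆ remainingEdges M j) (M j)
  covers : remainingEdges M (p + 1) = ∅

/-! ### The benchmark matching and the reward gaps -/

/-- The greedy matching `G*` for the weights `μ`, enumerated as `g 0, …, g (m - 1)` by
non-increasing weight; `istar a` is the incentive to which it matches the agent `a`. -/
structure GreedyBenchmark {A I K : Type*} [Fintype A] [Fintype I]
    [DecidableEq A] [DecidableEq I] [DecidableEq K]
    (cls : A × I → K) (cap : K → ℕ) (μ : A × I → ℝ) (m : ℕ) where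
  g : Fin m → A × I
  g_injective : Function.Injective g
  greedy : IsGreedyMatching cls cap μ (Finset.univ.image g)
  antitone : Antitone (fun j => μ (g j))
  istar : A → I
  istar_mem : ∀ a, (a, istar a) ∈ Finset.univ.image g

namespace GreedyBenchmark

variable {A I K : Type*} [Fintype A] [Fintype I]
    [DecidableEq A] [DecidableEq I] [DecidableEq K]
    {cls : A × I → K} {cap : K → ℕ} {μ : A × I → ℝ} {m : ℕ}

/-- The benchmark matching `G*`. -/
def Gstar (b : GreedyBenchmark cls cap μ m) : Finset (A × I) := Finset.univ.image b.g

/-- The set of the `j` heaviest edges of `G*`. -/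
def top (b : GreedyBenchmark cls cap μ m) (j : ℕ) : Finset (A × I) :=
  (Finset.univ.filter (fun l : Fin m => l.val < j)).image b.g

/-- The infeasibility set `H_j`: edges whose addition to the `j` heaviest edges of `G*` violates
feasibility. -/
def infeas (b : GreedyBenchmark cls cap μ m) (j : ℕ) : Set (A × I) :=
  {e | ¬ IsFeasible cls cap (insert e (b.top j))}

/-- The marginal infeasibility sets: `L_1 = H_1` and `L_j = H_j \ H_{j-1}` for `j ≥ 2`. -/
def marginal (b : GreedyBenchmark cls cap μ m) (j : ℕ) : Set (A × I) :=
  if j ≤ 1 then b.infeas j else b.infeas j \ b.infeas (j - 1)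

/-- The set `𝒮` of sub-optimal edges. -/
def subopt (b : GreedyBenchmark cls cap μ m) : Set (A × I) :=
  {e | μ e < μ (e.1, b.istar e.1)}

open scoped Classical in
/-- The reward gap `Δ e`. Index `j : Fin m` stands for the `(j + 1)`-st edge of `G*`, so
`L⁻¹ e = g j` means `e ∈ L_{j+1}`. The gap of the heaviest edge of `G*` is not used; it is set
to zero. -/
noncomputable def gap (b : GreedyBenchmark cls cap μ m) (e : A × I) : ℝ :=
  if e ∈ b.subopt then μ (e.1, b.istar e.1) - μ e
  else if h : ∃ j : Fin m, b.g j = e then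
    (if h.choose.val = 0 then 0
      else μ (b.g ⟨h.choose.val - 1, lt_of_le_of_lt (Nat.sub_le _ _) h.choose.isLt⟩)
        - μ (b.g h.choose))
  else if h : ∃ j : Fin m, e ∈ b.marginal (j.val + 1) then μ (b.g h.choose) - μ e
  else 0

end GreedyBenchmark

/-! ### Epochs and the algorithm -/

/-- Number `τ_k = τ₀ + ζ k` of iterations in epoch `k`. -/
def epochLen (τ₀ ζ k : ℕ) : ℕ := τ₀ + ζ * k

/-- The global index of the first iteration of epoch `k ≥ 1`; iterations are counted from `0`. -/
def epochStart (τ₀ ζ k : ℕ) : ℕ := ∑ l ∈ Finset.Ico 1 k, epochLen τ₀ ζ l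

/-- The time-averaged reward in epoch `k` of edge `e`, where `X t a` is the reward received from
agent `a` at iteration `t` (meant for edges played in epoch `k`). -/
noncomputable def epochAvg {A I Ω : Type*} (τ₀ ζ : ℕ) (X : ℕ → A → Ω → ℝ)
    (k : ℕ) (e : A × I) (ω : Ω) : ℝ :=
  (1 / (epochLen τ₀ ζ k : ℝ)) *
    ∑ s ∈ Finset.range (epochLen τ₀ ζ k), X (epochStart τ₀ ζ k + s) e.1 ω

/-- The number of epochs before epoch `k` in which edge `e` was selected. -/
def pullCount {A I Ω : Type*} [DecidableEq A] [DecidableEq I]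
    (α : ℕ → Ω → Finset (A × I)) (k : ℕ) (e : A × I) (ω : Ω) : ℕ :=
  ((Finset.Ico 1 k).filter (fun l => e ∈ α l ω)).card

/-- The average of the observed epoch rewards of `e` before epoch `k`. -/
noncomputable def empMean {A I Ω : Type*} [DecidableEq A] [DecidableEq I] (τ₀ ζ : ℕ)
    (X : ℕ → A → Ω → ℝ) (α : ℕ → Ω → Finset (A × I)) (k : ℕ) (e : A × I) (ω : Ω) : ℝ :=
  (∑ l ∈ (Finset.Ico 1 k).filter (fun l => e ∈ α l ω), epochAvg τ₀ ζ X l e ω) /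
    (pullCount α k e ω : ℝ)

/-- `Q(k) = (c / 2) (1 / (ζ + τ₀) + (1 / ζ) log (1 + k ζ / τ₀))`. -/
noncomputable def biasTerm (τ₀ ζ : ℕ) (c : ℝ) (k : ℕ) : ℝ :=
  c / 2 * (1 / ((ζ : ℝ) + τ₀) + 1 / (ζ : ℝ) * Real.log (1 + (k : ℝ) * ζ / τ₀))

/-- The confidence parameter of an edge with mixing constant `c` that has been selected `k` times
before epoch `t`. -/
noncomputable def confRadius (m τ₀ ζ : ℕ) (c : ℝ) (k t : ℕ) : ℝ :=
  biasTerm τ₀ ζ c k / k + Real.sqrt (6 / (k : ℝ) * Real.log t + 4 / (k : ℝ) * Real.log m)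

/-- The processes `θ` (types), `X` (rewards) and `α` (selected matchings) form an execution of an
epoch mixing policy over epochs `1, …, n`, in the environment `E`. The matching of an epoch is
determined at its beginning; at each iteration of the epoch, given the past, each agent `a` matched
to `i` yields a reward drawn from the distribution of its current type, and its type moves by one
step of `P (a, i)`, independently of that reward. Initial types, and the types of unmatched
agents, are arbitrary. -/
structure IsEpochMixing {A I K : Type*} {Θ : A → Type*}
    [DecidableEq A] [DecidableEq I] [∀ a, Fintype (Θ a)] [∀ a, DecidableEq (Θ a)]
    (E : MatchingEnv A I K Θ) (τ₀ ζ n : ℕ)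
    {Ω : Type*} [mΩ : MeasurableSpace Ω] (Pr : Measure Ω) (ℱ : Filtration ℕ mΩ)
    (θ : ℕ → (a : A) → Ω → Θ a) (X : ℕ → A → Ω → ℝ) (α : ℕ → Ω → Finset (A × I)) : Prop where
  type_adapted : ∀ t a x, MeasurableSet[ℱ t] {ω | θ t a ω = x}
  reward_adapted : ∀ t a, Measurable[ℱ (t + 1)] (X t a)
  policy_adapted : ∀ k ∈ Finset.Icc 1 n, ∀ e,
    MeasurableSet[ℱ (epochStart τ₀ ζ k)] {ω | e ∈ α k ω}
  law : ∀ k ∈ Finset.Icc 1 n, ∀ s < epochLen τ₀ ζ k, ∀ e : A × I,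
    ∀ B : Set ℝ, MeasurableSet B → ∀ y : Θ e.1,
      ∀ᵐ ω ∂Pr, e ∈ α k ω →
        (Pr[Set.indicator {ω' | X (epochStart τ₀ ζ k + s) e.1 ω' ∈ B ∧
              θ (epochStart τ₀ ζ k + s + 1) e.1 ω' = y} (fun _ => (1 : ℝ))
            | ℱ (epochStart τ₀ ζ k + s)]) ω
          = (E.reward e (θ (epochStart τ₀ ζ k + s) e.1 ω)).real B
              * E.P e (θ (epochStart τ₀ ζ k + s) e.1 ω) y

/-- An execution of MG-EUCB over epochs `1, …, n`: play the initial matchings `M 1, …, M p`; after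
that, in epoch `k`, play a greedy matching for the weights "empirical mean plus confidence
parameter". `C e` is the mixing constant used for edge `e`. -/
structure IsMGEUCB {A I K : Type*} {Θ : A → Type*} [Fintype A] [Fintype I]
    [DecidableEq A] [DecidableEq I] [DecidableEq K]
    [∀ a, Fintype (Θ a)] [∀ a, DecidableEq (Θ a)]
    (E : MatchingEnv A I K Θ) (C : A × I → ℝ) (m τ₀ ζ n : ℕ) (M : ℕ → Finset (A × I)) (p : ℕ)
    {Ω : Type*} [mΩ : MeasurableSpace Ω] (Pr : Measure Ω) (ℱ : Filtration ℕ mΩ)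
    (θ : ℕ → (a : A) → Ω → Θ a) (X : ℕ → A → Ω → ℝ) (α : ℕ → Ω → Finset (A × I)) : Prop
    extends IsEpochMixing E τ₀ ζ n Pr ℱ θ X α where
  init : ∀ k ∈ Finset.Icc 1 n, k ≤ p → ∀ ω, α k ω = M k
  greedy : ∀ k ∈ Finset.Icc 1 n, p < k → ∀ ω,
    IsGreedyMatching E.cls E.cap
      (fun e => empMean τ₀ ζ X α k e ω + confRadius m τ₀ ζ (C e) (pullCount α k e ω) k) (α k ω)

/-- The expected regret of an epoch mixing policy after `n` epochs with respect to `G`. -/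
noncomputable def regret {A I : Type*} {Ω : Type*} [MeasurableSpace Ω] (Pr : Measure Ω)
    (μ : A × I → ℝ) (G : Finset (A × I)) (τ₀ ζ : ℕ) (X : ℕ → A → Ω → ℝ)
    (α : ℕ → Ω → Finset (A × I)) (n : ℕ) : ℝ :=
  n * ∑ e ∈ G, μ e
    - ∑ k ∈ Finset.Icc 1 n, ∫ ω, ∑ e ∈ α k ω, epochAvg τ₀ ζ X k e ω ∂Pr

/-! ### The quantities in the bound -/

/-- `ρ = (ζ / (ζ + τ₀) + 1) c / (2 √ζ)`. -/
noncomputable def rhoConst (τ₀ ζ : ℕ) (c : ℝ) : ℝ :=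
  ((ζ : ℝ) / (ζ + τ₀) + 1) * (c / (2 * Real.sqrt ζ))

/-- `(4 / Δ²) (ρ / √τ₀ + √(6 log n + 4 log m))²` for an edge with gap `Δ` and mixing constant
`c`. -/
noncomputable def pullThreshold (m τ₀ ζ n : ℕ) (Δ c : ℝ) : ℝ :=
  4 / Δ ^ 2 * (rhoConst τ₀ ζ c / Real.sqrt τ₀
    + Real.sqrt (6 * Real.log n + 4 * Real.log m)) ^ 2

open scoped Classical in
/-- The right-hand side of the regret bound, `estar` being the edge `(a*, i*)`. -/
noncomputable def regretBound {A I K : Type*} [Fintype A] [Fintype I]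
    [DecidableEq A] [DecidableEq I] [DecidableEq K]
    {cls : A × I → K} {cap : K → ℕ} {μ : A × I → ℝ} {m : ℕ}
    (b : GreedyBenchmark cls cap μ m) (C : A × I → ℝ) (τ₀ ζ : ℕ) (estar : A × I) (n : ℕ) : ℝ :=
  ∑ e ∈ Finset.univ.filter (fun e => e ∈ b.subopt),
      ((m : ℝ) ^ 2 * pullThreshold m τ₀ ζ n (b.gap estar) (C estar) + 2 * (1 + Real.log n))
        * (b.gap e + C e / τ₀)
    + m * sSup (C '' {e | e ∉ b.subopt}) / ζ
        * (1 + Real.log ((ζ : ℝ) * ((n : ℝ) - 1) / τ₀ + 1))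

/-!
The regret is split by agent and epoch. A selected edge `e` loses its gap if it is suboptimal, and
the bias caused by an unmixed initial type, which is at most `C e / 2` divided by the length of the
epoch (`IsEpochMixing.abs_integral_weight_mul_epochAvg_sub_le`). Since the epochs grow linearly, the
biases add up to a logarithm. What remains is to bound the selections of suboptimal edges.

If a greedy matching for the upper confidence weights differs from the benchmark, then at the first
step at which the two greedy runs differ it prefers some edge `f` to a benchmark edge lying at
least the gap of `f` above `f` (`GreedyBenchmark.exists_preferred`). Unless an empirical mean
misses its mean by the confidence parameter, the gap of `f` is then less than twice its confidence
parameter, so `f` has been selected less often than its threshold (`lt_pullThreshold`). As each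
selection of `f` raises its count, each edge other than the heaviest benchmark edge accounts for at
most `z - 1` wrong epochs, where `z` is the rounded maximal threshold
(`IsMGEUCB.card_ne_Gstar_le`).

Deviations are rare by an Azuma inequality for increments that count only in the epochs in which
the edge is played. It rests on the exponential supermartingale compensated by `l² / 2` per counted
increment (`integral_exp_sum_indicator_le_one`) and on `cosh l ≤ exp (l² / 2)`. The union bound over
edges, signs and counts gives probability at most `2 / t` in epoch `t`
(`IsEpochMixing.measureReal_deviationEvent_le`).

The initial matchings may leave agents unmatched, which costs up to `m² (m - 1)` more. This is
absorbed because in each wrong epoch the agent of the heaviest benchmark edge, all of whose other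
`m - 1` edges are suboptimal, selects only one edge, whereas the bound pays for all of them
(`IsMGEUCB.sum_selected_subopt_le`, `regret_arithmetic`).

Mixing constants exist since an irreducible aperiodic chain has a positive power, which contracts
the `ℓ¹`-norm on vectors of total mass zero (`exists_isMixingConstant`).
-/

/-! ### Mixing of finite Markov chains -/

/-- The possible return times of an aperiodic chain generate a numerical semigroup with greatest
common divisor one, so all large times are possible return times. -/
lemma IsAperiodicChain.eventually_return_pos {S : Type*} [Fintype S] [DecidableEq S]
    {P : Matrix S S ℝ} (hP : ∀ i j, 0 ≤ P i j) (h : IsAperiodicChain P) (x : S) :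
    ∃ N, ∀ k ≥ N, 0 < (P ^ k) x x := by
  set R : Set ℕ := {k | 0 < k ∧ 0 < (P ^ k) x x}
  have hgcd : Nat.setGcd R = 1 :=
    h x _ fun k hk hpos => Nat.setGcd_dvd_of_mem ⟨hk, hpos⟩
  have hcl : ∀ k ∈ AddSubmonoid.closure R, 0 < (P ^ k) x x := by
    intro k hk
    induction hk using AddSubmonoid.closure_induction with
    | mem k hk => exact hk.2
    | zero => simp
    | add k l _ _ hk hl =>
      rw [pow_add, Matrix.mul_apply]
      exact (mul_pos hk hl).trans_le (Finset.single_le_sum (f := fun y => (P ^ k) x y * (P ^ l) y x)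
        (fun y _ => mul_nonneg (Matrix.pow_apply_nonneg hP _ _ _)
          (Matrix.pow_apply_nonneg hP _ _ _)) (Finset.mem_univ x))
  obtain ⟨N, hN⟩ := Nat.exists_mem_closure_of_ge R
  exact ⟨N, fun k hk => hcl k (hN k hk (by simp [hgcd]))⟩

/-- An irreducible aperiodic chain is primitive. -/
lemma IsAperiodicChain.exists_pow_pos {S : Type*} [Fintype S] [DecidableEq S]
    {P : Matrix S S ℝ} (hirr : P.IsIrreducible) (h : IsAperiodicChain P) :
    ∃ N, ∀ x y, 0 < (P ^ N) x y := by
  have hP := hirr.nonneg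
  choose n hn using h.eventually_return_pos hP
  choose k _ hk using (Matrix.isIrreducible_iff_exists_pow_pos hP).1 hirr
  refine ⟨Finset.univ.sup fun q : S × S => n q.1 + k q.1 q.2, fun x y => ?_⟩
  set N := Finset.univ.sup fun q : S × S => n q.1 + k q.1 q.2
  have hle : n x + k x y ≤ N :=
    Finset.le_sup (f := fun q : S × S => n q.1 + k q.1 q.2) (Finset.mem_univ (x, y))
  obtain ⟨r, hr⟩ := Nat.exists_eq_add_of_le hle
  have hN : N = (n x + r) + k x y := by omega
  rw [hN, pow_add, Matrix.mul_apply]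
  exact (mul_pos (hn x (n x + r) (by omega)) (hk x y)).trans_le
    (Finset.single_le_sum (f := fun z => (P ^ (n x + r)) x z * (P ^ (k x y)) z y)
      (fun z _ => mul_nonneg (Matrix.pow_apply_nonneg hP _ _ _)
        (Matrix.pow_apply_nonneg hP _ _ _)) (Finset.mem_univ x))

/-- Doeblin contraction: a stochastic matrix with entries at least `δ` contracts the `ℓ¹`-norm of
vectors of total mass zero. -/
lemma sum_abs_vecMul_le_of_le_apply {S : Type*} [Fintype S] [DecidableEq S] {Q : Matrix S S ℝ}
    (hQ : Q ∈ Matrix.rowStochastic ℝ S) {δ : ℝ} (hδ : ∀ x y, δ ≤ Q x y) {v : S → ℝ}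
    (hv : ∑ x, v x = 0) :
    ∑ y, |(v ᵥ* Q) y| ≤ (1 - Fintype.card S * δ) * ∑ x, |v x| := by
  have h1 : ∀ y, (v ᵥ* Q) y = ∑ x, v x * (Q x y - δ) := by
    intro y
    simp [Matrix.vecMul, dotProduct, mul_sub, Finset.sum_sub_distrib, ← Finset.sum_mul, hv]
  calc ∑ y, |(v ᵥ* Q) y| ≤ ∑ y, ∑ x, |v x| * (Q x y - δ) := by
        refine Finset.sum_le_sum fun y _ => ?_
        rw [h1]
        refine (Finset.abs_sum_le_sum_abs _ _).trans_eq (Finset.sum_congr rfl fun x _ => ?_)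
        rw [abs_mul, abs_of_nonneg (sub_nonneg.2 (hδ x y))]
    _ = (1 - Fintype.card S * δ) * ∑ x, |v x| := by
        rw [Finset.sum_comm, Finset.mul_sum]
        refine Finset.sum_congr rfl fun x _ => ?_
        rw [← Finset.mul_sum, Finset.sum_sub_distrib, Matrix.sum_row_of_mem_rowStochastic hQ]
        simp [mul_comm]

lemma vecMul_pow_eq_of_stationary {S : Type*} [Fintype S] [DecidableEq S] {P : Matrix S S ℝ}
    {π : S → ℝ} (h : π ᵥ* P = π) (s : ℕ) : π ᵥ* (P ^ s) = π := by
  induction s with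
  | zero => simp
  | succ s ih => rw [pow_succ, ← Matrix.vecMul_vecMul, ih, h]

/-- Every irreducible aperiodic chain has a mixing constant. If `P ^ N` contracts by the factor
`κ < 1`, then the partial sums `F` of the distances satisfy `F ≤ 2 N + κ F`. -/
lemma exists_isMixingConstant {S : Type*} [Fintype S] [DecidableEq S] {P : Matrix S S ℝ}
    {π : S → ℝ} (hP : P ∈ Matrix.rowStochastic ℝ S) (hirr : P.IsIrreducible)
    (hap : IsAperiodicChain P) (hπ : π ∈ stdSimplex ℝ S) (hst : π ᵥ* P = π) :
    ∃ c : ℝ, 0 < c ∧ IsMixingConstant P π c := by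
  obtain ⟨N, hN⟩ := hap.exists_pow_pos hirr
  have hne : Nonempty S := by
    by_contra hne
    rw [not_nonempty_iff] at hne
    simpa using hπ.2
  obtain ⟨q, -, hq⟩ := Finset.exists_min_image (Finset.univ : Finset (S × S))
    (fun q => (P ^ N) q.1 q.2) Finset.univ_nonempty
  set δ := (P ^ N) q.1 q.2
  have hδ : 0 < δ := hN _ _
  set κ := 1 - Fintype.card S * δ with hκdef
  have hκ : 0 < 1 - κ := by
    have : (0 : ℝ) < Fintype.card S := by exact_mod_cast Fintype.card_pos
    have := mul_pos this hδ
    linarith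
  refine ⟨2 * (N + 1) / (1 - κ), by positivity, fun β hβ M => ?_⟩
  set v : S → ℝ := β - π
  have hv : ∑ x, v x = 0 := by simp [v, Finset.sum_sub_distrib, hβ.2, hπ.2]
  have hsum : ∀ s, ∑ x, (v ᵥ* (P ^ s)) x = 0 := by
    intro s
    have h1 := Matrix.one_vecMul_of_mem_rowStochastic (pow_mem hP s)
    have h2 : (v ᵥ* (P ^ s)) ⬝ᵥ 1 = v ⬝ᵥ ((P ^ s) *ᵥ 1) := (Matrix.dotProduct_mulVec _ _ _).symm
    rw [h1] at h2
    simpa [dotProduct, hv] using h2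
  set f : ℕ → ℝ := fun s => ∑ x, |(v ᵥ* (P ^ s)) x|
  have hf : ∀ s, ∑ x, |(β ᵥ* (P ^ s)) x - π x| = f s := by
    intro s
    simp only [f, v, Matrix.sub_vecMul, vecMul_pow_eq_of_stationary hst, Pi.sub_apply]
  have hf0 : ∀ s, 0 ≤ f s := fun s => Finset.sum_nonneg fun _ _ => abs_nonneg _
  have hf2 : ∀ s, f s ≤ 2 := by
    intro s
    have hv2 : ∑ x, |v x| ≤ 2 := by
      calc ∑ x, |v x| ≤ ∑ x, (β x + π x) := Finset.sum_le_sum fun x _ => by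
            have h1 := hβ.1 x
            have h2 := hπ.1 x
            simp only [v, Pi.sub_apply]
            rw [abs_le]; constructor <;> linarith
        _ = 2 := by rw [Finset.sum_add_distrib, hβ.2, hπ.2]; norm_num
    have := sum_abs_vecMul_le_of_le_apply (pow_mem hP s) (δ := 0)
      (fun x y => Matrix.nonneg_of_mem_rowStochastic (pow_mem hP s)) hv
    simp only [mul_zero, sub_zero, one_mul] at this
    exact this.trans hv2
  have hfN : ∀ s, f (s + N) ≤ κ * f s := by
    intro s
    simp only [f, pow_add, ← Matrix.vecMul_vecMul]
    exact sum_abs_vecMul_le_of_le_apply (pow_mem hP N)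
      (fun x y => hq (x, y) (Finset.mem_univ _)) (hsum s)
  simp only [hf]
  rw [le_div_iff₀ hκ]
  have h1 : ∑ s ∈ Finset.range M, f s ≤ ∑ s ∈ Finset.range (N + M), f s :=
    Finset.sum_le_sum_of_subset_of_nonneg (Finset.range_mono (by omega)) fun s _ _ => hf0 s
  rw [Finset.sum_range_add] at h1
  have h2 : ∑ s ∈ Finset.range N, f s ≤ N * 2 := by
    simpa using Finset.sum_le_card_nsmul (Finset.range N) f 2 fun s _ => hf2 s
  have h3 : ∑ s ∈ Finset.range M, f (N + s) ≤ κ * ∑ s ∈ Finset.range M, f s := by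
    rw [Finset.mul_sum]
    exact Finset.sum_le_sum fun s _ => by rw [add_comm]; exact hfN s
  linarith

lemma IsMixingConstant.nonneg {S : Type*} [Fintype S] [DecidableEq S] {P : Matrix S S ℝ}
    {π : S → ℝ} {c : ℝ} (h : IsMixingConstant P π c) (hπ : π ∈ stdSimplex ℝ S) : 0 ≤ c := by
  simpa using h π hπ 0

/-- Rewards in `[0, 1]` integrate the `ℓ¹`-distance with weight one half: the total bias of the
expected rewards over any number of steps is at most half the mixing constant. -/
lemma IsMixingConstant.abs_sum_dotProduct_sub_le {S : Type*} [Fintype S] [DecidableEq S]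
    {P : Matrix S S ℝ} {π : S → ℝ} {c : ℝ} (h : IsMixingConstant P π c)
    (hP : P ∈ Matrix.rowStochastic ℝ S) (hπ : π ∈ stdSimplex ℝ S)
    {β : S → ℝ} (hβ : ∀ x, 0 ≤ β x) {ρ : S → ℝ} (hρ : ∀ x, ρ x ∈ Set.Icc (0 : ℝ) 1) (N : ℕ) :
    |∑ s ∈ Finset.range N, (β ᵥ* (P ^ s)) ⬝ᵥ ρ - N * ((∑ x, β x) * (π ⬝ᵥ ρ))|
      ≤ (∑ x, β x) * (c / 2) := by
  set w := ∑ x, β x with hw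
  have hw0 : 0 ≤ w := Finset.sum_nonneg fun x _ => hβ x
  rcases hw0.eq_or_lt with h0 | hpos
  · have : β = 0 := by
      funext x
      exact (Finset.sum_eq_zero_iff_of_nonneg fun x _ => hβ x).1 (hw ▸ h0.symm) x
        (Finset.mem_univ x)
    simp [this, ← h0]
  have hβ' : w⁻¹ • β ∈ stdSimplex ℝ S :=
    ⟨fun x => mul_nonneg (inv_nonneg.2 hw0) (hβ x), by
      simp [← Finset.mul_sum, ← hw, hpos.ne']⟩
  have hmix := h _ hβ' N
  have hone : ∀ s, ∑ x, ((w⁻¹ • β) ᵥ* (P ^ s)) x = 1 := by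
    intro s
    have h1 := Matrix.one_vecMul_of_mem_rowStochastic (pow_mem hP s)
    have h2 : ((w⁻¹ • β) ᵥ* (P ^ s)) ⬝ᵥ 1 = (w⁻¹ • β) ⬝ᵥ ((P ^ s) *ᵥ 1) :=
      (Matrix.dotProduct_mulVec _ _ _).symm
    rw [h1] at h2
    simp only [dotProduct, Pi.one_apply, mul_one] at h2
    rw [h2]; exact hβ'.2
  have hterm : ∀ s, |(β ᵥ* (P ^ s)) ⬝ᵥ ρ - w * (π ⬝ᵥ ρ)|
      ≤ w * (1 / 2 * ∑ x, |((w⁻¹ • β) ᵥ* (P ^ s)) x - π x|) := by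
    intro s
    -- subtracting `1 / 2` from `ρ` changes nothing, since the difference of laws has mass zero
    have h1 : (β ᵥ* (P ^ s)) ⬝ᵥ ρ - w * (π ⬝ᵥ ρ)
        = w * ∑ x, (((w⁻¹ • β) ᵥ* (P ^ s)) x - π x) * (ρ x - 1 / 2) := by
      have h2 : ∑ x, (((w⁻¹ • β) ᵥ* (P ^ s)) x - π x) * (1 / 2 : ℝ) = 0 := by
        rw [← Finset.sum_mul, Finset.sum_sub_distrib, hone, hπ.2]; simp
      have h3 : ∑ x, (((w⁻¹ • β) ᵥ* (P ^ s)) x - π x) * (ρ x - 1 / 2)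
          = ∑ x, (((w⁻¹ • β) ᵥ* (P ^ s)) x - π x) * ρ x := by
        rw [← sub_zero (∑ x, (((w⁻¹ • β) ᵥ* (P ^ s)) x - π x) * ρ x), ← h2,
          ← Finset.sum_sub_distrib]
        exact Finset.sum_congr rfl fun x _ => by ring
      rw [h3]
      simp only [dotProduct, Matrix.smul_vecMul, Pi.smul_apply, smul_eq_mul, Finset.mul_sum]
      rw [← Finset.sum_sub_distrib]
      refine Finset.sum_congr rfl fun x _ => ?_
      field_simp
    rw [h1, abs_mul, abs_of_pos hpos, Finset.mul_sum]
    refine mul_le_mul_of_nonneg_left ((Finset.abs_sum_le_sum_abs _ _).trans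
      (Finset.sum_le_sum fun x _ => ?_)) hw0
    rw [abs_mul, mul_comm]
    refine mul_le_mul_of_nonneg_right ?_ (abs_nonneg _)
    have := hρ x
    rw [abs_le]; constructor <;> linarith [this.1, this.2]
  calc _ = |∑ s ∈ Finset.range N, ((β ᵥ* (P ^ s)) ⬝ᵥ ρ - w * (π ⬝ᵥ ρ))| := by
        simp [Finset.sum_sub_distrib]
    _ ≤ ∑ s ∈ Finset.range N, w * (1 / 2 * ∑ x, |((w⁻¹ • β) ᵥ* (P ^ s)) x - π x|) :=
        (Finset.abs_sum_le_sum_abs _ _).trans (Finset.sum_le_sum fun s _ => hterm s)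
    _ = w * (1 / 2 * ∑ s ∈ Finset.range N, ∑ x, |((w⁻¹ • β) ᵥ* (P ^ s)) x - π x|) := by
        rw [Finset.mul_sum, Finset.mul_sum]
    _ ≤ w * (c / 2) := mul_le_mul_of_nonneg_left (by linarith) hw0

/-! ### Feasible sets and greedy matchings -/

lemma IsFeasible.mono {A I K : Type*} [DecidableEq K] {cls : A × I → K} {cap : K → ℕ}
    {M N : Finset (A × I)} (hN : IsFeasible cls cap N) (h : M ⊆ N) :
    IsFeasible cls cap M :=
  ⟨fun e he f hf => hN.1 e (h he) f (h hf), fun e he f hf => hN.2.1 e (h he) f (h hf),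
    fun ξ => (Finset.card_le_card (Finset.filter_subset_filter _ h)).trans (hN.2.2 ξ)⟩

lemma isFeasible_empty {A I K : Type*} [DecidableEq K] {cls : A × I → K} {cap : K → ℕ} :
    IsFeasible cls cap ∅ := by
  simp [IsFeasible]

section Greedy

variable {A I K : Type*} [DecidableEq A] [DecidableEq I] [DecidableEq K]
  {cls : A × I → K} {cap : K → ℕ}

/-- An edge that shares no endpoint with a feasible set and whose class is not full can be
added. -/
lemma IsFeasible.insert {M : Finset (A × I)} (hM : IsFeasible cls cap M) {e : A × I}
    (hdisj : ∀ f ∈ M, f.1 ≠ e.1 ∧ f.2 ≠ e.2)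
    (hcap : (M.filter (fun f => cls f = cls e)).card < cap (cls e)) :
    IsFeasible cls cap (insert e M) := by
  refine ⟨?_, ?_, fun ξ => ?_⟩
  · intro f hf f' hf' h
    rcases Finset.mem_insert.1 hf with h1 | h1 <;> rcases Finset.mem_insert.1 hf' with h2 | h2
    · rw [h1, h2]
    · exact absurd (h1 ▸ h.symm) (hdisj _ h2).1
    · exact absurd (h2 ▸ h) (hdisj _ h1).1
    · exact hM.1 _ h1 _ h2 h
  · intro f hf f' hf' h
    rcases Finset.mem_insert.1 hf with h1 | h1 <;> rcases Finset.mem_insert.1 hf' with h2 | h2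
    · rw [h1, h2]
    · exact absurd (h1 ▸ h.symm) (hdisj _ h2).2
    · exact absurd (h2 ▸ h) (hdisj _ h1).2
    · exact hM.2.1 _ h1 _ h2 h
  · rw [Finset.filter_insert]
    split_ifs with h
    · subst h
      exact (Finset.card_insert_le _ _).trans hcap
    · exact hM.2.2 ξ

lemma not_isFeasible_insert_of_full {M : Finset (A × I)} {e : A × I} (he : e ∉ M)
    (hcap : ¬ (M.filter (fun f => cls f = cls e)).card < cap (cls e)) :
    ¬ IsFeasible cls cap (insert e M) := by
  intro h
  have h1 := h.2.2 (cls e)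
  rw [Finset.filter_insert, if_pos rfl, Finset.card_insert_of_notMem (by simp [he])] at h1
  omega

lemma not_isFeasible_insert_of_shared {M : Finset (A × I)} {e f : A × I} (he : e ∉ M)
    (hf : f ∈ M) (h : e.1 = f.1 ∨ e.2 = f.2) : ¬ IsFeasible cls cap (insert e M) := by
  intro hfeas
  have : e = f := h.elim
    (hfeas.1 e (Finset.mem_insert_self _ _) f (Finset.mem_insert_of_mem hf))
    (hfeas.2.1 e (Finset.mem_insert_self _ _) f (Finset.mem_insert_of_mem hf))
  exact he (this ▸ hf)

lemma IsFeasible.maximal {M : Finset (A × I)} (hM : IsFeasible cls cap M)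
    (h : ∀ e, e ∉ M → ¬ IsFeasible cls cap (Insert.insert e M)) :
    Maximal (IsFeasible cls cap) M := by
  refine ⟨hM, fun N hN hMN e he => ?_⟩
  by_contra heM
  exact h e heM (hN.mono (Finset.insert_subset he hMN))

/-- The invariant of the greedy loop: the selected edges `G` are feasible, no remaining edge shares
an endpoint with them, and no discarded edge can be added to them. -/
structure GreedyInvariant (cls : A × I → K) (cap : K → ℕ) (G E' : Finset (A × I)) : Prop where
  feasible : IsFeasible cls cap G
  disj : ∀ e ∈ E', ∀ f ∈ G, f.1 ≠ e.1 ∧ f.2 ≠ e.2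
  discarded : ∀ e, e ∉ E' → e ∈ G ∨ ¬ IsFeasible cls cap (insert e G)

lemma GreedyInvariant.notMem {G E' : Finset (A × I)} (h : GreedyInvariant cls cap G E')
    {e : A × I} (he : e ∈ E') : e ∉ G :=
  fun heG => (h.disj e he e heG).1 rfl

lemma GreedyInvariant.take {G E' : Finset (A × I)} (h : GreedyInvariant cls cap G E') {e : A × I}
    (he : e ∈ E') (hcap : (G.filter (fun f => cls f = cls e)).card < cap (cls e)) :
    GreedyInvariant cls cap (insert e G) (E'.filter (fun f => ¬ (f.1 = e.1 ∨ f.2 = e.2))) := by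
  refine ⟨h.feasible.insert (h.disj e he) hcap, fun f hf f' hf' => ?_, fun f hf => ?_⟩
  · rw [Finset.mem_filter] at hf
    rcases Finset.mem_insert.1 hf' with rfl | hf'
    · exact ⟨fun h' => hf.2 (Or.inl h'.symm), fun h' => hf.2 (Or.inr h'.symm)⟩
    · exact h.disj f hf.1 f' hf'
  · by_cases hfG : f ∈ insert e G
    · exact Or.inl hfG
    refine Or.inr ?_
    by_cases hfE : f ∈ E'
    · have : f.1 = e.1 ∨ f.2 = e.2 := by
        by_contra hne
        exact hf (Finset.mem_filter.2 ⟨hfE, hne⟩)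
      exact not_isFeasible_insert_of_shared hfG (Finset.mem_insert_self _ _) this
    · rcases h.discarded f hfE with h' | h'
      · exact absurd (Finset.mem_insert_of_mem h') hfG
      · exact fun hfeas => h' (hfeas.mono
          (Finset.insert_subset_insert _ (Finset.subset_insert _ _)))

lemma GreedyInvariant.skip {G E' : Finset (A × I)} (h : GreedyInvariant cls cap G E') {e : A × I}
    (he : e ∈ E') (hcap : ¬ (G.filter (fun f => cls f = cls e)).card < cap (cls e)) :
    GreedyInvariant cls cap G (E'.erase e) := by
  refine ⟨h.feasible, fun f hf => h.disj f (Finset.mem_of_mem_erase hf), fun f hf => ?_⟩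
  by_cases hfe : f = e
  · subst hfe
    exact Or.inr (not_isFeasible_insert_of_full (h.notMem he) hcap)
  · exact h.discarded f fun hfE => hf (Finset.mem_erase.2 ⟨hfe, hfE⟩)

lemma GreedyRun.maximal {w : A × I → ℝ} {G E' out : Finset (A × I)}
    (hrun : GreedyRun cls cap w G E' out) (h : GreedyInvariant cls cap G E') :
    Maximal (IsFeasible cls cap) out := by
  induction hrun with
  | done G =>
    exact h.feasible.maximal fun e he =>
      (h.discarded e (Finset.notMem_empty e)).resolve_left he
  | take G E' out e he _ hcap _ ih => exact ih (h.take he hcap)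
  | skip G E' out e he _ hcap _ ih => exact ih (h.skip he hcap)

lemma GreedyRun.subset {w : A × I → ℝ} {G E' out : Finset (A × I)}
    (hrun : GreedyRun cls cap w G E' out) : G ⊆ out := by
  induction hrun with
  | done G => exact subset_rfl
  | take G E' out e _ _ _ _ ih => exact (Finset.subset_insert _ _).trans ih
  | skip G E' out e _ _ _ _ ih => exact ih

variable [Fintype A] [Fintype I]

lemma greedyInvariant_start : GreedyInvariant cls cap ∅ Finset.univ :=
  ⟨isFeasible_empty, by simp, by simp⟩

lemma IsGreedyMatching.maximal {w : A × I → ℝ} {M : Finset (A × I)}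
    (h : IsGreedyMatching cls cap w M) : Maximal (IsFeasible cls cap) M :=
  GreedyRun.maximal h greedyInvariant_start

end Greedy

/-! ### The benchmark and its gaps -/

namespace GreedyBenchmark

variable {A I K : Type*} [Fintype A] [Fintype I]
    [DecidableEq A] [DecidableEq I] [DecidableEq K]
    {cls : A × I → K} {cap : K → ℕ} {μ : A × I → ℝ} {m : ℕ}

lemma feasible_Gstar (b : GreedyBenchmark cls cap μ m) : IsFeasible cls cap b.Gstar :=
  b.greedy.maximal.1

lemma g_mem_Gstar (b : GreedyBenchmark cls cap μ m) (j : Fin m) : b.g j ∈ b.Gstar :=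
  Finset.mem_image_of_mem _ (Finset.mem_univ j)

lemma top_subset_Gstar (b : GreedyBenchmark cls cap μ m) (j : ℕ) : b.top j ⊆ b.Gstar :=
  Finset.image_subset_image (Finset.filter_subset _ _)

lemma g_mem_top (b : GreedyBenchmark cls cap μ m) {j : ℕ} {l : Fin m} :
    b.g l ∈ b.top j ↔ l.val < j := by
  simp [top, b.g_injective.eq_iff]

lemma top_mono (b : GreedyBenchmark cls cap μ m) {j l : ℕ} (h : j ≤ l) : b.top j ⊆ b.top l :=
  Finset.image_subset_image fun i hi => by
    simp only [Finset.mem_filter] at hi ⊢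
    exact ⟨hi.1, hi.2.trans_le h⟩

lemma top_zero (b : GreedyBenchmark cls cap μ m) : b.top 0 = ∅ := by
  simp [top]

lemma top_succ (b : GreedyBenchmark cls cap μ m) (j : Fin m) :
    b.top (j.val + 1) = insert (b.g j) (b.top j.val) := by
  ext e
  simp only [top, Finset.mem_image, Finset.mem_filter, Finset.mem_univ, true_and,
    Finset.mem_insert]
  constructor
  · rintro ⟨l, hl, rfl⟩
    rcases Nat.lt_succ_iff_lt_or_eq.1 hl with h | h
    · exact Or.inr ⟨l, h, rfl⟩
    · exact Or.inl (by rw [Fin.ext h])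
  · rintro (rfl | ⟨l, hl, rfl⟩)
    · exact ⟨j, Nat.lt_succ_self _, rfl⟩
    · exact ⟨l, hl.trans (Nat.lt_succ_self _), rfl⟩

lemma top_of_le (b : GreedyBenchmark cls cap μ m) {j : ℕ} (h : m ≤ j) : b.top j = b.Gstar := by
  rw [top, Gstar, Finset.filter_true_of_mem fun l _ => l.isLt.trans_le h]

lemma infeas_mono (b : GreedyBenchmark cls cap μ m) {j l : ℕ} (h : j ≤ l) :
    b.infeas j ⊆ b.infeas l :=
  fun _ he hfeas => he (hfeas.mono (Finset.insert_subset_insert _ (b.top_mono h)))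

lemma eq_of_mem_Gstar (b : GreedyBenchmark cls cap μ m) {e : A × I} (he : e ∈ b.Gstar) :
    e = (e.1, b.istar e.1) :=
  b.feasible_Gstar.1 e he _ (b.istar_mem e.1) rfl

lemma notMem_subopt_of_mem_Gstar (b : GreedyBenchmark cls cap μ m) {e : A × I}
    (he : e ∈ b.Gstar) : e ∉ b.subopt := by
  intro h
  rw [subopt, Set.mem_ofPred_eq, ← b.eq_of_mem_Gstar he] at h
  exact lt_irrefl _ h

lemma gap_of_mem_subopt (b : GreedyBenchmark cls cap μ m) {e : A × I} (he : e ∈ b.subopt) :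
    b.gap e = μ (e.1, b.istar e.1) - μ e := if_pos he

lemma sum_Gstar (b : GreedyBenchmark cls cap μ m) :
    ∑ e ∈ b.Gstar, μ e = ∑ a, μ (a, b.istar a) := by
  have h : b.Gstar = Finset.univ.image fun a => (a, b.istar a) := by
    ext e
    simp only [Finset.mem_image, Finset.mem_univ, true_and]
    constructor
    · exact fun he => ⟨e.1, (b.eq_of_mem_Gstar he).symm⟩
    · rintro ⟨a, rfl⟩
      exact b.istar_mem a
  rw [h, Finset.sum_image fun a _ a' _ h => congrArg Prod.fst h]

/-- An edge that can still be added to the `j` heaviest edges of the benchmark lies at least its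
gap below the next edge `g j`. -/
lemma gap_le_of_notMem_infeas [NeZero m] (b : GreedyBenchmark cls cap μ m)
    (hgap : ∀ e, e ≠ b.g 0 → 0 < b.gap e) {j : Fin m} {e : A × I}
    (hfeas : e ∉ b.infeas j) (htop : e ∉ b.top j) (hne : e ≠ b.g j) :
    e ≠ b.g 0 ∧ b.gap e ≤ μ (b.g j) - μ e := by
  have hfeas' : IsFeasible cls cap (insert e (b.top j)) := not_not.1 hfeas
  have hle : ∀ l : Fin m, b.g l ∉ b.top j → μ (b.g l) ≤ μ (b.g j) := by
    intro l hl
    rw [g_mem_top, not_lt] at hl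
    exact b.antitone hl
  have h0 : e ≠ b.g 0 := by
    rintro rfl
    rw [g_mem_top, not_lt] at htop
    exact hne (by rw [show j = 0 by simpa using htop])
  refine ⟨h0, ?_⟩
  have hpos := hgap e h0
  unfold gap at hpos ⊢
  split_ifs at hpos ⊢ with hS hG hz hL
  · refine sub_le_sub_right ?_ _
    obtain ⟨l, -, hl⟩ := Finset.mem_image.1 (b.istar_mem e.1)
    rw [← hl]
    refine hle l fun hlt => htop ?_
    have : e = b.g l := hfeas'.1 e (Finset.mem_insert_self _ _) _ (Finset.mem_insert_of_mem hlt)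
      (by rw [hl])
    rwa [this]
  · exact absurd hpos (lt_irrefl _)
  · have hc := hG.choose_spec
    rw [hc]
    refine sub_le_sub_right (b.antitone ?_) _
    have h1 : ¬ (hG.choose.val < j.val) := by
      rw [← b.g_mem_top, hc]; exact htop
    have h2 : hG.choose ≠ j := fun h => hne (by rw [← hc, h])
    rw [Fin.le_def]
    have h3 : hG.choose.val ≠ j.val := fun h => h2 (Fin.ext h)
    change j.val ≤ hG.choose.val - 1
    omega
  · have hc := hL.choose_spec
    refine sub_le_sub_right (b.antitone ?_) _
    rw [Fin.le_def]
    by_contra hlt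
    have h1 : e ∈ b.infeas (hL.choose.val + 1) := by
      unfold marginal at hc
      split_ifs at hc with h
      · exact hc
      · exact hc.1
    exact hfeas (b.infeas_mono (by omega) h1)
  · exact absurd hpos (lt_irrefl _)

/-- A greedy matching for weights `w` that differs from the benchmark contains an edge `f` that was
preferred, under `w`, to some benchmark edge lying at least the gap of `f` above `f`: compare the
two runs at the first step at which they differ. -/
lemma exists_preferred_of_greedyRun [NeZero m] (b : GreedyBenchmark cls cap μ m)
    (hgap : ∀ e, e ≠ b.g 0 → 0 < b.gap e) {w : A × I → ℝ} {G E' out : Finset (A × I)}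
    (hrun : GreedyRun cls cap w G E' out) (hinv : GreedyInvariant cls cap G E')
    (j : ℕ) (hG : G = b.top j) (hout : out ≠ b.Gstar) :
    ∃ f ∈ out, f ≠ b.g 0 ∧ ∃ l : Fin m, w (b.g l) ≤ w f ∧ b.gap f ≤ μ (b.g l) - μ f := by
  have hrem : ∀ {G E' : Finset (A × I)} {j : ℕ}, GreedyInvariant cls cap G E' → G = b.top j →
      ∀ h : j < m, b.g ⟨j, h⟩ ∈ E' := by
    intro G E' j hinv hG h
    by_contra hmem
    rcases hinv.discarded _ hmem with h1 | h1
    · rw [hG, g_mem_top] at h1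
      exact lt_irrefl _ h1
    · refine h1 (b.feasible_Gstar.mono (Finset.insert_subset (b.g_mem_Gstar _) ?_))
      rw [hG]
      exact b.top_subset_Gstar j
  induction hrun generalizing j with
  | done G =>
    by_cases h : j < m
    · exact absurd (hrem hinv hG h) (Finset.notMem_empty _)
    · exact absurd (hG.trans (b.top_of_le (not_lt.1 h))) hout
  | take G E' out e he hmax hcap hrun ih =>
    by_cases h : j < m
    · by_cases hej : e = b.g ⟨j, h⟩
      · refine ih (hinv.take he hcap) (j + 1) ?_ hout
        rw [b.top_succ ⟨j, h⟩, hG, hej]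
      · have hfeas : IsFeasible cls cap (insert e (b.top j)) :=
          hG ▸ (hinv.take he hcap).feasible
        have htop : e ∉ b.top j := hG ▸ hinv.notMem he
        obtain ⟨h0, h1⟩ := b.gap_le_of_notMem_infeas hgap (j := ⟨j, h⟩) (not_not.2 hfeas) htop hej
        exact ⟨e, hrun.subset (Finset.mem_insert_self _ _), h0, ⟨j, h⟩,
          hmax _ (hrem hinv hG h), h1⟩
    · rw [b.top_of_le (not_lt.1 h)] at hG
      have hmem : (e.1, b.istar e.1) ∈ G := hG ▸ b.istar_mem e.1
      exact absurd rfl (hinv.disj e he _ hmem).1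
  | skip G E' out e he hmax hcap hrun ih =>
    exact ih (hinv.skip he hcap) j hG hout

lemma exists_preferred [NeZero m] (b : GreedyBenchmark cls cap μ m)
    (hgap : ∀ e, e ≠ b.g 0 → 0 < b.gap e) {w : A × I → ℝ} {M : Finset (A × I)}
    (hM : IsGreedyMatching cls cap w M) (hne : M ≠ b.Gstar) :
    ∃ f ∈ M, f ≠ b.g 0 ∧ ∃ l : Fin m, w (b.g l) ≤ w f ∧ b.gap f ≤ μ (b.g l) - μ f :=
  b.exists_preferred_of_greedyRun hgap hM greedyInvariant_start 0 b.top_zero.symm hne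

/-- Every edge at the agent of the heaviest benchmark edge, other than that edge, is suboptimal. -/
lemma mem_subopt_of_fst_eq [NeZero m] (b : GreedyBenchmark cls cap μ m)
    (hgap : ∀ e, e ≠ b.g 0 → 0 < b.gap e) {e : A × I} (hfeas : IsFeasible cls cap {e})
    (h1 : e.1 = (b.g 0).1) (hne : e ≠ b.g 0) : e ∈ b.subopt := by
  have h0 : b.top (0 : Fin m).val = ∅ := b.top_zero
  have h := (b.gap_le_of_notMem_infeas hgap (j := 0) (e := e)
    (by rw [infeas, Set.mem_ofPred_eq, not_not, h0]; simpa using hfeas)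
    (h0 ▸ Finset.notMem_empty e) hne).2
  have h2 := hgap e hne
  rw [subopt, Set.mem_ofPred_eq, h1, ← b.eq_of_mem_Gstar (b.g_mem_Gstar 0)]
  linarith

end GreedyBenchmark

/-! ### The initial matchings -/

section InitialPlay

variable {A I K : Type*} [Fintype A] [Fintype I] [DecidableEq A] [DecidableEq I] [DecidableEq K]
  {cls : A × I → K} {cap : K → ℕ} {M : ℕ → Finset (A × I)} {p : ℕ}

lemma mem_remainingEdges {j : ℕ} {e : A × I} :
    e ∈ remainingEdges M j ↔ ∀ l, 1 ≤ l → l < j → e ∉ M l := by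
  simp [remainingEdges]

lemma IsInitialPlay.exists_mem (h : IsInitialPlay cls cap M p) (e : A × I) :
    ∃ j ∈ Finset.Icc 1 p, e ∈ M j := by
  by_contra! hne
  have : e ∈ remainingEdges M (p + 1) := mem_remainingEdges.2 fun l h1 h2 =>
    hne l (Finset.mem_Icc.2 ⟨h1, by omega⟩)
  rw [h.covers] at this
  exact Finset.notMem_empty _ this

lemma IsInitialPlay.isFeasible_singleton (h : IsInitialPlay cls cap M p) (e : A × I) :
    IsFeasible cls cap {e} := by
  obtain ⟨j, hj, he⟩ := h.exists_mem e
  exact (h.maximal j hj).1.1.mono (Finset.singleton_subset_iff.2 he)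

lemma IsInitialPlay.eq_of_mem (h : IsInitialPlay cls cap M p) {e : A × I} {j l : ℕ}
    (hj : j ∈ Finset.Icc 1 p) (hl : l ∈ Finset.Icc 1 p) (hej : e ∈ M j) (hel : e ∈ M l) :
    j = l := by
  have key : ∀ {j l : ℕ}, j ∈ Finset.Icc 1 p → l ∈ Finset.Icc 1 p → e ∈ M j → e ∈ M l →
      ¬ j < l := fun hj hl hej hel hlt =>
    mem_remainingEdges.1 ((h.maximal _ hl).1.2 hel) _ (Finset.mem_Icc.1 hj).1 hlt hej
  exact le_antisymm (not_lt.1 (key hl hj hel hej)) (not_lt.1 (key hj hl hej hel))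

lemma IsInitialPlay.nonempty_matching (h : IsInitialPlay cls cap M p) {j : ℕ}
    (hj : j ∈ Finset.Icc 1 p) : (M j).Nonempty := by
  obtain ⟨e, he⟩ := h.nonempty j hj
  by_contra hne
  rw [Finset.not_nonempty_iff_eq_empty] at hne
  have := (h.maximal j hj).2 (y := {e})
    ⟨h.isFeasible_singleton e, Finset.singleton_subset_iff.2 he⟩ (by simp [hne])
  simpa [hne] using this (Finset.mem_singleton_self e)

/-- There are at most as many initial matchings as edges. -/
lemma IsInitialPlay.le_card (h : IsInitialPlay cls cap M p) :
    p ≤ Fintype.card A * Fintype.card I := by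
  rcases Nat.eq_zero_or_pos p with rfl | hp
  · exact Nat.zero_le _
  obtain ⟨e₀, -⟩ := h.nonempty_matching (Finset.mem_Icc.2 ⟨le_rfl, hp⟩)
  have : Nonempty (A × I) := ⟨e₀⟩
  choose! f hf using fun j => h.nonempty_matching (j := j)
  have := Finset.card_le_card_of_injOn (s := Finset.Icc 1 p) (t := (Finset.univ : Finset (A × I)))
    f (fun _ _ => Finset.mem_coe.2 (Finset.mem_univ _)) fun j hj l hl hjl =>
      h.eq_of_mem hj hl (hf j hj) (by rw [hjl]; exact hf l hl)
  simpa using this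

end InitialPlay

/-! ### Elementary estimates -/

lemma Real.log_one_add_le_sqrt {x : ℝ} (hx : 0 ≤ x) : Real.log (1 + x) ≤ Real.sqrt x := by
  rw [Real.log_le_iff_le_exp (by linarith)]
  have h := Real.sum_le_exp_of_nonneg (Real.sqrt_nonneg x) 4
  simp only [Finset.sum_range_succ, Finset.sum_range_zero, Nat.factorial] at h
  norm_num at h
  nlinarith [Real.sq_sqrt hx, Real.sqrt_nonneg x,
    mul_nonneg (Real.sqrt_nonneg x) (sq_nonneg (Real.sqrt x - 3 / 2))]

/-- The bias part of the confidence parameter decays like `1 / √k`. -/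
lemma biasTerm_div_le {τ₀ ζ k : ℕ} (hτ : 1 ≤ τ₀) (hζ : 1 ≤ ζ) (hk : 1 ≤ k) {c : ℝ} (hc : 0 ≤ c) :
    biasTerm τ₀ ζ c k / k ≤ rhoConst τ₀ ζ c / Real.sqrt τ₀ / Real.sqrt k := by
  have hτ' : (1 : ℝ) ≤ τ₀ := by exact_mod_cast hτ
  have hζ' : (1 : ℝ) ≤ ζ := by exact_mod_cast hζ
  have hk' : (1 : ℝ) ≤ k := by exact_mod_cast hk
  have hτ0 : (0 : ℝ) < τ₀ := by linarith
  have hζ0 : (0 : ℝ) < ζ := by linarith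
  have hk0 : (0 : ℝ) < k := by linarith
  set x : ℝ := (k : ℝ) * ζ / τ₀ with hx
  have hx0 : 0 < x := by positivity
  set s := Real.sqrt x with hs
  have hs0 : 0 < s := Real.sqrt_pos.2 hx0
  have hsx : s ^ 2 = x := Real.sq_sqrt hx0.le
  set u : ℝ := (ζ : ℝ) / (ζ + τ₀) with hu
  have hu0 : 0 < u := by positivity
  -- in terms of `x = k ζ / τ₀` the claim reads `u + log (1 + x) ≤ (1 + u) √x`
  have hkey : u + Real.log (1 + x) ≤ (1 + u) * s := by
    rcases le_or_gt 1 s with h1 | h1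
    · have := Real.log_one_add_le_sqrt hx0.le
      nlinarith
    · have hux : u ≤ x / (1 + x) := by
        rw [hu, hx, div_le_div_iff₀ (by positivity) (by positivity)]
        have : (k : ℝ) * ζ / τ₀ * (ζ + τ₀) = k * ζ * ζ / τ₀ + k * ζ := by field_simp
        have h3 : (ζ : ℝ) * (1 + k * ζ / τ₀) = ζ + k * ζ * ζ / τ₀ := by ring
        rw [this, h3]
        nlinarith
      have h2 : x / (1 + x) ≤ s := by
        rw [div_le_iff₀ (by positivity), ← hsx]
        nlinarith [sq_nonneg (s - 1)]
      have hlog : Real.log (1 + x) ≤ x := by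
        have := Real.log_le_sub_one_of_pos (show 0 < 1 + x by linarith)
        linarith
      have h4 : u * (1 - s) ≤ s * (1 - s) :=
        mul_le_mul_of_nonneg_right (hux.trans h2) (by linarith)
      nlinarith
  have hL : biasTerm τ₀ ζ c k / k = c / (2 * ζ * k) * (u + Real.log (1 + x)) := by
    rw [biasTerm, ← hx, hu]
    field_simp
  have hτk : Real.sqrt τ₀ * Real.sqrt τ₀ = τ₀ := Real.mul_self_sqrt hτ0.le
  have hζζ : Real.sqrt ζ * Real.sqrt ζ = ζ := Real.mul_self_sqrt hζ0.le
  have hkk : Real.sqrt k * Real.sqrt k = k := Real.mul_self_sqrt hk0.le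
  have hR : rhoConst τ₀ ζ c / Real.sqrt τ₀ / Real.sqrt k = c / (2 * ζ * k) * ((1 + u) * s) := by
    have h1 : 0 < Real.sqrt τ₀ := Real.sqrt_pos.2 hτ0
    have h2 : 0 < Real.sqrt ζ := Real.sqrt_pos.2 hζ0
    have h3 : 0 < Real.sqrt k := Real.sqrt_pos.2 hk0
    have hs' : s = Real.sqrt k * Real.sqrt ζ / Real.sqrt τ₀ := by
      rw [hs, hx, Real.sqrt_div (by positivity), Real.sqrt_mul hk0.le]
    rw [rhoConst, ← hu, hs']
    have h4 : c / (2 * ζ * k) = c / (2 * (Real.sqrt ζ * Real.sqrt ζ)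
        * (Real.sqrt k * Real.sqrt k)) := by rw [hζζ, hkk]
    rw [h4]
    field_simp
    ring
  rw [hL, hR]
  exact mul_le_mul_of_nonneg_left hkey (by positivity)

/-- If twice the confidence parameter still exceeds the gap, the edge has been selected less often
than its threshold. -/
lemma lt_pullThreshold {m τ₀ ζ n k t : ℕ} (hτ : 1 ≤ τ₀) (hζ : 1 ≤ ζ) (hk : 1 ≤ k)
    (ht : 1 ≤ t) (htn : t ≤ n) {Δ c : ℝ} (hc : 0 ≤ c) (hΔ : 0 < Δ)
    (h : Δ < 2 * confRadius m τ₀ ζ c k t) : (k : ℝ) < pullThreshold m τ₀ ζ n Δ c := by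
  have hk0 : (0 : ℝ) < k := by exact_mod_cast hk
  have hsk : 0 < Real.sqrt k := Real.sqrt_pos.2 hk0
  have hlog : Real.log t ≤ Real.log n :=
    Real.log_le_log (by exact_mod_cast ht) (by exact_mod_cast htn)
  set Z := rhoConst τ₀ ζ c / Real.sqrt τ₀ + Real.sqrt (6 * Real.log n + 4 * Real.log m)
  have hconf : confRadius m τ₀ ζ c k t ≤ Z / Real.sqrt k := by
    rw [add_div]
    refine add_le_add (biasTerm_div_le hτ hζ hk hc) ?_
    rw [← Real.sqrt_div']
    · refine Real.sqrt_le_sqrt ?_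
      rw [div_mul_eq_mul_div, div_mul_eq_mul_div, ← add_div]
      gcongr
    · exact hk0.le
  have h1 : Δ * Real.sqrt k < 2 * Z := by
    have : Δ < 2 * (Z / Real.sqrt k) := h.trans_le (by linarith)
    rwa [← mul_div_assoc, lt_div_iff₀ hsk] at this
  have h2 : (Δ * Real.sqrt k) ^ 2 < (2 * Z) ^ 2 :=
    pow_lt_pow_left₀ h1 (by positivity) two_ne_zero
  rw [mul_pow, Real.sq_sqrt hk0.le] at h2
  rw [pullThreshold, div_mul_eq_mul_div, lt_div_iff₀ (by positivity)]
  nlinarith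

lemma sum_Icc_inv_epochLen_le {τ₀ ζ : ℕ} (hζ : 1 ≤ ζ) {k : ℕ} (hk : 1 ≤ k) :
    ∑ j ∈ Finset.Icc 1 k, 1 / (epochLen τ₀ ζ j : ℝ)
      ≤ 1 / ((ζ : ℝ) + τ₀) + 1 / ζ * (Real.log (τ₀ + ζ * k) - Real.log (τ₀ + ζ)) := by
  have hζ0 : (0 : ℝ) < ζ := by exact_mod_cast hζ
  induction k, hk using Nat.le_induction with
  | base => simp [epochLen, add_comm]
  | succ k hk ih =>
    rw [Finset.sum_Icc_succ_top (by omega)]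
    have hk0 : (0 : ℝ) < k := by exact_mod_cast hk
    have ha : (0 : ℝ) < τ₀ + ζ * k := by positivity
    have hb : (0 : ℝ) < τ₀ + ζ * (k + 1) := by positivity
    have h := Real.one_sub_inv_le_log_of_pos (div_pos hb ha)
    rw [Real.log_div hb.ne' ha.ne', inv_div] at h
    have h2 : 1 - ((τ₀ : ℝ) + ζ * k) / (τ₀ + ζ * (k + 1)) = ζ * (1 / (τ₀ + ζ * (k + 1))) := by
      field_simp; ring
    rw [h2] at h
    have h3 : 1 / ((τ₀ : ℝ) + ζ * (k + 1))
        ≤ 1 / ζ * (Real.log (τ₀ + ζ * (k + 1)) - Real.log (τ₀ + ζ * k)) := by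
      rw [one_div_mul_eq_div, le_div_iff₀ hζ0]
      linarith
    have h4 : ((epochLen τ₀ ζ (k + 1) : ℕ) : ℝ) = τ₀ + ζ * (k + 1) := by simp [epochLen]
    rw [h4]
    push_cast
    rw [mul_sub] at ih h3 ⊢
    linarith

lemma sum_Icc_bias_le_biasTerm {τ₀ ζ : ℕ} (hτ : 1 ≤ τ₀) (hζ : 1 ≤ ζ) (k : ℕ) {c : ℝ}
    (hc : 0 ≤ c) :
    ∑ j ∈ Finset.Icc 1 k, c / 2 * (1 / (epochLen τ₀ ζ j : ℝ)) ≤ biasTerm τ₀ ζ c k := by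
  have hζ0 : (0 : ℝ) < ζ := by exact_mod_cast hζ
  have hτ0 : (0 : ℝ) < τ₀ := by exact_mod_cast hτ
  rw [← Finset.mul_sum, biasTerm]
  refine mul_le_mul_of_nonneg_left ?_ (by positivity)
  rcases Nat.eq_zero_or_pos k with rfl | hk
  · simp; positivity
  refine (sum_Icc_inv_epochLen_le hζ hk).trans ?_
  gcongr
  have h1 : (1 : ℝ) + k * ζ / τ₀ = (τ₀ + ζ * k) / τ₀ := by field_simp
  rw [h1, Real.log_div (by positivity) (by positivity)]
  have : Real.log τ₀ ≤ Real.log (τ₀ + ζ) := Real.log_le_log hτ0 (by linarith)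
  linarith

lemma sum_Icc_inv_epochLen_le_log {τ₀ ζ : ℕ} (hτ : 1 ≤ τ₀) (hζ : 1 ≤ ζ) {n : ℕ} (hn : 1 ≤ n) :
    ∑ k ∈ Finset.Icc 1 n, 1 / (epochLen τ₀ ζ k : ℝ)
      ≤ 1 / ζ * (1 + Real.log ((ζ : ℝ) * ((n : ℝ) - 1) / τ₀ + 1)) := by
  have hζ0 : (0 : ℝ) < ζ := by exact_mod_cast hζ
  have hτ0 : (0 : ℝ) < τ₀ := by exact_mod_cast hτ
  have hn' : (0 : ℝ) ≤ (n : ℝ) - 1 := by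
    have : (1 : ℝ) ≤ n := by exact_mod_cast hn
    linarith
  refine (sum_Icc_inv_epochLen_le hζ hn).trans ?_
  rw [mul_add, mul_one]
  refine add_le_add (one_div_le_one_div_of_le hζ0 (by linarith))
    (mul_le_mul_of_nonneg_left ?_ (by positivity))
  have hn0 : (0 : ℝ) < n := by exact_mod_cast hn
  rw [← Real.log_div (by positivity) (by positivity)]
  refine Real.log_le_log (by positivity) ?_
  have : ((τ₀ : ℝ) + ζ * n) / (τ₀ + ζ) = ζ * (n - 1) / (τ₀ + ζ) + 1 := by field_simp; ring
  rw [this]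
  gcongr
  linarith

/-- An antitone function summed over `k` positive integers is at most its sum over the first `k`
ones. -/
lemma sum_le_sum_Icc_card_of_antitone {f : ℕ → ℝ} (hf : Antitone f) (L : Finset ℕ)
    (hL : ∀ l ∈ L, 1 ≤ l) : ∑ l ∈ L, f l ≤ ∑ j ∈ Finset.Icc 1 L.card, f j := by
  induction L using Finset.induction_on_max with
  | empty => simp
  | insert a s hmax ih =>
    have ha : a ∉ s := fun h => lt_irrefl _ (hmax a h)
    rw [Finset.sum_insert ha, Finset.card_insert_of_notMem ha, Finset.sum_Icc_succ_top (by omega),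
      add_comm]
    have hcard : s.card + 1 ≤ a := by
      have hsub : s ⊆ Finset.Ico 1 a := fun l hl =>
        Finset.mem_Ico.2 ⟨hL l (Finset.mem_insert_of_mem hl), hmax l hl⟩
      have h1 := Finset.card_le_card hsub
      have h2 := hL a (Finset.mem_insert_self _ _)
      rw [Nat.card_Ico] at h1
      omega
    exact add_le_add (ih fun l hl => hL l (Finset.mem_insert_of_mem hl)) (hf hcard)

lemma antitone_bias_epochLen {τ₀ ζ : ℕ} (hτ : 1 ≤ τ₀) {c : ℝ} (hc : 0 ≤ c) :
    Antitone fun k : ℕ => c / 2 * (1 / (epochLen τ₀ ζ k : ℝ)) := by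
  intro k l h
  have h1 : 0 < epochLen τ₀ ζ k := by simp only [epochLen]; omega
  have h2 : (epochLen τ₀ ζ k : ℝ) ≤ epochLen τ₀ ζ l := by
    exact_mod_cast Nat.add_le_add_left (Nat.mul_le_mul_left ζ h) τ₀
  have h3 : (0 : ℝ) < epochLen τ₀ ζ k := by exact_mod_cast h1
  exact mul_le_mul_of_nonneg_left (one_div_le_one_div_of_le h3 h2) (by positivity)

lemma sum_Icc_one_div_le_one_add_log (n : ℕ) :
    ∑ t ∈ Finset.Icc 1 n, 1 / (t : ℝ) ≤ 1 + Real.log n := by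
  have h := harmonic_le_one_add_log n
  rw [harmonic_eq_sum_Icc] at h
  push_cast at h
  simpa using h

/-! ### Rewards within one epoch -/

section EpochLaw

lemma epochAvg_mem_of_forall {A I Ω : Type*} {τ₀ ζ : ℕ} {X : ℕ → A → Ω → ℝ} (hτ : 1 ≤ τ₀)
    {k : ℕ} {e : A × I} {ω : Ω}
    (hX : ∀ s < epochLen τ₀ ζ k, X (epochStart τ₀ ζ k + s) e.1 ω ∈ Set.Icc (0 : ℝ) 1) :
    epochAvg τ₀ ζ X k e ω ∈ Set.Icc (0 : ℝ) 1 := by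
  have hlen : (0 : ℝ) < epochLen τ₀ ζ k := by
    have : 0 < epochLen τ₀ ζ k := by simp only [epochLen]; omega
    exact_mod_cast this
  rw [epochAvg, one_div_mul_eq_div]
  refine ⟨div_nonneg (Finset.sum_nonneg fun s hs => (hX s (Finset.mem_range.1 hs)).1) hlen.le, ?_⟩
  rw [div_le_one hlen]
  simpa using Finset.sum_le_card_nsmul (Finset.range (epochLen τ₀ ζ k)) _ 1
    fun s hs => (hX s (Finset.mem_range.1 hs)).2

variable {A I K : Type*} {Θ : A → Type*} [∀ a, Fintype (Θ a)] [∀ a, DecidableEq (Θ a)]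

lemma MatchingEnv.integrable_reward (E : MatchingEnv A I K Θ) (e : A × I) (x : Θ e.1) :
    Integrable (fun r : ℝ => r) (E.reward e x) := by
  have := E.reward_prob e x
  refine Integrable.of_bound (C := 1) measurable_id.aestronglyMeasurable ?_
  have h : ∀ᵐ r ∂(E.reward e x), r ∈ Set.Icc (0 : ℝ) 1 := E.reward_supp e x
  filter_upwards [h] with r hr
  rw [Real.norm_eq_abs, abs_of_nonneg hr.1]
  exact hr.2

lemma MatchingEnv.integral_reward_mem (E : MatchingEnv A I K Θ) (e : A × I) (x : Θ e.1) :
    ∫ r, r ∂(E.reward e x) ∈ Set.Icc (0 : ℝ) 1 := by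
  have := E.reward_prob e x
  have h : ∀ᵐ r ∂(E.reward e x), r ∈ Set.Icc (0 : ℝ) 1 := E.reward_supp e x
  refine ⟨integral_nonneg_of_ae (h.mono fun r hr => hr.1), ?_⟩
  calc ∫ r, r ∂(E.reward e x) ≤ ∫ _, (1 : ℝ) ∂(E.reward e x) :=
        integral_mono_ae (E.integrable_reward e x) (integrable_const _) (h.mono fun r hr => hr.2)
    _ = 1 := by simp

lemma MatchingEnv.mean_mem (E : MatchingEnv A I K Θ) (e : A × I) :
    E.mean e ∈ Set.Icc (0 : ℝ) 1 := by
  have h := E.stat_mem e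
  refine ⟨Finset.sum_nonneg fun x _ => mul_nonneg (h.1 x) (E.integral_reward_mem e x).1, ?_⟩
  calc E.mean e ≤ ∑ x, E.stat e x := Finset.sum_le_sum fun x _ =>
        mul_le_of_le_one_right (h.1 x) (E.integral_reward_mem e x).2
    _ = 1 := h.2

variable [DecidableEq A] [DecidableEq I] {E : MatchingEnv A I K Θ} {τ₀ ζ n : ℕ}
  {Ω : Type*} [mΩ : MeasurableSpace Ω] {Pr : Measure Ω}
  {ℱ : Filtration ℕ mΩ} {θ : ℕ → (a : A) → Ω → Θ a} {X : ℕ → A → Ω → ℝ}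
  {α : ℕ → Ω → Finset (A × I)}

lemma measurableSet_mixing_event (h : IsEpochMixing E τ₀ ζ n Pr ℱ θ X α) (t : ℕ) (a : A)
    {B : Set ℝ} (hB : MeasurableSet B) (y : Θ a) :
    MeasurableSet {ω | X t a ω ∈ B ∧ θ (t + 1) a ω = y} :=
  ((ℱ.le _) _ (h.reward_adapted t a hB)).inter ((ℱ.le _) _ (h.type_adapted (t + 1) a y))

lemma IsEpochMixing.measurable_reward (h : IsEpochMixing E τ₀ ζ n Pr ℱ θ X α) (t : ℕ) (a : A) :
    Measurable (X t a) :=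
  (h.reward_adapted t a).mono (ℱ.le _) le_rfl

variable [IsProbabilityMeasure Pr]

lemma integrable_of_bdd {m : MeasurableSpace Ω} (hm : m ≤ mΩ) {W : Ω → ℝ} {b : ℝ}
    (hW : Measurable[m] W) (hb : ∀ ω, W ω ∈ Set.Icc 0 b) : Integrable W Pr := by
  refine Integrable.of_bound (C := b) (hW.mono hm le_rfl).aestronglyMeasurable
    (Eventually.of_forall fun ω => ?_)
  rw [Real.norm_eq_abs, abs_of_nonneg (hb ω).1]
  exact (hb ω).2

/-- The one-step law integrated against a weight `W` that is known at the time of the step and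
vanishes where the edge is not played. -/
lemma IsEpochMixing.integral_weight_step (h : IsEpochMixing E τ₀ ζ n Pr ℱ θ X α) {k : ℕ}
    (hk : k ∈ Finset.Icc 1 n) {s : ℕ} (hs : s < epochLen τ₀ ζ k) (e : A × I) {W : Ω → ℝ} {b : ℝ}
    (hW : Measurable[ℱ (epochStart τ₀ ζ k + s)] W) (hb : ∀ ω, W ω ∈ Set.Icc 0 b)
    (hW0 : ∀ ω, e ∉ α k ω → W ω = 0) {B : Set ℝ} (hB : MeasurableSet B) (y : Θ e.1) :
    ∫ ω, W ω * Set.indicator {ω' | X (epochStart τ₀ ζ k + s) e.1 ω' ∈ B ∧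
        θ (epochStart τ₀ ζ k + s + 1) e.1 ω' = y} (fun _ => (1 : ℝ)) ω ∂Pr
      = ∑ x, (∫ ω, W ω * Set.indicator {ω' | θ (epochStart τ₀ ζ k + s) e.1 ω' = x}
          (fun _ => (1 : ℝ)) ω ∂Pr) * ((E.reward e x).real B * E.P e x y) := by
  set t := epochStart τ₀ ζ k + s
  set g : Ω → ℝ := Set.indicator {ω' | X t e.1 ω' ∈ B ∧ θ (t + 1) e.1 ω' = y} (fun _ => (1 : ℝ))
  have hg : Integrable g Pr :=
    (integrable_const (1 : ℝ)).indicator (measurableSet_mixing_event h t e.1 hB y)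
  have hpull := condExp_stronglyMeasurable_mul_of_bound (ℱ.le t) (f := W) (g := g) (μ := Pr)
    hW.stronglyMeasurable hg b (Eventually.of_forall fun ω => by
      rw [Real.norm_eq_abs, abs_of_nonneg (hb ω).1]; exact (hb ω).2)
  have hint : ∀ x, Integrable (fun ω => W ω * Set.indicator {ω' | θ t e.1 ω' = x}
      (fun _ => (1 : ℝ)) ω) Pr := by
    intro x
    have : (fun ω => W ω * Set.indicator {ω' | θ t e.1 ω' = x} (fun _ => (1 : ℝ)) ω)
        = Set.indicator {ω' | θ t e.1 ω' = x} W := by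
      funext ω
      by_cases hx : θ t e.1 ω = x <;> simp [Set.indicator, hx]
    rw [this]
    exact (integrable_of_bdd (ℱ.le t) hW hb).indicator ((ℱ.le t) _ (h.type_adapted t e.1 x))
  calc ∫ ω, W ω * g ω ∂Pr = ∫ ω, (Pr[W * g | ℱ t]) ω ∂Pr := (integral_condExp (ℱ.le t)).symm
    _ = ∫ ω, ∑ x, (W ω * Set.indicator {ω' | θ t e.1 ω' = x} (fun _ => (1 : ℝ)) ω)
          * ((E.reward e x).real B * E.P e x y) ∂Pr := by
        refine integral_congr_ae ?_
        filter_upwards [hpull, h.law k hk s hs e B hB y] with ω h1 h2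
        rw [h1, Pi.mul_apply]
        by_cases hω : e ∈ α k ω
        · rw [h2 hω, Finset.sum_eq_single (θ t e.1 ω)]
          · simp only [Set.indicator, Set.mem_ofPred_eq, if_true, mul_one]
            rfl
          · intro x _ hx
            simp [Set.indicator, Ne.symm hx]
          · simp
        · simp [hW0 ω hω]
    _ = _ := by
        rw [integral_finsetSum _ fun x _ => (hint x).mul_const _]
        exact Finset.sum_congr rfl fun x _ => integral_mul_const _ _

/-- Under a weight known at its beginning, the types move by the transition matrix. -/
lemma IsEpochMixing.occupation_step (h : IsEpochMixing E τ₀ ζ n Pr ℱ θ X α) {k : ℕ}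
    (hk : k ∈ Finset.Icc 1 n) {s : ℕ} (hs : s < epochLen τ₀ ζ k) (e : A × I) {W : Ω → ℝ} {b : ℝ}
    (hW : Measurable[ℱ (epochStart τ₀ ζ k + s)] W) (hb : ∀ ω, W ω ∈ Set.Icc 0 b)
    (hW0 : ∀ ω, e ∉ α k ω → W ω = 0) :
    (fun y => ∫ ω, W ω * Set.indicator {ω' | θ (epochStart τ₀ ζ k + s + 1) e.1 ω' = y}
        (fun _ => (1 : ℝ)) ω ∂Pr)
      = (fun x => ∫ ω, W ω * Set.indicator {ω' | θ (epochStart τ₀ ζ k + s) e.1 ω' = x}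
        (fun _ => (1 : ℝ)) ω ∂Pr) ᵥ* E.P e := by
  funext y
  have := h.integral_weight_step hk hs e hW hb hW0 MeasurableSet.univ y
  simp only [Set.mem_univ, true_and] at this
  rw [this]
  refine Finset.sum_congr rfl fun x _ => ?_
  have := E.reward_prob e x
  simp

/-- The weighted law of the reward of a step is the mixture of the reward distributions over the
weighted occupation of the types. -/
lemma IsEpochMixing.integral_weight_reward_mem (h : IsEpochMixing E τ₀ ζ n Pr ℱ θ X α) {k : ℕ}
    (hk : k ∈ Finset.Icc 1 n) {s : ℕ} (hs : s < epochLen τ₀ ζ k) (e : A × I) {W : Ω → ℝ} {b : ℝ}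
    (hW : Measurable[ℱ (epochStart τ₀ ζ k + s)] W) (hb : ∀ ω, W ω ∈ Set.Icc 0 b)
    (hW0 : ∀ ω, e ∉ α k ω → W ω = 0) {B : Set ℝ} (hB : MeasurableSet B) :
    ∫ ω, W ω * Set.indicator {ω' | X (epochStart τ₀ ζ k + s) e.1 ω' ∈ B} (fun _ => (1 : ℝ)) ω ∂Pr
      = ∑ x, (∫ ω, W ω * Set.indicator {ω' | θ (epochStart τ₀ ζ k + s) e.1 ω' = x}
          (fun _ => (1 : ℝ)) ω ∂Pr) * (E.reward e x).real B := by
  set t := epochStart τ₀ ζ k + s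
  have hWi := integrable_of_bdd (Pr := Pr) (ℱ.le t) hW hb
  calc _ = ∫ ω, ∑ y, W ω * Set.indicator {ω' | X t e.1 ω' ∈ B ∧ θ (t + 1) e.1 ω' = y}
        (fun _ => (1 : ℝ)) ω ∂Pr := by
        refine integral_congr_ae (Eventually.of_forall fun ω => ?_)
        by_cases hω : X t e.1 ω ∈ B
        · simp [Set.indicator, hω]
        · simp [Set.indicator, hω]
    _ = ∑ y, ∑ x, (∫ ω, W ω * Set.indicator {ω' | θ t e.1 ω' = x} (fun _ => (1 : ℝ)) ω ∂Pr)
          * ((E.reward e x).real B * E.P e x y) := by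
        rw [integral_finsetSum]
        · exact Finset.sum_congr rfl fun y _ => h.integral_weight_step hk hs e hW hb hW0 hB y
        · intro y _
          have : (fun ω => W ω * Set.indicator {ω' | X t e.1 ω' ∈ B ∧ θ (t + 1) e.1 ω' = y}
              (fun _ => (1 : ℝ)) ω)
              = Set.indicator {ω' | X t e.1 ω' ∈ B ∧ θ (t + 1) e.1 ω' = y} W := by
            funext ω
            by_cases hx : X t e.1 ω ∈ B ∧ θ (t + 1) e.1 ω = y <;> simp [Set.indicator, hx]
          rw [this]
          exact hWi.indicator (measurableSet_mixing_event h t e.1 hB y)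
    _ = _ := by
        rw [Finset.sum_comm]
        refine Finset.sum_congr rfl fun x _ => ?_
        rw [← Finset.mul_sum, ← Finset.mul_sum,
          Matrix.sum_row_of_mem_rowStochastic (E.stochastic e), mul_one]

/-- The rewards of a played edge lie in `[0, 1]` almost surely. -/
lemma IsEpochMixing.ae_reward_mem (h : IsEpochMixing E τ₀ ζ n Pr ℱ θ X α) {k : ℕ}
    (hk : k ∈ Finset.Icc 1 n) {s : ℕ} (hs : s < epochLen τ₀ ζ k) (e : A × I) :
    ∀ᵐ ω ∂Pr, e ∈ α k ω → X (epochStart τ₀ ζ k + s) e.1 ω ∈ Set.Icc (0 : ℝ) 1 := by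
  set t := epochStart τ₀ ζ k + s
  set W : Ω → ℝ := Set.indicator {ω | e ∈ α k ω} (fun _ => 1)
  have hS := h.policy_adapted k hk e
  have hW : Measurable[ℱ t] W :=
    Measurable.indicator measurable_const (ℱ.mono (Nat.le_add_right _ s) _ hS)
  have hb : ∀ ω, W ω ∈ Set.Icc (0 : ℝ) 1 := fun ω => by
    by_cases hω : e ∈ α k ω <;> simp [W, hω]
  have hB : MeasurableSet (Set.Icc (0 : ℝ) 1)ᶜ := measurableSet_Icc.compl
  have key := h.integral_weight_reward_mem hk hs e hW hb
    (fun ω hω => by simp [W, hω]) hB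
  have hzero : ∀ x, (E.reward e x).real (Set.Icc (0 : ℝ) 1)ᶜ = 0 := fun x => by
    simp [measureReal_def, E.reward_supp e x]
  simp only [hzero, mul_zero, Finset.sum_const_zero] at key
  have hmeas : MeasurableSet ({ω | e ∈ α k ω} ∩ {ω | X t e.1 ω ∈ (Set.Icc (0 : ℝ) 1)ᶜ}) :=
    ((ℱ.le _) _ hS).inter ((ℱ.le _) _ (h.reward_adapted t e.1 hB))
  have h1 : (fun ω => W ω * Set.indicator {ω' | X t e.1 ω' ∈ (Set.Icc (0 : ℝ) 1)ᶜ}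
      (fun _ => (1 : ℝ)) ω)
      = Set.indicator ({ω | e ∈ α k ω} ∩ {ω | X t e.1 ω ∈ (Set.Icc (0 : ℝ) 1)ᶜ}) fun _ => 1 := by
    funext ω
    by_cases h1 : e ∈ α k ω <;> by_cases h2 : X t e.1 ω ∈ (Set.Icc (0 : ℝ) 1)ᶜ <;>
      simp only [W, Set.indicator, Set.mem_inter_iff, Set.mem_ofPred_eq, h1, h2] <;> simp
  rw [h1, integral_indicator_const _ hmeas, smul_eq_mul, mul_one, measureReal_eq_zero_iff] at key
  have : ∀ᵐ ω ∂Pr, ω ∉ {ω | e ∈ α k ω} ∩ {ω | X t e.1 ω ∈ (Set.Icc (0 : ℝ) 1)ᶜ} :=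
    measure_eq_zero_iff_ae_notMem.1 key
  filter_upwards [this] with ω hω hα
  by_contra hX
  exact hω ⟨hα, hX⟩

lemma IsEpochMixing.integrable_weight_mul_reward (h : IsEpochMixing E τ₀ ζ n Pr ℱ θ X α) {k : ℕ}
    (hk : k ∈ Finset.Icc 1 n) {s : ℕ} (hs : s < epochLen τ₀ ζ k) (e : A × I) {W : Ω → ℝ} {b : ℝ}
    (hW : Measurable W) (hb : ∀ ω, W ω ∈ Set.Icc 0 b) (hW0 : ∀ ω, e ∉ α k ω → W ω = 0) :
    Integrable (fun ω => W ω * X (epochStart τ₀ ζ k + s) e.1 ω) Pr := by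
  refine Integrable.of_bound (C := b)
    (hW.mul (h.measurable_reward _ _)).aestronglyMeasurable ?_
  filter_upwards [h.ae_reward_mem hk hs e] with ω hω
  by_cases hα : e ∈ α k ω
  · rw [Real.norm_eq_abs, abs_of_nonneg (mul_nonneg (hb ω).1 (hω hα).1)]
    exact (mul_le_of_le_one_right (hb ω).1 (hω hα).2).trans (hb ω).2
  · simp [hW0 ω hα, (hb ω).1.trans (hb ω).2]

/-- The weighted expected reward of a step. -/
lemma IsEpochMixing.integral_weight_mul_reward (h : IsEpochMixing E τ₀ ζ n Pr ℱ θ X α) {k : ℕ}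
    (hk : k ∈ Finset.Icc 1 n) {s : ℕ} (hs : s < epochLen τ₀ ζ k) (e : A × I) {W : Ω → ℝ} {b : ℝ}
    (hW : Measurable[ℱ (epochStart τ₀ ζ k + s)] W) (hb : ∀ ω, W ω ∈ Set.Icc 0 b)
    (hW0 : ∀ ω, e ∉ α k ω → W ω = 0) :
    ∫ ω, W ω * X (epochStart τ₀ ζ k + s) e.1 ω ∂Pr
      = (fun x => ∫ ω, W ω * Set.indicator {ω' | θ (epochStart τ₀ ζ k + s) e.1 ω' = x}
        (fun _ => (1 : ℝ)) ω ∂Pr) ⬝ᵥ fun x => ∫ r, r ∂(E.reward e x) := by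
  set t := epochStart τ₀ ζ k + s
  set β : Θ e.1 → ℝ := fun x => ∫ ω, W ω * Set.indicator {ω' | θ t e.1 ω' = x}
    (fun _ => (1 : ℝ)) ω ∂Pr with hβ
  have hβ0 : ∀ x, 0 ≤ β x := fun x => integral_nonneg fun ω =>
    mul_nonneg (hb ω).1 (Set.indicator_nonneg (fun _ _ => zero_le_one) _)
  have hWm : Measurable W := hW.mono (ℱ.le t) le_rfl
  have hX : Measurable (X t e.1) := h.measurable_reward _ _
  have hWi := integrable_of_bdd (Pr := Pr) (ℱ.le t) hW hb
  -- both sides are integrals of the identity with respect to one and the same measure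
  have hmeas : (Pr.withDensity fun ω => ENNReal.ofReal (W ω)).map (X t e.1)
      = ∑ x, ENNReal.ofReal (β x) • E.reward e x := by
    ext B hB
    have h1 := h.integral_weight_reward_mem hk hs e hW hb hW0 hB
    have h2 : (fun ω => W ω * Set.indicator {ω' | X t e.1 ω' ∈ B} (fun _ => (1 : ℝ)) ω)
        = Set.indicator (X t e.1 ⁻¹' B) W := by
      funext ω
      by_cases hx : X t e.1 ω ∈ B <;> simp [Set.indicator, hx]
    rw [h2, integral_indicator (hX hB)] at h1
    rw [Measure.map_apply hX hB, withDensity_apply _ (hX hB),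
      ← ofReal_integral_eq_lintegral_ofReal hWi.integrableOn (Eventually.of_forall fun ω =>
        (hb ω).1), h1, ENNReal.ofReal_sum_of_nonneg fun x _ =>
        mul_nonneg (hβ0 x) measureReal_nonneg]
    simp only [Measure.coe_finsetSum, Finset.sum_apply, Measure.smul_apply, smul_eq_mul]
    refine Finset.sum_congr rfl fun x _ => ?_
    have := E.reward_prob e x
    rw [ENNReal.ofReal_mul (hβ0 x), ofReal_measureReal]
  calc ∫ ω, W ω * X t e.1 ω ∂Pr
      = ∫ ω, X t e.1 ω ∂(Pr.withDensity fun ω => ENNReal.ofReal (W ω)) := by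
        rw [integral_withDensity_eq_integral_toReal_smul hWm.ennreal_ofReal
          (Eventually.of_forall fun ω => ENNReal.ofReal_lt_top)]
        refine integral_congr_ae (Eventually.of_forall fun ω => ?_)
        simp [ENNReal.toReal_ofReal (hb ω).1]
    _ = ∫ r, r ∂((Pr.withDensity fun ω => ENNReal.ofReal (W ω)).map (X t e.1)) :=
        (integral_map hX.aemeasurable measurable_id.aestronglyMeasurable).symm
    _ = _ := by
        rw [hmeas, integral_finsetSum_measure fun x _ =>
          (E.integrable_reward e x).smul_measure ENNReal.ofReal_ne_top]
        refine Finset.sum_congr rfl fun x _ => ?_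
        rw [integral_smul_measure, ENNReal.toReal_ofReal (hβ0 x), smul_eq_mul]

lemma IsEpochMixing.ae_epochAvg_mem (h : IsEpochMixing E τ₀ ζ n Pr ℱ θ X α) (hτ : 1 ≤ τ₀) {k : ℕ}
    (hk : k ∈ Finset.Icc 1 n) (e : A × I) :
    ∀ᵐ ω ∂Pr, e ∈ α k ω → epochAvg τ₀ ζ X k e ω ∈ Set.Icc (0 : ℝ) 1 := by
  have : ∀ᵐ ω ∂Pr, ∀ s : ℕ, s < epochLen τ₀ ζ k → e ∈ α k ω →
      X (epochStart τ₀ ζ k + s) e.1 ω ∈ Set.Icc (0 : ℝ) 1 := by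
    rw [ae_all_iff]
    intro s
    by_cases hs : s < epochLen τ₀ ζ k
    · filter_upwards [h.ae_reward_mem hk hs e] with ω hω _ using hω
    · exact Eventually.of_forall fun ω hs' => absurd hs' hs
  filter_upwards [this] with ω hω hα
  exact epochAvg_mem_of_forall hτ fun s hs => hω s hs hα

/-- The expected average reward of an epoch, under any weight known at the beginning of the epoch,
is within half the mixing constant, divided by the length of the epoch, of the stationary
reward. -/
lemma IsEpochMixing.abs_integral_weight_mul_epochAvg_sub_le
    (h : IsEpochMixing E τ₀ ζ n Pr ℱ θ X α) (hτ : 1 ≤ τ₀) {k : ℕ} (hk : k ∈ Finset.Icc 1 n)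
    (e : A × I) {c : ℝ} (hc : IsMixingConstant (E.P e) (E.stat e) c) {W : Ω → ℝ} {b : ℝ}
    (hW : Measurable[ℱ (epochStart τ₀ ζ k)] W) (hb : ∀ ω, W ω ∈ Set.Icc 0 b)
    (hW0 : ∀ ω, e ∉ α k ω → W ω = 0) :
    |∫ ω, W ω * epochAvg τ₀ ζ X k e ω ∂Pr - E.mean e * ∫ ω, W ω ∂Pr|
      ≤ c / 2 * (1 / (epochLen τ₀ ζ k : ℝ)) * ∫ ω, W ω ∂Pr := by
  set t₀ := epochStart τ₀ ζ k
  set N := epochLen τ₀ ζ k with hN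
  have hlen : (0 : ℝ) < N := by
    have : 0 < epochLen τ₀ ζ k := by simp only [epochLen]; omega
    exact_mod_cast this
  set β : ℕ → Θ e.1 → ℝ := fun s x => ∫ ω, W ω * Set.indicator {ω' | θ (t₀ + s) e.1 ω' = x}
    (fun _ => (1 : ℝ)) ω ∂Pr with hβ
  have hWs : ∀ s, Measurable[ℱ (t₀ + s)] W := fun s =>
    hW.mono (ℱ.mono (Nat.le_add_right _ s)) le_rfl
  have hWm : Measurable W := hW.mono (ℱ.le t₀) le_rfl
  have hβ0 : ∀ x, 0 ≤ β 0 x := fun x => integral_nonneg fun ω =>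
    mul_nonneg (hb ω).1 (Set.indicator_nonneg (fun _ _ => zero_le_one) _)
  have hβpow : ∀ s ≤ N, β s = β 0 ᵥ* (E.P e) ^ s := by
    intro s hs
    induction s with
    | zero => simp
    | succ s ih =>
      rw [pow_succ, ← Matrix.vecMul_vecMul, ← ih (by omega)]
      exact h.occupation_step hk (by omega) e (hWs s) hb hW0
  have hβsum : ∑ x, β 0 x = ∫ ω, W ω ∂Pr := by
    simp only [hβ]
    rw [← integral_finsetSum]
    · refine integral_congr_ae (Eventually.of_forall fun ω => ?_)
      simp [Set.indicator]
    · intro x _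
      have : (fun ω => W ω * Set.indicator {ω' | θ (t₀ + 0) e.1 ω' = x} (fun _ => (1 : ℝ)) ω)
          = Set.indicator {ω' | θ (t₀ + 0) e.1 ω' = x} W := by
        funext ω
        simp [Set.indicator]
      rw [this]
      exact (integrable_of_bdd (ℱ.le t₀) hW hb).indicator ((ℱ.le _) _ (h.type_adapted _ e.1 x))
  set ρ : Θ e.1 → ℝ := fun x => ∫ r, r ∂(E.reward e x)
  have hmix := hc.abs_sum_dotProduct_sub_le (E.stochastic e) (E.stat_mem e) hβ0
    (ρ := ρ) (fun x => E.integral_reward_mem e x) N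
  have hsum : ∑ s ∈ Finset.range N, (β 0 ᵥ* (E.P e) ^ s) ⬝ᵥ ρ
      = N * ∫ ω, W ω * epochAvg τ₀ ζ X k e ω ∂Pr := by
    have h1 : ∀ ω, W ω * epochAvg τ₀ ζ X k e ω
        = 1 / (N : ℝ) * ∑ s ∈ Finset.range N, W ω * X (t₀ + s) e.1 ω := by
      intro ω
      rw [epochAvg, ← Finset.mul_sum]
      ring
    simp only [h1]
    rw [integral_const_mul, integral_finsetSum _ fun s hs =>
      h.integrable_weight_mul_reward hk (Finset.mem_range.1 hs) e hWm hb hW0]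
    rw [← mul_assoc, mul_one_div_cancel hlen.ne', one_mul]
    refine Finset.sum_congr rfl fun s hs => ?_
    rw [← hβpow s (Finset.mem_range.1 hs).le]
    exact (h.integral_weight_mul_reward hk (Finset.mem_range.1 hs) e (hWs s) hb hW0).symm
  rw [hsum, hβsum, ← mul_sub, abs_mul, abs_of_pos hlen] at hmix
  have h2 : E.mean e = E.stat e ⬝ᵥ ρ := rfl
  rw [h2, mul_comm (E.stat e ⬝ᵥ ρ)]
  calc _ ≤ (∫ ω, W ω ∂Pr) * (c / 2) / N := by
        rw [le_div_iff₀ hlen, mul_comm]; exact hmix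
    _ = _ := by ring

end EpochLaw

/-! ### Concentration of the empirical means -/

/-- The chord of `y ↦ exp (l y)` over `[-1, 1]` lies above its graph. -/
lemma exp_mul_le_cosh_add_mul_sinh (l : ℝ) {y : ℝ} (hy : y ∈ Set.Icc (-1 : ℝ) 1) :
    Real.exp (l * y) ≤ Real.cosh l + y * Real.sinh l := by
  have h := convexOn_exp.2 (Set.mem_univ l) (Set.mem_univ (-l))
    (show (0 : ℝ) ≤ (1 + y) / 2 by linarith [hy.1]) (show (0 : ℝ) ≤ (1 - y) / 2 by linarith [hy.2])
    (by ring)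
  simp only [smul_eq_mul] at h
  rw [Real.cosh_eq, Real.sinh_eq]
  calc Real.exp (l * y) = Real.exp ((1 + y) / 2 * l + (1 - y) / 2 * -l) := by congr 1; ring
    _ ≤ _ := h
    _ = _ := by ring

section Azuma

variable {Ω : Type*} [mΩ : MeasurableSpace Ω] {Pr : Measure Ω} [IsProbabilityMeasure Pr]
  {𝒢 : ℕ → MeasurableSpace Ω} {S : ℕ → Set Ω} {Y : ℕ → Ω → ℝ} {n : ℕ}

/-- The exponential supermartingale of increments `Y l` that count only on the events `S l`, each
such increment being compensated by `l² / 2`. -/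
lemma integral_exp_sum_indicator_le_one (h𝒢 : ∀ l, 𝒢 l ≤ mΩ) (hmono : Monotone 𝒢)
    (hS : ∀ l ∈ Finset.Icc 1 n, MeasurableSet[𝒢 l] (S l))
    (hY : ∀ l ∈ Finset.Icc 1 n, Measurable[𝒢 (l + 1)] (Y l))
    (hYb : ∀ l ω, Y l ω ∈ Set.Icc (-1 : ℝ) 1)
    (hYint : ∀ l ∈ Finset.Icc 1 n, ∀ (W : Ω → ℝ) (b : ℝ), Measurable[𝒢 l] W →
      (∀ ω, W ω ∈ Set.Icc 0 b) → (∀ ω ∉ S l, W ω = 0) → ∫ ω, W ω * Y l ω ∂Pr ≤ 0)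
    {a : ℝ} (ha : 0 ≤ a) {t : ℕ} (ht : t ≤ n + 1) :
    ∫ ω, Real.exp (∑ l ∈ Finset.Ico 1 t,
      (S l).indicator (fun ω => a * Y l ω - a ^ 2 / 2) ω) ∂Pr ≤ 1 := by
  set V : ℕ → Ω → ℝ := fun t ω => Real.exp (∑ l ∈ Finset.Ico 1 t,
    (S l).indicator (fun ω => a * Y l ω - a ^ 2 / 2) ω) with hV
  have hVm : ∀ t ≤ n + 1, Measurable[𝒢 t] (V t) := by
    intro t ht
    refine Real.measurable_exp.comp (Finset.measurable_fun_sum _ fun l hl => ?_)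
    rw [Finset.mem_Ico] at hl
    have hl' : l ∈ Finset.Icc 1 n := Finset.mem_Icc.2 ⟨hl.1, by omega⟩
    exact Measurable.indicator
      ((((hY l hl').mono (hmono (by omega)) le_rfl).const_mul a).sub_const _)
      (hmono (by omega) _ (hS l hl'))
  have hVb : ∀ (t : ℕ) ω, V t ω ∈ Set.Icc 0 (Real.exp (t * a)) := by
    intro t ω
    refine ⟨(Real.exp_pos _).le, Real.exp_le_exp.2 ?_⟩
    have h1 : ∀ l ∈ Finset.Ico 1 t, (S l).indicator (fun ω => a * Y l ω - a ^ 2 / 2) ω ≤ a := by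
      intro l _
      have h2 : a * Y l ω ≤ a := mul_le_of_le_one_right ha (hYb l ω).2
      by_cases hω : ω ∈ S l
      · rw [Set.indicator_of_mem hω]
        have := sq_nonneg a
        linarith
      · rw [Set.indicator_of_notMem hω]
        exact ha
    refine (Finset.sum_le_card_nsmul _ _ _ h1).trans ?_
    rw [nsmul_eq_mul, Nat.card_Ico]
    refine mul_le_mul_of_nonneg_right ?_ ha
    exact_mod_cast Nat.sub_le _ _
  induction t with
  | zero => simp
  | succ t ih =>
    rcases Nat.eq_zero_or_pos t with rfl | htpos
    · simp
    have htn : t ∈ Finset.Icc 1 n := Finset.mem_Icc.2 ⟨htpos, by omega⟩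
    have ih' := ih (by omega)
    set W : Ω → ℝ := (S t).indicator (V t) with hW
    have hWm : Measurable[𝒢 t] W := (hVm t (by omega)).indicator (hS t htn)
    have hWb : ∀ ω, W ω ∈ Set.Icc 0 (Real.exp (t * a)) := fun ω => by
      by_cases hω : ω ∈ S t
      · simp only [hW, Set.indicator_of_mem hω]; exact hVb t ω
      · simp only [hW, Set.indicator_of_notMem hω]; exact ⟨le_rfl, (Real.exp_pos _).le⟩
    have hWi : Integrable W Pr := integrable_of_bdd (h𝒢 t) hWm hWb
    have hVi : Integrable (V t) Pr := integrable_of_bdd (h𝒢 t) (hVm t (by omega)) (hVb t)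
    have hWYi : Integrable (fun ω => W ω * Y t ω) Pr :=
      hWi.mul_bdd (c := 1) ((hY t htn).mono (h𝒢 _) le_rfl).aestronglyMeasurable
        (Eventually.of_forall fun ω => by
          rw [Real.norm_eq_abs, abs_le]; exact hYb t ω)
    have hsinh : 0 ≤ Real.sinh a := Real.sinh_nonneg_iff.2 ha
    have hcosh : Real.cosh a ≤ Real.exp (a ^ 2 / 2) := Real.cosh_le_exp_half_sq a
    have hee : Real.exp (-(a ^ 2 / 2)) * Real.exp (a ^ 2 / 2) = 1 := by
      rw [← Real.exp_add]; simp
    have hpt : ∀ ω, V (t + 1) ω ≤ V t ω - W ω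
        + Real.exp (-(a ^ 2 / 2)) * (Real.cosh a * W ω + Real.sinh a * (W ω * Y t ω)) := by
      intro ω
      simp only [hV, Finset.sum_Ico_succ_top htpos, Real.exp_add]
      by_cases hω : ω ∈ S t
      · simp only [hW, Set.indicator_of_mem hω, hV, sub_self, zero_add]
        have h1 := exp_mul_le_cosh_add_mul_sinh a (hYb t ω)
        rw [sub_eq_add_neg, Real.exp_add]
        have h2 := mul_le_mul_of_nonneg_left h1
          (mul_nonneg (Real.exp_pos (∑ l ∈ Finset.Ico 1 t,
            (S l).indicator (fun ω => a * Y l ω - a ^ 2 / 2) ω)).le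
            (Real.exp_pos (-(a ^ 2 / 2))).le)
        refine le_trans (le_of_eq ?_) (h2.trans (le_of_eq ?_)) <;> ring
      · simp [hW, Set.indicator_of_notMem hω]
    have hVi' : Integrable (V (t + 1)) Pr := integrable_of_bdd (h𝒢 _) (hVm _ ht) (hVb _)
    have hi1 : Integrable (fun ω => V t ω - W ω) Pr := hVi.sub hWi
    have hi2 : Integrable (fun ω => Real.cosh a * W ω + Real.sinh a * (W ω * Y t ω)) Pr :=
      (hWi.const_mul _).add (hWYi.const_mul _)
    calc ∫ ω, V (t + 1) ω ∂Pr
        ≤ ∫ ω, (V t ω - W ω + Real.exp (-(a ^ 2 / 2))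
            * (Real.cosh a * W ω + Real.sinh a * (W ω * Y t ω))) ∂Pr :=
          integral_mono hVi' (hi1.add (hi2.const_mul _)) hpt
      _ = ∫ ω, V t ω ∂Pr - ∫ ω, W ω ∂Pr + Real.exp (-(a ^ 2 / 2))
            * (Real.cosh a * ∫ ω, W ω ∂Pr + Real.sinh a * ∫ ω, W ω * Y t ω ∂Pr) := by
          rw [integral_add hi1 (hi2.const_mul _), integral_sub hVi hWi, integral_const_mul,
            integral_add (hWi.const_mul _) (hWYi.const_mul _), integral_const_mul,
            integral_const_mul]
      _ ≤ ∫ ω, V t ω ∂Pr - ∫ ω, W ω ∂Pr + Real.exp (-(a ^ 2 / 2))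
            * (Real.exp (a ^ 2 / 2) * ∫ ω, W ω ∂Pr + 0) := by
          have h1 : 0 ≤ ∫ ω, W ω ∂Pr := integral_nonneg fun ω => (hWb ω).1
          have h2 := hYint t htn W _ hWm hWb fun ω hω => Set.indicator_of_notMem hω _
          gcongr
          exact mul_nonpos_of_nonneg_of_nonpos hsinh h2
      _ = ∫ ω, V t ω ∂Pr := by
          rw [add_zero, ← mul_assoc, hee]; ring
      _ ≤ 1 := ih'

/-- An Azuma inequality for increments that count only on the events `S l`: the bound is in terms
of the number `k` of increments that count. -/
lemma measureReal_sum_indicator_ge_le (h𝒢 : ∀ l, 𝒢 l ≤ mΩ) (hmono : Monotone 𝒢)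
    (hS : ∀ l ∈ Finset.Icc 1 n, MeasurableSet[𝒢 l] (S l))
    (hY : ∀ l ∈ Finset.Icc 1 n, Measurable[𝒢 (l + 1)] (Y l))
    (hYb : ∀ l ω, Y l ω ∈ Set.Icc (-1 : ℝ) 1)
    (hYint : ∀ l ∈ Finset.Icc 1 n, ∀ (W : Ω → ℝ) (b : ℝ), Measurable[𝒢 l] W →
      (∀ ω, W ω ∈ Set.Icc 0 b) → (∀ ω ∉ S l, W ω = 0) → ∫ ω, W ω * Y l ω ∂Pr ≤ 0)
    {x : ℝ} (hx : 0 ≤ x) {t : ℕ} (ht : t ≤ n + 1) {k : ℝ} (hk : 0 < k) :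
    Pr.real {ω | ∑ l ∈ Finset.Ico 1 t, (S l).indicator (fun _ => (1 : ℝ)) ω = k ∧
      x ≤ ∑ l ∈ Finset.Ico 1 t, (S l).indicator (Y l) ω} ≤ Real.exp (-(x ^ 2 / (2 * k))) := by
  -- this rate maximizes `a x - a² k / 2`
  set a := x / k with ha
  have ha0 : 0 ≤ a := by positivity
  have hint := integral_exp_sum_indicator_le_one h𝒢 hmono hS hY hYb hYint ha0 ht
  set V : Ω → ℝ := fun ω => Real.exp (∑ l ∈ Finset.Ico 1 t,
    (S l).indicator (fun ω => a * Y l ω - a ^ 2 / 2) ω)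
  have hVi : Integrable V Pr := by
    refine Integrable.of_bound (C := Real.exp (∑ l ∈ Finset.Ico 1 t, a)) ?_ ?_
    · refine Measurable.aestronglyMeasurable
        (Real.measurable_exp.comp (Finset.measurable_fun_sum _ fun l hl => ?_))
      rw [Finset.mem_Ico] at hl
      have hl' : l ∈ Finset.Icc 1 n := Finset.mem_Icc.2 ⟨hl.1, by omega⟩
      exact Measurable.indicator ((((hY l hl').mono (h𝒢 _) le_rfl).const_mul a).sub_const _)
        (h𝒢 _ _ (hS l hl'))
    · refine Eventually.of_forall fun ω => ?_
      rw [Real.norm_eq_abs, abs_of_pos (Real.exp_pos _)]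
      refine Real.exp_le_exp.2 (Finset.sum_le_sum fun l _ => Set.indicator_le' (fun ω _ => ?_)
        (fun ω _ => ha0) ω)
      have h1 := mul_le_of_le_one_right ha0 (hYb l ω).2
      have h2 := sq_nonneg a
      linarith
  set c := Real.exp (x ^ 2 / (2 * k))
  have hsub : {ω | ∑ l ∈ Finset.Ico 1 t, (S l).indicator (fun _ => (1 : ℝ)) ω = k ∧
      x ≤ ∑ l ∈ Finset.Ico 1 t, (S l).indicator (Y l) ω} ⊆ {ω | c ≤ V ω} := by
    rintro ω ⟨h1, h2⟩
    refine Real.exp_le_exp.2 ?_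
    have h3 : ∑ l ∈ Finset.Ico 1 t, (S l).indicator (fun ω => a * Y l ω - a ^ 2 / 2) ω
        = a * ∑ l ∈ Finset.Ico 1 t, (S l).indicator (Y l) ω - a ^ 2 / 2
          * ∑ l ∈ Finset.Ico 1 t, (S l).indicator (fun _ => (1 : ℝ)) ω := by
      rw [Finset.mul_sum, Finset.mul_sum, ← Finset.sum_sub_distrib]
      refine Finset.sum_congr rfl fun l _ => ?_
      by_cases hω : ω ∈ S l <;> simp [hω]
    rw [h3, h1]
    have h4 := mul_le_mul_of_nonneg_left h2 ha0
    have h5 : x ^ 2 / (2 * k) = a * x - a ^ 2 / 2 * k := by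
      rw [ha]; field_simp; ring
    linarith
  have hmarkov := mul_meas_ge_le_integral_of_nonneg
    (Eventually.of_forall fun ω => (Real.exp_pos _).le : 0 ≤ᵐ[Pr] V) hVi c
  have h6 : c * Pr.real {ω | c ≤ V ω} ≤ 1 := hmarkov.trans hint
  have h7 := measureReal_mono (μ := Pr) hsub
  rw [Real.exp_neg, ← one_div, le_div_iff₀ (Real.exp_pos _), mul_comm]
  exact (mul_le_mul_of_nonneg_left h7 (Real.exp_pos _).le).trans h6

end Azuma

section EpochConcentration

lemma epochStart_succ (τ₀ ζ : ℕ) {k : ℕ} (hk : 1 ≤ k) :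
    epochStart τ₀ ζ (k + 1) = epochStart τ₀ ζ k + epochLen τ₀ ζ k :=
  Finset.sum_Ico_succ_top hk _

lemma monotone_epochStart (τ₀ ζ : ℕ) : Monotone (epochStart τ₀ ζ) := fun _ _ h =>
  Finset.sum_le_sum_of_subset (Finset.Ico_subset_Ico le_rfl h)

lemma cast_pullCount {A I Ω : Type*} [DecidableEq A] [DecidableEq I]
    (α : ℕ → Ω → Finset (A × I)) (t : ℕ) (e : A × I) (ω : Ω) :
    (pullCount α t e ω : ℝ)
      = ∑ l ∈ Finset.Ico 1 t, Set.indicator {ω | e ∈ α l ω} (fun _ => (1 : ℝ)) ω := by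
  rw [pullCount, Finset.card_filter]
  push_cast
  exact Finset.sum_congr rfl fun l _ => by simp [Set.indicator]

/-- The average of epoch `k`, clipped to `[0, 1]`; almost surely this changes nothing where the
edge is played. -/
noncomputable def clippedAvg {A I Ω : Type*} (τ₀ ζ : ℕ) (X : ℕ → A → Ω → ℝ) (k : ℕ)
    (e : A × I) (ω : Ω) : ℝ :=
  max 0 (min 1 (epochAvg τ₀ ζ X k e ω))

lemma clippedAvg_mem {A I Ω : Type*} (τ₀ ζ : ℕ) (X : ℕ → A → Ω → ℝ) (k : ℕ) (e : A × I)
    (ω : Ω) :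
    clippedAvg τ₀ ζ X k e ω ∈ Set.Icc (0 : ℝ) 1 :=
  ⟨le_max_left _ _, max_le zero_le_one (min_le_left _ _)⟩

lemma mul_confRadius (m τ₀ ζ : ℕ) (c : ℝ) {k : ℕ} (hk : 1 ≤ k) (t : ℕ) :
    k * confRadius m τ₀ ζ c k t
      = biasTerm τ₀ ζ c k + Real.sqrt (k * (6 * Real.log t + 4 * Real.log m)) := by
  have hk0 : (0 : ℝ) < k := by exact_mod_cast hk
  have h1 : (k : ℝ) * (6 * Real.log t + 4 * Real.log m)
      = k ^ 2 * (6 / k * Real.log t + 4 / k * Real.log m) := by field_simp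
  rw [confRadius, mul_add, mul_div_cancel₀ _ hk0.ne', h1, Real.sqrt_mul (by positivity),
    Real.sqrt_sq hk0.le]

lemma sum_mem_eq_sum_ite {ι : Type*} [Fintype ι] [DecidableEq ι] (N : Finset ι) (f : ι → ℝ) :
    ∑ e ∈ N, f e = ∑ e, if e ∈ N then f e else 0 := by
  rw [Finset.sum_ite_mem, Finset.univ_inter]

variable {A I K : Type*} {Θ : A → Type*} [∀ a, Fintype (Θ a)] [∀ a, DecidableEq (Θ a)]
  [DecidableEq A] [DecidableEq I] {E : MatchingEnv A I K Θ} {τ₀ ζ n : ℕ}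
  {Ω : Type*} [mΩ : MeasurableSpace Ω] {Pr : Measure Ω}
  {ℱ : Filtration ℕ mΩ} {θ : ℕ → (a : A) → Ω → Θ a} {X : ℕ → A → Ω → ℝ}
  {α : ℕ → Ω → Finset (A × I)}

lemma IsEpochMixing.measurable_epochAvg (h : IsEpochMixing E τ₀ ζ n Pr ℱ θ X α) {k : ℕ}
    (hk : 1 ≤ k) (e : A × I) :
    Measurable[ℱ (epochStart τ₀ ζ (k + 1))] (epochAvg τ₀ ζ X k e) := by
  refine Measurable.const_mul (Finset.measurable_fun_sum _ fun s hs => ?_) _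
  rw [Finset.mem_range] at hs
  rw [epochStart_succ τ₀ ζ hk]
  exact (h.reward_adapted _ _).mono (ℱ.mono (by omega)) le_rfl

lemma IsEpochMixing.measurable_clippedAvg (h : IsEpochMixing E τ₀ ζ n Pr ℱ θ X α) {k : ℕ}
    (hk : 1 ≤ k) (e : A × I) :
    Measurable[ℱ (epochStart τ₀ ζ (k + 1))] (clippedAvg τ₀ ζ X k e) :=
  measurable_const.max (measurable_const.min (h.measurable_epochAvg hk e))

lemma IsEpochMixing.integrable_weight_mul_clippedAvg (h : IsEpochMixing E τ₀ ζ n Pr ℱ θ X α)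
    {k : ℕ} (hk : 1 ≤ k) (e : A × I) {W : Ω → ℝ} (hW : Integrable W Pr) :
    Integrable (fun ω => W ω * clippedAvg τ₀ ζ X k e ω) Pr :=
  hW.mul_bdd (c := 1) ((h.measurable_clippedAvg hk e).mono (ℱ.le _) le_rfl).aestronglyMeasurable
    (Eventually.of_forall fun ω => by
      rw [Real.norm_eq_abs, abs_of_nonneg (clippedAvg_mem _ _ _ _ _ _).1]
      exact (clippedAvg_mem _ _ _ _ _ _).2)

lemma IsEpochMixing.measurable_ite (h : IsEpochMixing E τ₀ ζ n Pr ℱ θ X α) {k : ℕ}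
    (hk : k ∈ Finset.Icc 1 n) (e : A × I) (x : ℝ) :
    Measurable[ℱ (epochStart τ₀ ζ k)] fun ω => if e ∈ α k ω then x else 0 :=
  Measurable.ite (h.policy_adapted k hk e) measurable_const measurable_const

variable [IsProbabilityMeasure Pr]

/-- Tail bound for a bounded modification `Y` of the centred epoch averages: `Y l` has nonpositive
expectation under every weight known at the beginning of epoch `l`, and dominates `D l` minus the
bias of that epoch wherever the edge is played. -/
lemma IsEpochMixing.measureReal_sum_dev_ge_le (h : IsEpochMixing E τ₀ ζ n Pr ℱ θ X α)
    (hτ : 1 ≤ τ₀) (hζ : 1 ≤ ζ) (e : A × I) {c : ℝ} (hc : 0 ≤ c) {D Y : ℕ → Ω → ℝ}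
    (hY : ∀ l ∈ Finset.Icc 1 n, Measurable[ℱ (epochStart τ₀ ζ (l + 1))] (Y l))
    (hYb : ∀ l ω, Y l ω ∈ Set.Icc (-1 : ℝ) 1)
    (hYint : ∀ l ∈ Finset.Icc 1 n, ∀ (W : Ω → ℝ) (b : ℝ),
      Measurable[ℱ (epochStart τ₀ ζ l)] W → (∀ ω, W ω ∈ Set.Icc 0 b) →
      (∀ ω, e ∉ α l ω → W ω = 0) → ∫ ω, W ω * Y l ω ∂Pr ≤ 0)
    (hD : ∀ l ∈ Finset.Icc 1 n, ∀ᵐ ω ∂Pr, e ∈ α l ω →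
      D l ω - c / 2 * (1 / (epochLen τ₀ ζ l : ℝ)) ≤ Y l ω)
    {t : ℕ} (ht : t ≤ n + 1) {k : ℕ} (hk : 1 ≤ k) {L : ℝ} (hL : 0 ≤ L) :
    Pr.real {ω | pullCount α t e ω = k ∧ biasTerm τ₀ ζ c k + Real.sqrt (k * L)
      ≤ ∑ l ∈ (Finset.Ico 1 t).filter (fun l => e ∈ α l ω), D l ω} ≤ Real.exp (-(L / 2)) := by
  have hk0 : (0 : ℝ) < k := by exact_mod_cast hk
  have hkey := measureReal_sum_indicator_ge_le (Pr := Pr) (n := n)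
    (𝒢 := fun l => ℱ (epochStart τ₀ ζ l)) (S := fun l => {ω | e ∈ α l ω}) (Y := Y)
    (fun l => ℱ.le _) (fun _ _ hl => ℱ.mono (monotone_epochStart τ₀ ζ hl))
    (fun l hl => h.policy_adapted l hl e) hY hYb
    (fun l hl W b h1 h2 h3 => hYint l hl W b h1 h2 h3) (Real.sqrt_nonneg (k * L)) ht hk0
  have h1 : Real.sqrt (k * L) ^ 2 / (2 * k) = L / 2 := by
    rw [Real.sq_sqrt (by positivity)]; field_simp
  rw [h1] at hkey
  refine le_trans ?_ hkey
  refine ENNReal.toReal_mono (measure_ne_top _ _) (measure_mono_ae ?_)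
  have hae : ∀ᵐ ω ∂Pr, ∀ l : ℕ, l ∈ Finset.Icc 1 n → e ∈ α l ω →
      D l ω - c / 2 * (1 / (epochLen τ₀ ζ l : ℝ)) ≤ Y l ω := by
    rw [ae_all_iff]
    intro l
    by_cases hl : l ∈ Finset.Icc 1 n
    · filter_upwards [hD l hl] with ω hω _ using hω
    · exact Eventually.of_forall fun ω hl' => absurd hl' hl
  filter_upwards [hae] with ω hω
  rintro ⟨hcount, hsum⟩
  refine ⟨by rw [← cast_pullCount, hcount], ?_⟩
  have h2 : ∑ l ∈ Finset.Ico 1 t, Set.indicator {ω | e ∈ α l ω} (Y l) ω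
      = ∑ l ∈ (Finset.Ico 1 t).filter (fun l => e ∈ α l ω), Y l ω := by
    rw [Finset.sum_filter]
    exact Finset.sum_congr rfl fun l _ => by simp [Set.indicator]
  change _ ≤ ∑ l ∈ Finset.Ico 1 t, Set.indicator {ω | e ∈ α l ω} (Y l) ω
  rw [h2]
  -- the `j`-th selection happens in epoch `j` or later, whose bias is at most that of epoch `j`
  have h3 : ∑ l ∈ (Finset.Ico 1 t).filter (fun l => e ∈ α l ω),
      c / 2 * (1 / (epochLen τ₀ ζ l : ℝ)) ≤ biasTerm τ₀ ζ c k := by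
    have h4 := sum_le_sum_Icc_card_of_antitone (antitone_bias_epochLen (ζ := ζ) hτ hc)
      ((Finset.Ico 1 t).filter (fun l => e ∈ α l ω)) fun l hl =>
        (Finset.mem_Ico.1 (Finset.mem_filter.1 hl).1).1
    rw [show ((Finset.Ico 1 t).filter (fun l => e ∈ α l ω)).card = k from hcount] at h4
    exact h4.trans (sum_Icc_bias_le_biasTerm hτ hζ k hc)
  have h5 : ∑ l ∈ (Finset.Ico 1 t).filter (fun l => e ∈ α l ω),
      (D l ω - c / 2 * (1 / (epochLen τ₀ ζ l : ℝ)))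
      ≤ ∑ l ∈ (Finset.Ico 1 t).filter (fun l => e ∈ α l ω), Y l ω := by
    refine Finset.sum_le_sum fun l hl => ?_
    obtain ⟨hl1, hl2⟩ := Finset.mem_filter.1 hl
    rw [Finset.mem_Ico] at hl1
    exact hω l (Finset.mem_Icc.2 ⟨hl1.1, by omega⟩) hl2
  rw [Finset.sum_sub_distrib] at h5
  linarith

lemma IsEpochMixing.integral_weight_mul_clippedAvg (h : IsEpochMixing E τ₀ ζ n Pr ℱ θ X α)
    (hτ : 1 ≤ τ₀) {k : ℕ} (hk : k ∈ Finset.Icc 1 n) (e : A × I) {W : Ω → ℝ}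
    (hW0 : ∀ ω, e ∉ α k ω → W ω = 0) :
    ∫ ω, W ω * clippedAvg τ₀ ζ X k e ω ∂Pr = ∫ ω, W ω * epochAvg τ₀ ζ X k e ω ∂Pr := by
  refine integral_congr_ae ?_
  filter_upwards [h.ae_epochAvg_mem hτ hk e] with ω hω
  by_cases hα : e ∈ α k ω
  · rw [clippedAvg, min_eq_right (hω hα).2, max_eq_right (hω hα).1]
  · simp [hW0 ω hα]

/-- The sum of the observed averages of an edge rarely exceeds its mean by much. -/
lemma IsEpochMixing.measureReal_sum_upper_le (h : IsEpochMixing E τ₀ ζ n Pr ℱ θ X α)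
    (hτ : 1 ≤ τ₀) (hζ : 1 ≤ ζ) (e : A × I) {c : ℝ}
    (hc : IsMixingConstant (E.P e) (E.stat e) c) {t : ℕ} (ht : t ≤ n + 1) {k : ℕ} (hk : 1 ≤ k)
    {L : ℝ} (hL : 0 ≤ L) :
    Pr.real {ω | pullCount α t e ω = k ∧ biasTerm τ₀ ζ c k + Real.sqrt (k * L)
      ≤ ∑ l ∈ (Finset.Ico 1 t).filter (fun l => e ∈ α l ω),
        (epochAvg τ₀ ζ X l e ω - E.mean e)} ≤ Real.exp (-(L / 2)) := by
  have hc0 := hc.nonneg (E.stat_mem e)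
  have hμ := E.mean_mem e
  set q : ℕ → ℝ := fun l => min 1 (E.mean e + c / 2 * (1 / (epochLen τ₀ ζ l : ℝ)))
  have hq : ∀ l, q l ∈ Set.Icc (0 : ℝ) 1 := fun l =>
    ⟨le_min zero_le_one (add_nonneg hμ.1 (by positivity)), min_le_left _ _⟩
  refine h.measureReal_sum_dev_ge_le hτ hζ e hc0
    (Y := fun l ω => clippedAvg τ₀ ζ X l e ω - q l) ?_ ?_ ?_ ?_ ht hk hL
  · exact fun l hl => (h.measurable_clippedAvg (Finset.mem_Icc.1 hl).1 e).sub_const _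
  · intro l ω
    have h1 := clippedAvg_mem τ₀ ζ X l e ω
    have h2 := hq l
    constructor <;> linarith [h1.1, h1.2, h2.1, h2.2]
  · intro l hl W b hW hb hW0
    have hWi : Integrable W Pr := integrable_of_bdd (ℱ.le _) hW hb
    have hWc := h.integrable_weight_mul_clippedAvg (Finset.mem_Icc.1 hl).1 e hWi
    have hnn : 0 ≤ ∫ ω, W ω ∂Pr := integral_nonneg fun ω => (hb ω).1
    simp only [mul_sub]
    rw [integral_sub hWc (hWi.mul_const _), integral_mul_const, sub_nonpos]
    have h1 : ∫ ω, W ω * clippedAvg τ₀ ζ X l e ω ∂Pr ≤ ∫ ω, W ω ∂Pr :=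
      integral_mono hWc hWi fun ω =>
        mul_le_of_le_one_right (hb ω).1 (clippedAvg_mem _ _ _ _ _ _).2
    have h2 := (abs_le.1 (h.abs_integral_weight_mul_epochAvg_sub_le hτ hl e hc hW hb hW0)).2
    rw [← h.integral_weight_mul_clippedAvg hτ hl e hW0] at h2
    simp only [q]
    rw [mul_min_of_nonneg _ _ hnn]
    refine le_min (by linarith) ?_
    linarith
  · intro l hl
    filter_upwards [h.ae_epochAvg_mem hτ hl e] with ω hω hα
    simp only [clippedAvg, min_eq_right (hω hα).2, max_eq_right (hω hα).1]
    have : q l ≤ E.mean e + c / 2 * (1 / (epochLen τ₀ ζ l : ℝ)) := min_le_right _ _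
    linarith

/-- The sum of the observed averages of an edge rarely falls short of its mean by much. -/
lemma IsEpochMixing.measureReal_sum_lower_le (h : IsEpochMixing E τ₀ ζ n Pr ℱ θ X α)
    (hτ : 1 ≤ τ₀) (hζ : 1 ≤ ζ) (e : A × I) {c : ℝ}
    (hc : IsMixingConstant (E.P e) (E.stat e) c) {t : ℕ} (ht : t ≤ n + 1) {k : ℕ} (hk : 1 ≤ k)
    {L : ℝ} (hL : 0 ≤ L) :
    Pr.real {ω | pullCount α t e ω = k ∧ biasTerm τ₀ ζ c k + Real.sqrt (k * L)
      ≤ ∑ l ∈ (Finset.Ico 1 t).filter (fun l => e ∈ α l ω),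
        (E.mean e - epochAvg τ₀ ζ X l e ω)} ≤ Real.exp (-(L / 2)) := by
  have hc0 := hc.nonneg (E.stat_mem e)
  have hμ := E.mean_mem e
  set q : ℕ → ℝ := fun l => max 0 (E.mean e - c / 2 * (1 / (epochLen τ₀ ζ l : ℝ)))
  have hq : ∀ l, q l ∈ Set.Icc (0 : ℝ) 1 := fun l => by
    have : 0 ≤ c / 2 * (1 / (epochLen τ₀ ζ l : ℝ)) := by positivity
    exact ⟨le_max_left _ _, max_le zero_le_one (by linarith [hμ.2])⟩
  refine h.measureReal_sum_dev_ge_le hτ hζ e hc0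
    (Y := fun l ω => q l - clippedAvg τ₀ ζ X l e ω) ?_ ?_ ?_ ?_ ht hk hL
  · exact fun l hl => (h.measurable_clippedAvg (Finset.mem_Icc.1 hl).1 e).const_sub _
  · intro l ω
    have h1 := clippedAvg_mem τ₀ ζ X l e ω
    have h2 := hq l
    constructor <;> linarith [h1.1, h1.2, h2.1, h2.2]
  · intro l hl W b hW hb hW0
    have hWi : Integrable W Pr := integrable_of_bdd (ℱ.le _) hW hb
    have hWc := h.integrable_weight_mul_clippedAvg (Finset.mem_Icc.1 hl).1 e hWi
    have hnn : 0 ≤ ∫ ω, W ω ∂Pr := integral_nonneg fun ω => (hb ω).1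
    simp only [mul_sub]
    rw [integral_sub (hWi.mul_const _) hWc, integral_mul_const, sub_nonpos]
    have h1 : 0 ≤ ∫ ω, W ω * clippedAvg τ₀ ζ X l e ω ∂Pr :=
      integral_nonneg fun ω => mul_nonneg (hb ω).1 (clippedAvg_mem _ _ _ _ _ _).1
    have h2 := (abs_le.1 (h.abs_integral_weight_mul_epochAvg_sub_le hτ hl e hc hW hb hW0)).1
    rw [← h.integral_weight_mul_clippedAvg hτ hl e hW0] at h2
    simp only [q]
    rw [mul_max_of_nonneg _ _ hnn]
    refine max_le (by linarith) ?_
    linarith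
  · intro l hl
    filter_upwards [h.ae_epochAvg_mem hτ hl e] with ω hω hα
    simp only [clippedAvg, min_eq_right (hω hα).2, max_eq_right (hω hα).1]
    have : E.mean e - c / 2 * (1 / (epochLen τ₀ ζ l : ℝ)) ≤ q l := le_max_right _ _
    linarith

/-- The event that, at the beginning of epoch `t`, the empirical mean of some edge that has already
been played misses the mean by at least the confidence parameter. -/
def deviationEvent (E : MatchingEnv A I K Θ) (C : A × I → ℝ) (m τ₀ ζ : ℕ) (X : ℕ → A → Ω → ℝ)
    (α : ℕ → Ω → Finset (A × I)) (t : ℕ) : Set Ω :=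
  {ω | ∃ e, 1 ≤ pullCount α t e ω ∧
    (E.mean e + confRadius m τ₀ ζ (C e) (pullCount α t e ω) t ≤ empMean τ₀ ζ X α t e ω ∨
      empMean τ₀ ζ X α t e ω ≤ E.mean e - confRadius m τ₀ ζ (C e) (pullCount α t e ω) t)}

/-- A union bound over the `m ^ 2` edges, the two signs and the possible numbers of earlier
selections. -/
lemma IsEpochMixing.measureReal_deviationEvent_le [Fintype A] [Fintype I]
    (h : IsEpochMixing E τ₀ ζ n Pr ℱ θ X α) (hτ : 1 ≤ τ₀) (hζ : 1 ≤ ζ) {m : ℕ} (hm : 1 ≤ m)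
    (hA : Fintype.card A = m) (hI : Fintype.card I = m) {C : A × I → ℝ}
    (hC : ∀ e, IsMixingConstant (E.P e) (E.stat e) (C e)) {t : ℕ} (ht : 1 ≤ t) (htn : t ≤ n) :
    Pr.real (deviationEvent E C m τ₀ ζ X α t) ≤ 2 * (1 / (t : ℝ)) := by
  have hm0 : (0 : ℝ) < m := by exact_mod_cast hm
  have ht0 : (0 : ℝ) < t := by exact_mod_cast ht
  set L : ℝ := 6 * Real.log t + 4 * Real.log m with hLdef
  have hL : 0 ≤ L := by
    have h1 : 0 ≤ Real.log t := Real.log_nonneg (by exact_mod_cast ht)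
    have h2 : 0 ≤ Real.log m := Real.log_nonneg (by exact_mod_cast hm)
    positivity
  set U : A × I → ℕ → Set Ω := fun e k => {ω | pullCount α t e ω = k ∧
    biasTerm τ₀ ζ (C e) k + Real.sqrt (k * L)
      ≤ ∑ l ∈ (Finset.Ico 1 t).filter (fun l => e ∈ α l ω), (epochAvg τ₀ ζ X l e ω - E.mean e)}
  set V : A × I → ℕ → Set Ω := fun e k => {ω | pullCount α t e ω = k ∧
    biasTerm τ₀ ζ (C e) k + Real.sqrt (k * L)
      ≤ ∑ l ∈ (Finset.Ico 1 t).filter (fun l => e ∈ α l ω), (E.mean e - epochAvg τ₀ ζ X l e ω)}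
  have hsub : deviationEvent E C m τ₀ ζ X α t
      ⊆ ⋃ q ∈ (Finset.univ : Finset (A × I)) ×ˢ Finset.Icc 1 t, (U q.1 q.2 ∪ V q.1 q.2) := by
    rintro ω ⟨e, hk, hdev⟩
    simp only [Set.mem_iUnion]
    set k := pullCount α t e ω with hkdef
    have hk0 : (0 : ℝ) < k := by exact_mod_cast hk
    have hkt : k ≤ t := by
      rw [hkdef, pullCount]
      refine (Finset.card_filter_le _ _).trans ?_
      simp
    refine ⟨(e, k), by simp [hk, hkt], ?_⟩
    have hmul := mul_confRadius m τ₀ ζ (C e) hk t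
    have hemp : ∑ l ∈ (Finset.Ico 1 t).filter (fun l => e ∈ α l ω), epochAvg τ₀ ζ X l e ω
        = k * empMean τ₀ ζ X α t e ω := by
      rw [empMean, mul_div_cancel₀ _ hk0.ne']
    have hcard : ((Finset.Ico 1 t).filter (fun l => e ∈ α l ω)).card = k := rfl
    rcases hdev with hdev | hdev
    · left
      refine ⟨rfl, ?_⟩
      rw [← hmul, Finset.sum_sub_distrib, hemp, Finset.sum_const, hcard, nsmul_eq_mul]
      have := mul_le_mul_of_nonneg_left hdev hk0.le
      linarith
    · right
      refine ⟨rfl, ?_⟩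
      rw [← hmul, Finset.sum_sub_distrib, hemp, Finset.sum_const, hcard, nsmul_eq_mul]
      have := mul_le_mul_of_nonneg_left hdev hk0.le
      linarith
  have hexp : Real.exp (-(L / 2)) = 1 / ((t : ℝ) ^ 3 * (m : ℝ) ^ 2) := by
    have : L / 2 = Real.log ((t : ℝ) ^ 3 * (m : ℝ) ^ 2) := by
      rw [Real.log_mul (by positivity) (by positivity), Real.log_pow, Real.log_pow, hLdef]
      push_cast
      ring
    rw [this, Real.exp_neg, Real.exp_log (by positivity), one_div]
  calc Pr.real (deviationEvent E C m τ₀ ζ X α t)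
      ≤ Pr.real (⋃ q ∈ (Finset.univ : Finset (A × I)) ×ˢ Finset.Icc 1 t,
          (U q.1 q.2 ∪ V q.1 q.2)) := measureReal_mono hsub (measure_ne_top _ _)
    _ ≤ ∑ q ∈ (Finset.univ : Finset (A × I)) ×ˢ Finset.Icc 1 t, Pr.real (U q.1 q.2 ∪ V q.1 q.2) :=
        measureReal_biUnion_finset_le _ _
    _ ≤ ∑ q ∈ (Finset.univ : Finset (A × I)) ×ˢ Finset.Icc 1 t,
          2 * (1 / ((t : ℝ) ^ 3 * (m : ℝ) ^ 2)) := by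
        refine Finset.sum_le_sum fun q hq => ?_
        rw [Finset.mem_product, Finset.mem_Icc] at hq
        have h1 := h.measureReal_sum_upper_le hτ hζ q.1 (hC q.1) (t := t) (by omega) hq.2.1 hL
        have h2 := h.measureReal_sum_lower_le hτ hζ q.1 (hC q.1) (t := t) (by omega) hq.2.1 hL
        rw [hexp] at h1 h2
        refine (measureReal_union_le _ _).trans ?_
        rw [two_mul]
        exact add_le_add h1 h2
    _ = 2 * (1 / (t : ℝ)) * (1 / t) := by
        rw [Finset.sum_const, Finset.card_product, Finset.card_univ, Fintype.card_prod, hA, hI,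
          Nat.card_Icc, nsmul_eq_mul]
        push_cast
        field_simp
    _ ≤ 2 * (1 / (t : ℝ)) := by
        refine mul_le_of_le_one_right (by positivity) ?_
        rw [div_le_one ht0]
        exact_mod_cast ht

lemma IsEpochMixing.integrable_ite (h : IsEpochMixing E τ₀ ζ n Pr ℱ θ X α) {k : ℕ}
    (hk : k ∈ Finset.Icc 1 n) (e : A × I) (x : ℝ) :
    Integrable (fun ω => if e ∈ α k ω then x else 0) Pr := by
  refine Integrable.of_bound (C := |x|)
    ((h.measurable_ite hk e x).mono (ℱ.le _) le_rfl).aestronglyMeasurable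
    (Eventually.of_forall fun ω => ?_)
  split_ifs <;> simp

/-- The expected reward of an epoch, up to the bias of the played edges. -/
lemma IsEpochMixing.integral_sum_mean_sub_le [Fintype A] [Fintype I]
    (h : IsEpochMixing E τ₀ ζ n Pr ℱ θ X α) {C : A × I → ℝ}
    (hτ : 1 ≤ τ₀) (hC : ∀ e, IsMixingConstant (E.P e) (E.stat e) (C e)) {k : ℕ}
    (hk : k ∈ Finset.Icc 1 n) :
    ∫ ω, ∑ e ∈ α k ω, (E.mean e - C e / epochLen τ₀ ζ k) ∂Pr
      ≤ ∫ ω, ∑ e ∈ α k ω, epochAvg τ₀ ζ X k e ω ∂Pr := by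
  rw [show (fun ω => ∑ e ∈ α k ω, (E.mean e - C e / epochLen τ₀ ζ k))
      = fun ω => ∑ e, if e ∈ α k ω then E.mean e - C e / epochLen τ₀ ζ k else 0 from
      funext fun ω => sum_mem_eq_sum_ite _ _,
    show (fun ω => ∑ e ∈ α k ω, epochAvg τ₀ ζ X k e ω)
      = fun ω => ∑ e, if e ∈ α k ω then epochAvg τ₀ ζ X k e ω else 0 from
      funext fun ω => sum_mem_eq_sum_ite _ _]
  have hint : ∀ e, Integrable (fun ω => if e ∈ α k ω then epochAvg τ₀ ζ X k e ω else 0) Pr := by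
    intro e
    refine Integrable.of_bound (C := 1) ?_ ?_
    · exact (Measurable.ite ((ℱ.le _) _ (h.policy_adapted k hk e))
        ((h.measurable_epochAvg (Finset.mem_Icc.1 hk).1 e).mono (ℱ.le _) le_rfl)
        measurable_const).aestronglyMeasurable
    · filter_upwards [h.ae_epochAvg_mem hτ hk e] with ω hω
      split_ifs with hα
      · rw [Real.norm_eq_abs, abs_of_nonneg (hω hα).1]
        exact (hω hα).2
      · simp
  rw [integral_finsetSum _ fun e _ => h.integrable_ite hk e _,
    integral_finsetSum _ fun e _ => hint e]
  refine Finset.sum_le_sum fun e _ => ?_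
  set W : Ω → ℝ := fun ω => if e ∈ α k ω then 1 else 0 with hW
  have hWb : ∀ ω, W ω ∈ Set.Icc (0 : ℝ) 1 := fun ω => by simp only [hW]; split_ifs <;> simp
  have key := (abs_le.1 (h.abs_integral_weight_mul_epochAvg_sub_le hτ hk e (hC e) (W := W) (b := 1)
    (h.measurable_ite hk e 1) hWb (fun ω hω => by simp [hW, hω]))).1
  have hW0 : 0 ≤ ∫ ω, W ω ∂Pr := integral_nonneg fun ω => (hWb ω).1
  have h1 : ∫ ω, (if e ∈ α k ω then E.mean e - C e / epochLen τ₀ ζ k else 0) ∂Pr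
      = (E.mean e - C e / epochLen τ₀ ζ k) * ∫ ω, W ω ∂Pr := by
    rw [← integral_const_mul]
    exact integral_congr_ae (Eventually.of_forall fun ω => by simp [hW])
  have h2 : ∫ ω, (if e ∈ α k ω then epochAvg τ₀ ζ X k e ω else 0) ∂Pr
      = ∫ ω, W ω * epochAvg τ₀ ζ X k e ω ∂Pr :=
    integral_congr_ae (Eventually.of_forall fun ω => by simp [hW])
  rw [h1, h2]
  have h3 : 0 ≤ C e / epochLen τ₀ ζ k := div_nonneg ((hC e).nonneg (E.stat_mem e)) (by positivity)
  have h4 : C e / 2 * (1 / (epochLen τ₀ ζ k : ℝ)) = C e / epochLen τ₀ ζ k / 2 := by ring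
  rw [h4] at key
  have h5 := mul_nonneg h3 hW0
  rw [sub_mul]
  linarith

end EpochConcentration

/-! ### Counting the epochs with a wrong matching -/

open scoped Classical in
/-- The set `𝒮` of suboptimal edges as a finite set. -/
noncomputable def GreedyBenchmark.suboptFinset {A I K : Type*} [Fintype A] [Fintype I]
    [DecidableEq A] [DecidableEq I] [DecidableEq K] {cls : A × I → K} {cap : K → ℕ}
    {μ : A × I → ℝ} {m : ℕ} (b : GreedyBenchmark cls cap μ m) : Finset (A × I) :=
  Finset.univ.filter fun e => e ∈ b.subopt

lemma GreedyBenchmark.mem_suboptFinset {A I K : Type*} [Fintype A] [Fintype I]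
    [DecidableEq A] [DecidableEq I] [DecidableEq K] {cls : A × I → K} {cap : K → ℕ}
    {μ : A × I → ℝ} {m : ℕ} (b : GreedyBenchmark cls cap μ m) {e : A × I} :
    e ∈ b.suboptFinset ↔ e ∈ b.subopt := by
  simp [GreedyBenchmark.suboptFinset]

section Counting

lemma pullCount_lt_of_mem {A I Ω : Type*} [DecidableEq A] [DecidableEq I]
    {α : ℕ → Ω → Finset (A × I)} {s t : ℕ} (hs : 1 ≤ s) (hst : s < t) {e : A × I} {ω : Ω}
    (he : e ∈ α s ω) : pullCount α s e ω < pullCount α t e ω := by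
  refine Finset.card_lt_card ((Finset.ssubset_iff_of_subset ?_).2 ⟨s, ?_, ?_⟩)
  · exact Finset.filter_subset_filter _ (Finset.Ico_subset_Ico le_rfl hst.le)
  · exact Finset.mem_filter.2 ⟨Finset.mem_Ico.2 ⟨hs, hst⟩, he⟩
  · simp

/-- An edge is selected in at most `z - 1` epochs at whose beginning its number of earlier
selections is positive and less than `z`. -/
lemma card_selected_of_pullCount_lt {A I Ω : Type*} [DecidableEq A] [DecidableEq I]
    {α : ℕ → Ω → Finset (A × I)} {e : A × I} {ω : Ω} (T : Finset ℕ) (z : ℕ)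
    (hT : ∀ t ∈ T, 1 ≤ t ∧ e ∈ α t ω ∧ 1 ≤ pullCount α t e ω ∧ pullCount α t e ω < z) :
    T.card ≤ z - 1 := by
  rw [← Nat.card_Ico]
  refine Finset.card_le_card_of_injOn (fun t => pullCount α t e ω) (fun t ht => ?_) ?_
  · exact Finset.mem_coe.2 (Finset.mem_Ico.2 (hT t ht).2.2)
  · intro s hs t ht hst
    by_contra hne
    rcases lt_or_gt_of_ne hne with h | h
    · exact absurd hst (pullCount_lt_of_mem (hT s hs).1 h (hT s hs).2.1).ne
    · exact absurd hst (pullCount_lt_of_mem (hT t ht).1 h (hT t ht).2.1).ne'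

variable {A I K : Type*} {Θ : A → Type*} [Fintype A] [Fintype I]
  [DecidableEq A] [DecidableEq I] [DecidableEq K]
  [∀ a, Fintype (Θ a)] [∀ a, DecidableEq (Θ a)]
  {m : ℕ} {E : MatchingEnv A I K Θ} {C : A × I → ℝ} {τ₀ ζ n : ℕ} {M : ℕ → Finset (A × I)} {p : ℕ}
  {Ω : Type*} [mΩ : MeasurableSpace Ω] {Pr : Measure Ω}
  {ℱ : Filtration ℕ mΩ} {θ : ℕ → (a : A) → Ω → Θ a} {X : ℕ → A → Ω → ℝ}
  {α : ℕ → Ω → Finset (A × I)}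

/-- After the initial matchings every edge has been selected. -/
lemma IsMGEUCB.one_le_pullCount (h : IsMGEUCB E C m τ₀ ζ n M p Pr ℱ θ X α)
    (hM : IsInitialPlay E.cls E.cap M p) {t : ℕ} (hpt : p < t) (htn : t ≤ n) (e : A × I) (ω : Ω) :
    1 ≤ pullCount α t e ω := by
  obtain ⟨j, hj, he⟩ := hM.exists_mem e
  rw [Finset.mem_Icc] at hj
  refine Finset.card_pos.2 ⟨j, Finset.mem_filter.2 ⟨Finset.mem_Ico.2 ⟨hj.1, by omega⟩, ?_⟩⟩
  rw [h.init j (Finset.mem_Icc.2 ⟨hj.1, by omega⟩) hj.2 ω]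
  exact he

lemma IsMGEUCB.isFeasible (h : IsMGEUCB E C m τ₀ ζ n M p Pr ℱ θ X α)
    (hM : IsInitialPlay E.cls E.cap M p) {k : ℕ} (hk : k ∈ Finset.Icc 1 n) (ω : Ω) :
    IsFeasible E.cls E.cap (α k ω) := by
  rcases le_or_gt k p with hkp | hkp
  · rw [h.init k hk hkp ω]
    exact (hM.maximal k (Finset.mem_Icc.2 ⟨(Finset.mem_Icc.1 hk).1, hkp⟩)).1.1
  · exact (h.greedy k hk hkp ω).maximal.1

/-- Unless some empirical mean deviates, a matching other than the benchmark contains an edge that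
has been selected less often than its threshold. -/
lemma IsMGEUCB.exists_pullCount_lt [NeZero m] (h : IsMGEUCB E C m τ₀ ζ n M p Pr ℱ θ X α)
    (hM : IsInitialPlay E.cls E.cap M p) (b : GreedyBenchmark E.cls E.cap E.mean m)
    (hgap : ∀ e, e ≠ b.g 0 → 0 < b.gap e)
    (hC : ∀ e, IsMixingConstant (E.P e) (E.stat e) (C e)) (hτ : 1 ≤ τ₀) (hζ : 1 ≤ ζ)
    {t : ℕ} (hpt : p < t) (htn : t ≤ n) {ω : Ω} (hne : α t ω ≠ b.Gstar)
    (hdev : ω ∉ deviationEvent E C m τ₀ ζ X α t) :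
    ∃ f ∈ α t ω, f ≠ b.g 0 ∧
      (pullCount α t f ω : ℝ) < pullThreshold m τ₀ ζ n (b.gap f) (C f) := by
  obtain ⟨f, hf, hf0, l, hw, hle⟩ := b.exists_preferred hgap
    (h.greedy t (Finset.mem_Icc.2 ⟨by omega, htn⟩) hpt ω) hne
  refine ⟨f, hf, hf0, ?_⟩
  have hcount := fun e => h.one_le_pullCount hM hpt htn e ω
  have hgood : ∀ e, E.mean e - confRadius m τ₀ ζ (C e) (pullCount α t e ω) t
      < empMean τ₀ ζ X α t e ω ∧ empMean τ₀ ζ X α t e ω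
      < E.mean e + confRadius m τ₀ ζ (C e) (pullCount α t e ω) t := by
    intro e
    constructor
    · by_contra! hcon
      exact hdev ⟨e, hcount e, Or.inr hcon⟩
    · by_contra! hcon
      exact hdev ⟨e, hcount e, Or.inl hcon⟩
  refine lt_pullThreshold (t := t) hτ hζ (hcount f) (by omega) htn ((hC f).nonneg (E.stat_mem f))
    (hgap f hf0) ?_
  have h1 := (hgood f).2
  have h2 := (hgood (b.g l)).1
  linarith

/-- The number of epochs after the initial matchings whose matching is not the benchmark: apart
from epochs with a deviation, each is charged to an edge below its threshold. -/
lemma IsMGEUCB.card_ne_Gstar_le [NeZero m] (h : IsMGEUCB E C m τ₀ ζ n M p Pr ℱ θ X α)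
    (hA : Fintype.card A = m) (hI : Fintype.card I = m)
    (hM : IsInitialPlay E.cls E.cap M p) (b : GreedyBenchmark E.cls E.cap E.mean m)
    (hgap : ∀ e, e ≠ b.g 0 → 0 < b.gap e)
    (hC : ∀ e, IsMixingConstant (E.P e) (E.stat e) (C e)) (hτ : 1 ≤ τ₀) (hζ : 1 ≤ ζ)
    {z : ℕ} (hz : ∀ e, e ≠ b.g 0 → pullThreshold m τ₀ ζ n (b.gap e) (C e) ≤ z) (ω : Ω) :
    (((Finset.Ioc p n).filter fun t => α t ω ≠ b.Gstar).card : ℝ)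
      ≤ ((m : ℝ) ^ 2 - 1) * ((z - 1 : ℕ) : ℝ)
        + ∑ t ∈ Finset.Ioc p n,
          (deviationEvent E C m τ₀ ζ X α t).indicator (fun _ => (1 : ℝ)) ω := by
  classical
  set D : Finset ℕ := (Finset.Ioc p n).filter fun t => ω ∈ deviationEvent E C m τ₀ ζ X α t
  set Q : A × I → Finset ℕ := fun f => (Finset.Ioc p n).filter fun t =>
    f ∈ α t ω ∧ pullCount α t f ω < z
  have hsub : ((Finset.Ioc p n).filter fun t => α t ω ≠ b.Gstar)
      ⊆ D ∪ (Finset.univ.erase (b.g 0)).biUnion Q := by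
    intro t ht
    rw [Finset.mem_filter, Finset.mem_Ioc] at ht
    by_cases hdev : ω ∈ deviationEvent E C m τ₀ ζ X α t
    · exact Finset.mem_union_left _ (Finset.mem_filter.2 ⟨Finset.mem_Ioc.2 ht.1, hdev⟩)
    · obtain ⟨f, hf, hf0, hlt⟩ := h.exists_pullCount_lt hM b hgap hC hτ hζ ht.1.1 ht.1.2 ht.2 hdev
      refine Finset.mem_union_right _ (Finset.mem_biUnion.2 ⟨f, by simp [hf0],
        Finset.mem_filter.2 ⟨Finset.mem_Ioc.2 ht.1, hf, ?_⟩⟩)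
      exact_mod_cast hlt.trans_le (hz f hf0)
  have hQ : ∀ f ∈ Finset.univ.erase (b.g 0), (Q f).card ≤ z - 1 := fun f _ =>
    card_selected_of_pullCount_lt (α := α) (e := f) (ω := ω) _ z fun t ht => by
      obtain ⟨ht1, ht2, ht3⟩ := Finset.mem_filter.1 ht
      rw [Finset.mem_Ioc] at ht1
      exact ⟨by omega, ht2, h.one_le_pullCount hM ht1.1 ht1.2 f ω, ht3⟩
  have hcard : ((Finset.Ioc p n).filter fun t => α t ω ≠ b.Gstar).card
      ≤ D.card + (m ^ 2 - 1) * (z - 1) := by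
    refine (Finset.card_le_card hsub).trans ((Finset.card_union_le _ _).trans
      (Nat.add_le_add_left ((Finset.card_biUnion_le_card_mul _ _ _ hQ).trans_eq ?_) _))
    rw [Finset.card_erase_of_mem (Finset.mem_univ _), Finset.card_univ, Fintype.card_prod, hA, hI,
      sq]
  have hD : ∑ t ∈ Finset.Ioc p n, (deviationEvent E C m τ₀ ζ X α t).indicator
      (fun _ => (1 : ℝ)) ω = D.card := by
    rw [Finset.card_filter]
    push_cast
    exact Finset.sum_congr rfl fun t _ => by simp [Set.indicator]
  have hm1 : 1 ≤ m ^ 2 := Nat.one_le_pow _ _ (Nat.pos_of_ne_zero (NeZero.ne m))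
  rw [hD]
  have hcast : (((m ^ 2 - 1 : ℕ) : ℕ) : ℝ) = (m : ℝ) ^ 2 - 1 := by
    rw [Nat.cast_sub hm1]; push_cast; ring
  rw [← hcast, add_comm]
  exact_mod_cast hcard

/-- The total loss `∑ w` of the selected suboptimal edges. Each of them is selected at most once
initially, and afterwards only in the `N` epochs with a wrong matching, where at most one edge of
`S₁`, whose edges share an agent, is selected. -/
lemma IsMGEUCB.sum_selected_subopt_le (h : IsMGEUCB E C m τ₀ ζ n M p Pr ℱ θ X α)
    (hM : IsInitialPlay E.cls E.cap M p) (b : GreedyBenchmark E.cls E.cap E.mean m)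
    {w : A × I → ℝ} (hw : ∀ e, e ∈ b.subopt → 0 ≤ w e)
    {S₁ : Finset (A × I)} (hS₁ : S₁ ⊆ b.suboptFinset) {a : A} (ha : ∀ e ∈ S₁, e.1 = a)
    {e₀ : A × I} (he₀ : e₀ ∈ S₁) (hmax : ∀ e ∈ S₁, w e ≤ w e₀) (ω : Ω) :
    ∑ k ∈ Finset.Icc 1 n, ∑ e ∈ b.suboptFinset, (if e ∈ α k ω then w e else 0)
      ≤ ∑ e ∈ b.suboptFinset, w e
        + (((Finset.Ioc p n).filter fun t => α t ω ≠ b.Gstar).card : ℝ)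
          * (∑ e ∈ b.suboptFinset, w e - ∑ e ∈ S₁.erase e₀, w e) := by
  set S := b.suboptFinset
  set N := (Finset.Ioc p n).filter fun t => α t ω ≠ b.Gstar with hN
  have hw' : ∀ e ∈ S, 0 ≤ w e := fun e he => hw e (b.mem_suboptFinset.1 he)
  set V : A × I → Finset ℕ := fun e => (Finset.Ioc p n).filter fun t => e ∈ α t ω with hV
  set V₀ : A × I → Finset ℕ := fun e => (Finset.Icc 1 (min p n)).filter fun t => e ∈ α t ω
  have hVN : ∀ e ∈ S, V e ⊆ N := by
    intro e he t ht
    obtain ⟨ht1, ht2⟩ := Finset.mem_filter.1 ht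
    refine Finset.mem_filter.2 ⟨ht1, fun heq => ?_⟩
    exact b.notMem_subopt_of_mem_Gstar (heq ▸ ht2) (b.mem_suboptFinset.1 he)
  have hV₀ : ∀ e, (V₀ e).card ≤ 1 := by
    intro e
    refine Finset.card_le_one.2 fun s hs t ht => ?_
    obtain ⟨hs1, hs2⟩ := Finset.mem_filter.1 hs
    obtain ⟨ht1, ht2⟩ := Finset.mem_filter.1 ht
    rw [Finset.mem_Icc, le_min_iff] at hs1 ht1
    rw [h.init s (Finset.mem_Icc.2 ⟨hs1.1, hs1.2.2⟩) hs1.2.1] at hs2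
    rw [h.init t (Finset.mem_Icc.2 ⟨ht1.1, ht1.2.2⟩) ht1.2.1] at ht2
    exact hM.eq_of_mem (Finset.mem_Icc.2 ⟨hs1.1, hs1.2.1⟩) (Finset.mem_Icc.2 ⟨ht1.1, ht1.2.1⟩)
      hs2 ht2
  have hT : ∀ e ∈ S, ∑ k ∈ Finset.Icc 1 n, (if e ∈ α k ω then w e else 0)
      ≤ w e + (V e).card * w e := by
    intro e he
    rw [← Finset.sum_filter, Finset.sum_const, nsmul_eq_mul]
    have hsub : (Finset.Icc 1 n).filter (fun k => e ∈ α k ω) ⊆ V₀ e ∪ V e := by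
      intro k hk
      obtain ⟨hk1, hk2⟩ := Finset.mem_filter.1 hk
      rw [Finset.mem_Icc] at hk1
      rcases le_or_gt k p with hkp | hkp
      · exact Finset.mem_union_left _ (Finset.mem_filter.2
          ⟨Finset.mem_Icc.2 ⟨hk1.1, le_min hkp hk1.2⟩, hk2⟩)
      · exact Finset.mem_union_right _ (Finset.mem_filter.2
          ⟨Finset.mem_Ioc.2 ⟨hkp, hk1.2⟩, hk2⟩)
    have hcard : ((Finset.Icc 1 n).filter (fun k => e ∈ α k ω)).card ≤ 1 + (V e).card :=
      (Finset.card_le_card hsub).trans ((Finset.card_union_le _ _).trans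
        (Nat.add_le_add_right (hV₀ e) _))
    have : (((Finset.Icc 1 n).filter (fun k => e ∈ α k ω)).card : ℝ) ≤ 1 + (V e).card := by
      exact_mod_cast hcard
    calc _ ≤ (1 + ((V e).card : ℝ)) * w e := mul_le_mul_of_nonneg_right this (hw' e he)
      _ = _ := by ring
  have hS₁V : ∑ e ∈ S₁, ((V e).card : ℝ) ≤ N.card := by
    have hdisj : (S₁ : Set (A × I)).PairwiseDisjoint V := by
      intro e he f hf hef
      refine Finset.disjoint_left.2 fun t hte htf => hef ?_
      obtain ⟨ht1, ht2⟩ := Finset.mem_filter.1 hte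
      rw [Finset.mem_Ioc] at ht1
      exact (h.isFeasible hM (Finset.mem_Icc.2 ⟨by omega, ht1.2⟩) ω).1 e ht2 f
        (Finset.mem_filter.1 htf).2 (by rw [ha e he, ha f hf])
    have h1 : (S₁.biUnion V).card ≤ N.card :=
      Finset.card_le_card (Finset.biUnion_subset.2 fun e he => hVN e (hS₁ he))
    rw [Finset.card_biUnion hdisj] at h1
    exact_mod_cast h1
  have h1 : ∑ e ∈ S₁, (V e).card * w e ≤ N.card * w e₀ :=
    calc ∑ e ∈ S₁, (V e).card * w e ≤ ∑ e ∈ S₁, ((V e).card : ℝ) * w e₀ :=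
          Finset.sum_le_sum fun e he => mul_le_mul_of_nonneg_left (hmax e he) (Nat.cast_nonneg _)
      _ = (∑ e ∈ S₁, ((V e).card : ℝ)) * w e₀ := (Finset.sum_mul _ _ _).symm
      _ ≤ N.card * w e₀ := mul_le_mul_of_nonneg_right hS₁V (hw' e₀ (hS₁ he₀))
  have h2 : ∑ e ∈ S \ S₁, (V e).card * w e ≤ N.card * ∑ e ∈ S \ S₁, w e := by
    rw [Finset.mul_sum]
    refine Finset.sum_le_sum fun e he => ?_
    have heS := (Finset.mem_sdiff.1 he).1
    refine mul_le_mul_of_nonneg_right ?_ (hw' e heS)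
    exact_mod_cast Finset.card_le_card (hVN e heS)
  have h3 : ∑ e ∈ S \ S₁, w e + ∑ e ∈ S₁, w e = ∑ e ∈ S, w e := Finset.sum_sdiff hS₁
  have h4 : ∑ e ∈ S \ S₁, (V e).card * w e + ∑ e ∈ S₁, (V e).card * w e
      = ∑ e ∈ S, (V e).card * w e := Finset.sum_sdiff hS₁
  have h5 : ∑ e ∈ S₁.erase e₀, w e + w e₀ = ∑ e ∈ S₁, w e := Finset.sum_erase_add _ _ he₀
  have h6 : ∑ e ∈ S, w e - ∑ e ∈ S₁.erase e₀, w e = ∑ e ∈ S \ S₁, w e + w e₀ := by linarith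
  rw [Finset.sum_comm, h6]
  have h7 := Finset.sum_le_sum hT
  rw [Finset.sum_add_distrib] at h7
  rw [mul_add]
  linarith

end Counting

/-! ### Decomposition of the regret -/

section Regret

/-- The benchmark reward that a feasible set leaves unmatched. -/
lemma sum_le_sum_feasible_add {A I K : Type*} [Fintype A] [DecidableEq A] [DecidableEq K]
    {cls : A × I → K} {cap : K → ℕ} {N : Finset (A × I)} (hN : IsFeasible cls cap N)
    {v : A → ℝ} (hv : ∀ a, v a ≤ 1) :
    ∑ a, v a ≤ ∑ e ∈ N, v e.1 + (Fintype.card A - N.card) := by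
  have hinj : Set.InjOn Prod.fst (N : Set (A × I)) := fun e he f hf h => hN.1 e he f hf h
  have h1 : ∑ e ∈ N, v e.1 = ∑ a ∈ N.image Prod.fst, v a := (Finset.sum_image hinj).symm
  have h2 : (N.image Prod.fst).card = N.card := Finset.card_image_of_injOn hinj
  have h3 := Finset.sum_add_sum_compl (N.image Prod.fst) v
  have h4 : ∑ a ∈ (N.image Prod.fst)ᶜ, v a ≤ Fintype.card A - N.card := by
    refine (Finset.sum_le_card_nsmul _ _ 1 fun a _ => hv a).trans_eq ?_
    rw [nsmul_eq_mul, mul_one, Finset.card_compl, h2, Nat.cast_sub]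
    rw [← h2]
    exact Finset.card_le_univ _
  linarith

lemma IsFeasible.card_le {A I K : Type*} [Fintype A] [DecidableEq A] [DecidableEq K]
    {cls : A × I → K} {cap : K → ℕ} {N : Finset (A × I)} (hN : IsFeasible cls cap N) :
    N.card ≤ Fintype.card A := by
  have hinj : Set.InjOn Prod.fst (N : Set (A × I)) := fun e he f hf h => hN.1 e he f hf h
  rw [← Finset.card_image_of_injOn hinj]
  exact Finset.card_le_univ _

variable {A I K : Type*} {Θ : A → Type*} [Fintype A] [Fintype I]
  [DecidableEq A] [DecidableEq I] [DecidableEq K]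
  [∀ a, Fintype (Θ a)] [∀ a, DecidableEq (Θ a)]
  {m : ℕ} {E : MatchingEnv A I K Θ} {C : A × I → ℝ} {τ₀ ζ n : ℕ} {M : ℕ → Finset (A × I)} {p : ℕ}
  {Ω : Type*} [mΩ : MeasurableSpace Ω] {Pr : Measure Ω}
  {ℱ : Filtration ℕ mΩ} {θ : ℕ → (a : A) → Ω → Θ a} {X : ℕ → A → Ω → ℝ}
  {α : ℕ → Ω → Finset (A × I)}

/-- The number of agents left unmatched is at most `m - 1` in each initial epoch, and zero
afterwards. -/
lemma IsMGEUCB.sub_card_le (h : IsMGEUCB E C m τ₀ ζ n M p Pr ℱ θ X α)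
    (hA : Fintype.card A = m) (hmatch : ∀ M, Maximal (IsFeasible E.cls E.cap) M →
      ∀ a, ∃ i, (a, i) ∈ M)
    (hM : IsInitialPlay E.cls E.cap M p) {k : ℕ} (hk : k ∈ Finset.Icc 1 n) (ω : Ω) :
    (m : ℝ) - (α k ω).card ≤ if k ≤ p then (m : ℝ) - 1 else 0 := by
  split_ifs with hkp
  · have h1 := hM.nonempty_matching (Finset.mem_Icc.2 ⟨(Finset.mem_Icc.1 hk).1, hkp⟩)
    rw [← h.init k hk hkp ω] at h1
    have : (1 : ℝ) ≤ (α k ω).card := by exact_mod_cast h1.card_pos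
    linarith
  · have h1 := hmatch _ (h.greedy k hk (not_le.1 hkp) ω).maximal
    have h2 : (Finset.univ : Finset A) ⊆ (α k ω).image Prod.fst := fun a _ => by
      obtain ⟨i, hi⟩ := h1 a
      exact Finset.mem_image.2 ⟨(a, i), hi, rfl⟩
    have h3 := (Finset.card_le_card h2).trans Finset.card_image_le
    rw [Finset.card_univ, hA] at h3
    have : (m : ℝ) ≤ (α k ω).card := by exact_mod_cast h3
    linarith

variable [IsProbabilityMeasure Pr]

/-- The regret is at most the expected loss of the selected suboptimal edges, the reward of the
agents left unmatched by the initial matchings, and the bias of the remaining edges. -/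
lemma IsMGEUCB.regret_le (h : IsMGEUCB E C m τ₀ ζ n M p Pr ℱ θ X α) (hm : 1 ≤ m)
    (hA : Fintype.card A = m) (hI : Fintype.card I = m)
    (hmatch : ∀ M, Maximal (IsFeasible E.cls E.cap) M → ∀ a, ∃ i, (a, i) ∈ M)
    (hM : IsInitialPlay E.cls E.cap M p) (b : GreedyBenchmark E.cls E.cap E.mean m)
    (hC : ∀ e, IsMixingConstant (E.P e) (E.stat e) (C e)) (hτ : 1 ≤ τ₀) (hζ : 1 ≤ ζ)
    (hn : 1 ≤ n) :
    regret Pr E.mean b.Gstar τ₀ ζ X α n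
      ≤ ∫ ω, ∑ k ∈ Finset.Icc 1 n, ∑ e ∈ b.suboptFinset,
          (if e ∈ α k ω then b.gap e + C e / τ₀ else 0) ∂Pr
        + (m : ℝ) ^ 2 * (m - 1)
        + m * sSup (C '' {e | e ∉ b.subopt}) / ζ
          * (1 + Real.log ((ζ : ℝ) * ((n : ℝ) - 1) / τ₀ + 1)) := by
  set Cs := sSup (C '' {e | e ∉ b.subopt})
  have hCs : ∀ e, e ∉ b.subopt → C e ≤ Cs := fun e he =>
    le_csSup (Set.toFinite _).bddAbove (Set.mem_image_of_mem _ he)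
  have hC0 : ∀ e, 0 ≤ C e := fun e => (hC e).nonneg (E.stat_mem e)
  have hm1 : (1 : ℝ) ≤ m := by exact_mod_cast hm
  have hCs0 : 0 ≤ Cs := (hC0 _).trans (hCs (b.g ⟨0, hm⟩)
    (b.notMem_subopt_of_mem_Gstar (b.g_mem_Gstar _)))
  set v : A → ℝ := fun a => E.mean (a, b.istar a)
  have hlenpos : ∀ k, (0 : ℝ) < epochLen τ₀ ζ k := fun k => by
    have : 0 < epochLen τ₀ ζ k := by simp only [epochLen]; omega
    exact_mod_cast this
  have hτ0 : (0 : ℝ) < τ₀ := by exact_mod_cast hτ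
  -- the loss of one epoch, for a given matching
  have hpt : ∀ k ∈ Finset.Icc 1 n, ∀ ω, ∑ a, v a - ∑ e ∈ α k ω, (E.mean e - C e / epochLen τ₀ ζ k)
      ≤ ∑ e ∈ b.suboptFinset, (if e ∈ α k ω then b.gap e + C e / τ₀ else 0)
        + ((if k ≤ p then (m : ℝ) - 1 else 0) + m * Cs * (1 / (epochLen τ₀ ζ k : ℝ))) := by
    intro k hk ω
    have hfeas := h.isFeasible hM hk ω
    have h1 := sum_le_sum_feasible_add hfeas (v := v) fun a => (E.mean_mem _).2
    rw [hA] at h1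
    have h2 := h.sub_card_le hA hmatch hM hk ω
    have h3 : ∑ e ∈ α k ω, (v e.1 - (E.mean e - C e / epochLen τ₀ ζ k))
        ≤ ∑ e ∈ α k ω, ((if e ∈ b.suboptFinset then b.gap e + C e / τ₀ else 0)
          + Cs * (1 / (epochLen τ₀ ζ k : ℝ))) := by
      refine Finset.sum_le_sum fun e _ => ?_
      have h4 : 0 ≤ Cs * (1 / (epochLen τ₀ ζ k : ℝ)) :=
        mul_nonneg hCs0 (one_div_nonneg.2 (hlenpos k).le)
      split_ifs with hS
      · rw [b.gap_of_mem_subopt (b.mem_suboptFinset.1 hS)]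
        have h5 : C e / epochLen τ₀ ζ k ≤ C e / τ₀ := by
          refine div_le_div_of_nonneg_left (hC0 e) hτ0 ?_
          exact_mod_cast Nat.le_add_right τ₀ (ζ * k)
        simp only [v]
        linarith
      · have hS' : e ∉ b.subopt := fun hmem => hS (b.mem_suboptFinset.2 hmem)
        have h5 : v e.1 ≤ E.mean e := not_lt.1 hS'
        have h6 : C e / epochLen τ₀ ζ k ≤ Cs * (1 / (epochLen τ₀ ζ k : ℝ)) := by
          rw [mul_one_div]
          exact div_le_div_of_nonneg_right (hCs e hS') (hlenpos k).le
        linarith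
    have h7 : ((α k ω).card : ℝ) * (Cs * (1 / (epochLen τ₀ ζ k : ℝ)))
        ≤ m * Cs * (1 / (epochLen τ₀ ζ k : ℝ)) := by
      rw [mul_assoc]
      refine mul_le_mul_of_nonneg_right ?_ (mul_nonneg hCs0 (one_div_nonneg.2 (hlenpos k).le))
      rw [← hA]
      exact_mod_cast hfeas.card_le
    have h8 : ∑ e ∈ α k ω, (if e ∈ b.suboptFinset then b.gap e + C e / τ₀ else 0)
        = ∑ e ∈ b.suboptFinset, (if e ∈ α k ω then b.gap e + C e / τ₀ else 0) := by
      rw [Finset.sum_ite_mem, Finset.sum_ite_mem, Finset.inter_comm]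
    rw [Finset.sum_add_distrib, Finset.sum_const, nsmul_eq_mul, h8, Finset.sum_sub_distrib] at h3
    linarith
  have hint1 : ∀ k ∈ Finset.Icc 1 n, Integrable (fun ω => ∑ e ∈ b.suboptFinset,
      (if e ∈ α k ω then b.gap e + C e / τ₀ else 0)) Pr := fun k hk =>
    integrable_finsetSum _ fun e _ => h.integrable_ite hk e _
  have hint2 : ∀ k ∈ Finset.Icc 1 n, Integrable (fun ω => ∑ e ∈ α k ω,
      (E.mean e - C e / epochLen τ₀ ζ k)) Pr := fun k hk => by
    rw [show (fun ω => ∑ e ∈ α k ω, (E.mean e - C e / epochLen τ₀ ζ k))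
      = fun ω => ∑ e, if e ∈ α k ω then E.mean e - C e / epochLen τ₀ ζ k else 0 from
      funext fun ω => sum_mem_eq_sum_ite _ _]
    exact integrable_finsetSum _ fun e _ => h.integrable_ite hk e _
  have hepoch : ∀ k ∈ Finset.Icc 1 n, ∑ a, v a - ∫ ω, ∑ e ∈ α k ω, epochAvg τ₀ ζ X k e ω ∂Pr
      ≤ ∫ ω, ∑ e ∈ b.suboptFinset, (if e ∈ α k ω then b.gap e + C e / τ₀ else 0) ∂Pr
        + ((if k ≤ p then (m : ℝ) - 1 else 0) + m * Cs * (1 / (epochLen τ₀ ζ k : ℝ))) := by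
    intro k hk
    have h1 := h.integral_sum_mean_sub_le hτ hC hk
    have h2 := integral_mono ((integrable_const (∑ a, v a)).sub (hint2 k hk))
      ((hint1 k hk).add (integrable_const _)) (hpt k hk)
    simp only [Pi.add_apply, Pi.sub_apply] at h2
    rw [integral_sub (integrable_const _) (hint2 k hk), integral_add (hint1 k hk)
      (integrable_const _)] at h2
    simp only [integral_const, probReal_univ, one_smul] at h2
    linarith
  have hsum := Finset.sum_le_sum hepoch
  have hp : ∑ k ∈ Finset.Icc 1 n, (if k ≤ p then (m : ℝ) - 1 else 0) ≤ (m : ℝ) ^ 2 * (m - 1) := by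
    rw [← Finset.sum_filter, Finset.sum_const, nsmul_eq_mul]
    refine mul_le_mul_of_nonneg_right ?_ (by linarith)
    have h1 : ((Finset.Icc 1 n).filter fun k => k ≤ p).card ≤ p := by
      have : ((Finset.Icc 1 n).filter fun k => k ≤ p) ⊆ Finset.Icc 1 p := fun k hk => by
        rw [Finset.mem_filter, Finset.mem_Icc] at hk
        exact Finset.mem_Icc.2 ⟨hk.1.1, hk.2⟩
      simpa using Finset.card_le_card this
    have h2 := hM.le_card
    rw [hA, hI, ← sq] at h2
    exact_mod_cast h1.trans h2
  have hbias : ∑ k ∈ Finset.Icc 1 n, m * Cs * (1 / (epochLen τ₀ ζ k : ℝ))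
      ≤ m * Cs / ζ * (1 + Real.log ((ζ : ℝ) * ((n : ℝ) - 1) / τ₀ + 1)) := by
    rw [← Finset.mul_sum]
    calc _ ≤ m * Cs * (1 / ζ * (1 + Real.log ((ζ : ℝ) * ((n : ℝ) - 1) / τ₀ + 1))) :=
          mul_le_mul_of_nonneg_left (sum_Icc_inv_epochLen_le_log hτ hζ hn) (by positivity)
      _ = _ := by ring
  rw [regret, b.sum_Gstar, integral_finsetSum _ hint1]
  rw [Finset.sum_sub_distrib, Finset.sum_const, Nat.card_Icc, Nat.add_sub_cancel, nsmul_eq_mul,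
    Finset.sum_add_distrib, Finset.sum_add_distrib] at hsum
  linarith

end Regret

/-! ### The regret bound -/

lemma pullThreshold_nonneg (m τ₀ ζ n : ℕ) (Δ c : ℝ) : 0 ≤ pullThreshold m τ₀ ζ n Δ c := by
  rw [pullThreshold]; positivity

/-- For at least two agents the thresholds are bounded below by `16 log 2 / Δ²`, and
`16 log 2 > 11`. -/
lemma eleven_le_pullThreshold_mul_sq {m τ₀ ζ n : ℕ} (hm : 2 ≤ m) (hn : 1 ≤ n) {Δ c : ℝ}
    (hΔ : 0 < Δ) (hc : 0 ≤ c) : 11 ≤ pullThreshold m τ₀ ζ n Δ c * Δ ^ 2 := by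
  have h1 : 0 ≤ rhoConst τ₀ ζ c / Real.sqrt τ₀ := by rw [rhoConst]; positivity
  have h2 : 0 ≤ Real.log n := Real.log_nonneg (by exact_mod_cast hn)
  have h3 : Real.log 2 ≤ Real.log m := Real.log_le_log (by norm_num) (by exact_mod_cast hm)
  have h4 := Real.log_two_gt_d9
  have h5 : 0 ≤ 6 * Real.log n + 4 * Real.log m := by linarith
  have h6 := Real.sq_sqrt h5
  have h7 := Real.sqrt_nonneg (6 * Real.log n + 4 * Real.log m)
  have h8 : pullThreshold m τ₀ ζ n Δ c * Δ ^ 2 = 4 * (rhoConst τ₀ ζ c / Real.sqrt τ₀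
      + Real.sqrt (6 * Real.log n + 4 * Real.log m)) ^ 2 := by
    rw [pullThreshold]; field_simp
  rw [h8]
  nlinarith [mul_nonneg h1 h7, sq_nonneg (rhoConst τ₀ ζ c / Real.sqrt τ₀)]

/-- The arithmetic that absorbs the agents left unmatched initially: `s` is the total weight of the
suboptimal edges, `r` that of the edges of one agent except the heaviest, `z` the rounded
threshold `x`, and `l` bounds half the expected number of epochs with a deviation. -/
lemma regret_arithmetic {m s r x z l : ℝ} (hm : 2 ≤ m) (hs : 0 ≤ s) (hr : 0 ≤ r) (hl : 0 ≤ l)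
    (hzx : z - 1 ≤ x) (h₁ : 9 * (m - 1) ≤ (z - 2) * s) (h₂ : 10 * (m - 2) ≤ (z - 1) * r) :
    s + ((m ^ 2 - 1) * (z - 1) + 2 * l) * (s - r) + m ^ 2 * (m - 1)
      ≤ s * (m ^ 2 * x + 2 * l) := by
  have h3 : s * (m ^ 2 * (z - 1)) ≤ s * (m ^ 2 * x) :=
    mul_le_mul_of_nonneg_left (mul_le_mul_of_nonneg_left hzx (sq_nonneg m)) hs
  have h4 : (m ^ 2 - 1) * (10 * (m - 2)) ≤ (m ^ 2 - 1) * ((z - 1) * r) :=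
    mul_le_mul_of_nonneg_left h₂ (by nlinarith)
  have h5 : 0 ≤ 2 * l * r := by positivity
  have h6 : m ^ 2 * (m - 1) ≤ 9 * (m - 1) + (m ^ 2 - 1) * (10 * (m - 2)) := by
    have h7 : 0 ≤ (m - 1) * (9 * m ^ 2 - 10 * m - 11) :=
      mul_nonneg (by linarith) (by nlinarith)
    nlinarith
  nlinarith

section Bound

variable {A I K : Type*} {Θ : A → Type*} [Fintype A] [Fintype I]
  [DecidableEq A] [DecidableEq I] [DecidableEq K]
  [∀ a, Fintype (Θ a)] [∀ a, DecidableEq (Θ a)]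
  {m : ℕ} [NeZero m] {E : MatchingEnv A I K Θ} {C : A × I → ℝ} {τ₀ ζ n : ℕ}
  {M : ℕ → Finset (A × I)} {p : ℕ}
  {Ω : Type*} [mΩ : MeasurableSpace Ω] {Pr : Measure Ω} [IsProbabilityMeasure Pr]
  {ℱ : Filtration ℕ mΩ} {θ : ℕ → (a : A) → Ω → Θ a} {X : ℕ → A → Ω → ℝ}
  {α : ℕ → Ω → Finset (A × I)}

/-- The expected loss of the selected suboptimal edges. -/
lemma IsMGEUCB.integral_sum_selected_subopt_le (h : IsMGEUCB E C m τ₀ ζ n M p Pr ℱ θ X α)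
    (hA : Fintype.card A = m) (hI : Fintype.card I = m)
    (hM : IsInitialPlay E.cls E.cap M p) (b : GreedyBenchmark E.cls E.cap E.mean m)
    (hgap : ∀ e, e ≠ b.g 0 → 0 < b.gap e)
    (hC : ∀ e, IsMixingConstant (E.P e) (E.stat e) (C e)) (hτ : 1 ≤ τ₀) (hζ : 1 ≤ ζ)
    {z : ℕ} (hz : ∀ e, e ≠ b.g 0 → pullThreshold m τ₀ ζ n (b.gap e) (C e) ≤ z)
    {w : A × I → ℝ} (hw : ∀ e, e ∈ b.subopt → 0 ≤ w e)
    {S₁ : Finset (A × I)} (hS₁ : S₁ ⊆ b.suboptFinset) {a : A} (ha : ∀ e ∈ S₁, e.1 = a)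
    {e₀ : A × I} (he₀ : e₀ ∈ S₁) (hmax : ∀ e ∈ S₁, w e ≤ w e₀) :
    ∫ ω, ∑ k ∈ Finset.Icc 1 n, ∑ e ∈ b.suboptFinset, (if e ∈ α k ω then w e else 0) ∂Pr
      ≤ ∑ e ∈ b.suboptFinset, w e
        + (((m : ℝ) ^ 2 - 1) * ((z - 1 : ℕ) : ℝ) + 2 * (1 + Real.log n))
          * (∑ e ∈ b.suboptFinset, w e - ∑ e ∈ S₁.erase e₀, w e) := by
  have hm : 1 ≤ m := Nat.pos_of_ne_zero (NeZero.ne m)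
  set s := ∑ e ∈ b.suboptFinset, w e
  set r := ∑ e ∈ S₁.erase e₀, w e
  have hsr : 0 ≤ s - r := sub_nonneg.2 (Finset.sum_le_sum_of_subset_of_nonneg
    ((Finset.erase_subset _ _).trans hS₁) fun e he _ => hw e (b.mem_suboptFinset.1 he))
  -- measurable hulls spare the measurability of the deviation events
  set D : ℕ → Set Ω := fun t => toMeasurable Pr (deviationEvent E C m τ₀ ζ X α t)
  have hDi : ∀ t, Integrable ((D t).indicator fun _ => (1 : ℝ)) Pr := fun t =>
    (integrable_const _).indicator (measurableSet_toMeasurable _ _)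
  have hDsum : Integrable (fun ω => ∑ t ∈ Finset.Ioc p n, (D t).indicator (fun _ => (1 : ℝ)) ω)
      Pr := integrable_finsetSum _ fun t _ => hDi t
  set B₀ := ((m : ℝ) ^ 2 - 1) * ((z - 1 : ℕ) : ℝ)
  have hpt : ∀ ω, ∑ k ∈ Finset.Icc 1 n, ∑ e ∈ b.suboptFinset, (if e ∈ α k ω then w e else 0)
      ≤ s + (B₀ + ∑ t ∈ Finset.Ioc p n, (D t).indicator (fun _ => (1 : ℝ)) ω) * (s - r) := by
    intro ω
    refine (h.sum_selected_subopt_le hM b hw hS₁ ha he₀ hmax ω).trans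
      (add_le_add le_rfl (mul_le_mul_of_nonneg_right ?_ hsr))
    refine (h.card_ne_Gstar_le hA hI hM b hgap hC hτ hζ hz ω).trans
      (add_le_add le_rfl (Finset.sum_le_sum fun t _ => ?_))
    exact Set.indicator_le_indicator_of_subset (subset_toMeasurable _ _)
      (fun _ => zero_le_one) ω
  have hL : Integrable (fun ω => ∑ k ∈ Finset.Icc 1 n, ∑ e ∈ b.suboptFinset,
      (if e ∈ α k ω then w e else 0)) Pr :=
    integrable_finsetSum _ fun k hk => integrable_finsetSum _ fun e _ => h.integrable_ite hk e _
  have hR : Integrable (fun ω => (B₀ + ∑ t ∈ Finset.Ioc p n,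
      (D t).indicator (fun _ => (1 : ℝ)) ω) * (s - r)) Pr :=
    ((integrable_const _).add hDsum).mul_const _
  have h1 := integral_mono hL ((integrable_const s).add hR) hpt
  refine h1.trans ?_
  simp only [Pi.add_apply]
  rw [integral_add (integrable_const _) hR, integral_mul_const,
    integral_add (integrable_const _) hDsum, integral_finsetSum _ fun t _ => hDi t]
  simp only [integral_const, probReal_univ, one_smul]
  refine add_le_add le_rfl (mul_le_mul_of_nonneg_right (add_le_add le_rfl ?_) hsr)
  calc ∑ t ∈ Finset.Ioc p n, ∫ ω, (D t).indicator (fun _ => (1 : ℝ)) ω ∂Pr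
      ≤ ∑ t ∈ Finset.Ioc p n, 2 * (1 / (t : ℝ)) := by
        refine Finset.sum_le_sum fun t ht => ?_
        rw [Finset.mem_Ioc] at ht
        rw [integral_indicator_const _ (measurableSet_toMeasurable _ _), smul_eq_mul, mul_one,
          measureReal_def, measure_toMeasurable]
        exact h.measureReal_deviationEvent_le hτ hζ hm hA hI hC (by omega) ht.2
    _ ≤ ∑ t ∈ Finset.Icc 1 n, 2 * (1 / (t : ℝ)) :=
        Finset.sum_le_sum_of_subset_of_nonneg (fun t ht => by
          rw [Finset.mem_Ioc] at ht
          exact Finset.mem_Icc.2 ⟨by omega, ht.2⟩) fun t _ _ => by positivity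
    _ ≤ 2 * (1 + Real.log n) := by
        rw [← Finset.mul_sum]
        exact mul_le_mul_of_nonneg_left (sum_Icc_one_div_le_one_add_log n) zero_le_two

/-- The finite-horizon regret bound. -/
lemma IsMGEUCB.regret_le_regretBound (h : IsMGEUCB E C m τ₀ ζ n M p Pr ℱ θ X α)
    (hA : Fintype.card A = m) (hI : Fintype.card I = m)
    (hmatch : ∀ M, Maximal (IsFeasible E.cls E.cap) M → ∀ a, ∃ i, (a, i) ∈ M)
    (hM : IsInitialPlay E.cls E.cap M p) (b : GreedyBenchmark E.cls E.cap E.mean m)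
    (hgap : ∀ e, e ≠ b.g 0 → 0 < b.gap e)
    (hC : ∀ e, IsMixingConstant (E.P e) (E.stat e) (C e)) (hτ : 1 ≤ τ₀) (hζ : 1 ≤ ζ)
    (hn : 1 ≤ n) {estar : A × I}
    (hest : ∀ e, e ≠ b.g 0 → ⌈pullThreshold m τ₀ ζ n (b.gap e) (C e)⌉
        ≤ ⌈pullThreshold m τ₀ ζ n (b.gap estar) (C estar)⌉) :
    regret Pr E.mean b.Gstar τ₀ ζ X α n ≤ regretBound b C τ₀ ζ estar n := by
  have hm : 1 ≤ m := Nat.pos_of_ne_zero (NeZero.ne m)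
  have hC0 : ∀ e, 0 ≤ C e := fun e => (hC e).nonneg (E.stat_mem e)
  refine (h.regret_le hm hA hI hmatch hM b hC hτ hζ hn).trans ?_
  set x := pullThreshold m τ₀ ζ n (b.gap estar) (C estar) with hx
  set w : A × I → ℝ := fun e => b.gap e + C e / τ₀ with hwdef
  set l := 1 + Real.log n
  have hl : 0 ≤ l := by
    have : 0 ≤ Real.log n := Real.log_nonneg (by exact_mod_cast hn)
    positivity
  have hgoal : regretBound b C τ₀ ζ estar n
      = (∑ e ∈ b.suboptFinset, w e) * ((m : ℝ) ^ 2 * x + 2 * l)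
        + m * sSup (C '' {e | e ∉ b.subopt}) / ζ
          * (1 + Real.log ((ζ : ℝ) * ((n : ℝ) - 1) / τ₀ + 1)) := by
    rw [Finset.sum_mul]
    refine congrArg₂ _ (Finset.sum_congr rfl fun e _ => mul_comm _ _) rfl
  rw [hgoal]
  refine add_le_add ?_ le_rfl
  have hne : ∀ e, e ∈ b.subopt → e ≠ b.g 0 := by
    rintro e he rfl
    exact b.notMem_subopt_of_mem_Gstar (b.g_mem_Gstar 0) he
  rcases hm.eq_or_lt with hm1 | hm2
  · -- with one agent there is only one edge
    have hS : b.suboptFinset = ∅ := by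
      refine Finset.eq_empty_of_forall_notMem fun e he => ?_
      have hsub : Subsingleton (A × I) := by
        rw [← Fintype.card_le_one_iff_subsingleton, Fintype.card_prod, hA, hI, ← hm1]
      exact hne e (b.mem_suboptFinset.1 he) (Subsingleton.elim _ _)
    simp [hS, ← hm1]
  have hm2' : (2 : ℝ) ≤ m := by exact_mod_cast hm2
  set z := ⌈x⌉.toNat with hzdef
  have hx0 : 0 ≤ ⌈x⌉ := Int.ceil_nonneg (pullThreshold_nonneg _ _ _ _ _ _)
  have hzx : (z : ℝ) = (⌈x⌉ : ℝ) := by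
    have : (z : ℤ) = ⌈x⌉ := Int.toNat_of_nonneg hx0
    exact_mod_cast this
  have hz : ∀ e, e ≠ b.g 0 → pullThreshold m τ₀ ζ n (b.gap e) (C e) ≤ z := fun e he => by
    rw [hzx]
    exact (Int.le_ceil _).trans (by exact_mod_cast hest e he)
  -- every suboptimal edge has a gap in `(0, 1]`, so the thresholds dominate its inverse
  have hbig : ∀ e, e ∈ b.subopt → 0 ≤ w e ∧ 11 ≤ (z : ℝ) ∧ 9 ≤ ((z : ℝ) - 2) * w e
      ∧ 10 ≤ ((z : ℝ) - 1) * w e := by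
    intro e he
    have h1 := hgap e (hne e he)
    have h2 : b.gap e ≤ 1 := by
      rw [b.gap_of_mem_subopt he]
      linarith [(E.mean_mem e).1, (E.mean_mem (e.1, b.istar e.1)).2]
    have h3 := (eleven_le_pullThreshold_mul_sq (τ₀ := τ₀) (ζ := ζ) hm2 hn h1 (hC0 e)).trans
      (mul_le_mul_of_nonneg_right (hz e (hne e he)) (sq_nonneg _))
    have h4 : 0 ≤ C e / τ₀ := div_nonneg (hC0 e) (Nat.cast_nonneg _)
    have hz0 : (0 : ℝ) ≤ z := Nat.cast_nonneg _
    have h5 : (z : ℝ) * b.gap e ^ 2 ≤ z * b.gap e :=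
      mul_le_mul_of_nonneg_left (by nlinarith) hz0
    have h6 : (z : ℝ) * b.gap e ≤ z := mul_le_of_le_one_right hz0 h2
    have h7 : b.gap e ≤ w e := by simp only [hwdef]; linarith
    refine ⟨h1.le.trans h7, by linarith, ?_, ?_⟩ <;> nlinarith
  set a := (b.g 0).1
  set S₁ : Finset (A × I) := (Finset.univ.image fun i : I => (a, i)).erase (b.g 0) with hS₁def
  have hS₁a : ∀ e ∈ S₁, e.1 = a := fun e he => by
    obtain ⟨i, -, rfl⟩ := Finset.mem_image.1 (Finset.mem_of_mem_erase he)
    rfl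
  have hS₁ : S₁ ⊆ b.suboptFinset := fun e he => b.mem_suboptFinset.2
    (b.mem_subopt_of_fst_eq hgap (hM.isFeasible_singleton e) (hS₁a e he)
      (Finset.ne_of_mem_erase he))
  have hcard : S₁.card = m - 1 := by
    rw [Finset.card_erase_of_mem (Finset.mem_image.2 ⟨(b.g 0).2, Finset.mem_univ _, rfl⟩),
      Finset.card_image_of_injective _ (Prod.mk_right_injective a), Finset.card_univ, hI]
  obtain ⟨e₀, he₀, hmax⟩ := Finset.exists_max_image S₁ w
    (Finset.card_pos.1 (by rw [hcard]; omega))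
  have hz11 := (hbig e₀ (b.mem_suboptFinset.1 (hS₁ he₀))).2.1
  have hcast : ((z - 1 : ℕ) : ℝ) = (z : ℝ) - 1 := by
    have : 1 ≤ z := by
      have : (1 : ℝ) ≤ z := by linarith
      exact_mod_cast this
    rw [Nat.cast_sub this, Nat.cast_one]
  have hint := h.integral_sum_selected_subopt_le hA hI hM b hgap hC hτ hζ hz
    (fun e he => (hbig e he).1) hS₁ hS₁a he₀ hmax
  rw [hcast] at hint
  have hw0 : ∀ e ∈ b.suboptFinset, 0 ≤ w e := fun e he => (hbig e (b.mem_suboptFinset.1 he)).1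
  have hS₁w : ∀ e ∈ S₁, 0 ≤ w e := fun e he => hw0 e (hS₁ he)
  refine (add_le_add hint le_rfl).trans (regret_arithmetic hm2' (Finset.sum_nonneg hw0)
    (Finset.sum_nonneg fun e he => hS₁w e (Finset.mem_of_mem_erase he)) hl ?_ ?_ ?_)
  · rw [hzx]
    linarith [Int.ceil_lt_add_one x]
  · have h1 : ∑ e ∈ S₁, w e ≤ ∑ e ∈ b.suboptFinset, w e :=
      Finset.sum_le_sum_of_subset_of_nonneg hS₁ fun e he _ => hw0 e he
    have h2 : 9 * ((m : ℝ) - 1) ≤ ((z : ℝ) - 2) * ∑ e ∈ S₁, w e := by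
      rw [Finset.mul_sum]
      have := Finset.card_nsmul_le_sum S₁ (fun e => ((z : ℝ) - 2) * w e) 9 fun e he =>
        (hbig e (b.mem_suboptFinset.1 (hS₁ he))).2.2.1
      rw [hcard, nsmul_eq_mul, Nat.cast_sub hm, Nat.cast_one] at this
      linarith
    exact h2.trans (mul_le_mul_of_nonneg_left h1 (by linarith))
  · rw [Finset.mul_sum]
    have := Finset.card_nsmul_le_sum (S₁.erase e₀) (fun e => ((z : ℝ) - 1) * w e) 10 fun e he =>
      (hbig e (b.mem_suboptFinset.1 (hS₁ (Finset.mem_of_mem_erase he)))).2.2.2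
    rw [Finset.card_erase_of_mem he₀, hcard, nsmul_eq_mul, Nat.sub_sub, Nat.cast_sub hm2] at this
    push_cast at this
    linarith

end Bound

/-! ### Logarithmic growth -/

lemma isBigO_const_log_natCast (c : ℝ) :
    (fun _ : ℕ => c) =O[atTop] fun n : ℕ => Real.log n :=
  (Real.isLittleO_const_log_atTop.comp_tendsto tendsto_natCast_atTop_atTop).isBigO

lemma isBigO_pullThreshold (m τ₀ ζ : ℕ) (Δ c : ℝ) :
    (fun n : ℕ => pullThreshold m τ₀ ζ n Δ c) =O[atTop] fun n : ℕ => Real.log n := by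
  set q := rhoConst τ₀ ζ c / Real.sqrt τ₀
  have h : (fun n : ℕ => 4 / Δ ^ 2 * (2 * q ^ 2 + 8 * Real.log m) + 4 / Δ ^ 2 * 12 * Real.log n)
      =O[atTop] fun n : ℕ => Real.log n :=
    (isBigO_const_log_natCast _).add ((Asymptotics.isBigO_refl _ _).const_mul_left _)
  refine (Asymptotics.IsBigO.of_bound 1 ?_).trans h
  filter_upwards [eventually_ge_atTop 1] with n hn
  have hn0 : 0 ≤ Real.log n := Real.log_nonneg (by exact_mod_cast hn)
  have hm0 : 0 ≤ Real.log m := Real.log_natCast_nonneg m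
  rw [one_mul, Real.norm_eq_abs, Real.norm_eq_abs, abs_of_nonneg (pullThreshold_nonneg _ _ _ _ _ _)]
  refine le_trans ?_ (le_abs_self _)
  have h1 : (q + Real.sqrt (6 * Real.log n + 4 * Real.log m)) ^ 2
      ≤ (2 * q ^ 2 + 8 * Real.log m) + 12 * Real.log n := by
    have h2 := Real.sq_sqrt (show 0 ≤ 6 * Real.log n + 4 * Real.log m by positivity)
    nlinarith [sq_nonneg (q - Real.sqrt (6 * Real.log n + 4 * Real.log m))]
  calc pullThreshold m τ₀ ζ n Δ c
      ≤ 4 / Δ ^ 2 * ((2 * q ^ 2 + 8 * Real.log m) + 12 * Real.log n) :=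
        mul_le_mul_of_nonneg_left h1 (by positivity)
    _ = _ := by ring

lemma isBigO_regretBound {A I K : Type*} [Fintype A] [Fintype I]
    [DecidableEq A] [DecidableEq I] [DecidableEq K] {cls : A × I → K} {cap : K → ℕ}
    {μ : A × I → ℝ} {m : ℕ} (b : GreedyBenchmark cls cap μ m) (C : A × I → ℝ) {τ₀ ζ : ℕ}
    (hτ : 1 ≤ τ₀) (estar : ℕ → A × I) :
    (fun n : ℕ => regretBound b C τ₀ ζ (estar n) n) =O[atTop] fun n : ℕ => Real.log n := by
  have hthr : (fun n : ℕ => pullThreshold m τ₀ ζ n (b.gap (estar n)) (C (estar n)))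
      =O[atTop] fun n : ℕ => Real.log n := by
    refine (Asymptotics.IsBigO.of_bound 1 (Eventually.of_forall fun n => ?_)).trans
      (Asymptotics.IsBigO.fun_sum (s := (Finset.univ : Finset (A × I)))
        fun e _ => isBigO_pullThreshold m τ₀ ζ (b.gap e) (C e))
    have h0 : ∀ e, 0 ≤ pullThreshold m τ₀ ζ n (b.gap e) (C e) := fun e =>
      pullThreshold_nonneg _ _ _ _ _ _
    rw [one_mul, Real.norm_eq_abs, Real.norm_eq_abs, abs_of_nonneg (h0 _),
      abs_of_nonneg (Finset.sum_nonneg fun e _ => h0 e)]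
    exact Finset.single_le_sum (f := fun e => pullThreshold m τ₀ ζ n (b.gap e) (C e))
      (fun e _ => h0 e) (Finset.mem_univ (estar n))
  have hlog : (fun n : ℕ => 1 + Real.log n) =O[atTop] fun n : ℕ => Real.log n :=
    (isBigO_const_log_natCast 1).add (Asymptotics.isBigO_refl _ _)
  have hbias : (fun n : ℕ => 1 + Real.log ((ζ : ℝ) * ((n : ℝ) - 1) / τ₀ + 1))
      =O[atTop] fun n : ℕ => Real.log n := by
    refine (isBigO_const_log_natCast 1).add ((Asymptotics.IsBigO.of_bound 1 ?_).trans
      ((isBigO_const_log_natCast (Real.log (ζ + 1))).add (Asymptotics.isBigO_refl _ _)))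
    filter_upwards [eventually_ge_atTop 1] with n hn
    have hn1 : (1 : ℝ) ≤ n := by exact_mod_cast hn
    have hτ1 : (1 : ℝ) ≤ τ₀ := by exact_mod_cast hτ
    have hζ0 : (0 : ℝ) ≤ ζ := Nat.cast_nonneg _
    have h1 : 0 ≤ (ζ : ℝ) * ((n : ℝ) - 1) / τ₀ :=
      div_nonneg (mul_nonneg hζ0 (by linarith)) (by linarith)
    rw [one_mul, Real.norm_eq_abs, Real.norm_eq_abs, abs_of_nonneg (Real.log_nonneg (by linarith))]
    refine le_trans ?_ (le_abs_self _)
    rw [← Real.log_mul (by positivity) (by positivity)]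
    refine Real.log_le_log (by linarith) ?_
    have h2 : (ζ : ℝ) * ((n : ℝ) - 1) / τ₀ ≤ ζ * (n - 1) :=
      div_le_self (mul_nonneg hζ0 (by linarith)) hτ1
    nlinarith
  unfold regretBound
  refine Asymptotics.IsBigO.add (Asymptotics.IsBigO.fun_sum fun e _ => ?_) (hbias.const_mul_left _)
  simp_rw [mul_comm _ (b.gap e + C e / (τ₀ : ℝ))]
  exact ((hthr.const_mul_left _).add (hlog.const_mul_left _)).const_mul_left _

theorem mainTheorem5 {A I K : Type*} {Θ : A → Type*} [Fintype A] [Fintype I]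
    [DecidableEq A] [DecidableEq I] [DecidableEq K]
    [∀ a, Fintype (Θ a)] [∀ a, DecidableEq (Θ a)]
    (m : ℕ) [NeZero m] (hA : Fintype.card A = m) (hI : Fintype.card I = m)
    (E : MatchingEnv A I K Θ)
    -- every inclusion-maximal feasible matching matches every agent
    (hmatch : ∀ M, Maximal (IsFeasible E.cls E.cap) M → ∀ a, ∃ i, (a, i) ∈ M)
    (b : GreedyBenchmark E.cls E.cap E.mean m)
    (hgap : ∀ e, e ≠ b.g 0 → 0 < b.gap e) :
    (∀ e, ∃ c : ℝ, 0 < c ∧ IsMixingConstant (E.P e) (E.stat e) c) ∧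
    ∀ C : A × I → ℝ, (∀ e, IsMixingConstant (E.P e) (E.stat e) (C e)) →
    ∀ τ₀ ζ : ℕ, 1 ≤ τ₀ → 1 ≤ ζ →
    -- `estar n` is a maximizer, over the edges other than the heaviest one of the benchmark
    ∀ estar : ℕ → A × I,
    (∀ n, ∀ e, e ≠ b.g 0 → estar n ≠ b.g 0 ∧
      ⌈pullThreshold m τ₀ ζ n (b.gap e) (C e)⌉
        ≤ ⌈pullThreshold m τ₀ ζ n (b.gap (estar n)) (C (estar n))⌉) →
    (∀ n : ℕ, 1 ≤ n →
      ∀ (M : ℕ → Finset (A × I)) (p : ℕ), IsInitialPlay E.cls E.cap M p →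
      ∀ (Ω : Type*) [mΩ : MeasurableSpace Ω] (Pr : Measure Ω) [IsProbabilityMeasure Pr]
        (ℱ : Filtration ℕ mΩ) (θ : ℕ → (a : A) → Ω → Θ a) (X : ℕ → A → Ω → ℝ)
        (α : ℕ → Ω → Finset (A × I)),
      IsMGEUCB E C m τ₀ ζ n M p Pr ℱ θ X α →
      regret Pr E.mean b.Gstar τ₀ ζ X α n ≤ regretBound b C τ₀ ζ (estar n) n) ∧
    (fun n : ℕ => regretBound b C τ₀ ζ (estar n) n) =O[atTop] (fun n : ℕ => Real.log n) := by
  refine ⟨fun e => exists_isMixingConstant (E.stochastic e) (E.irreducible e) (E.aperiodic e)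
    (E.stat_mem e) (E.stationary e), fun C hC τ₀ ζ hτ hζ estar hest => ⟨?_, ?_⟩⟩
  · intro n hn M p hM Ω mΩ Pr hPr ℱ θ X α h
    exact h.regret_le_regretBound hA hI hmatch hM b hgap hC hτ hζ hn fun e he => (hest n e he).2
  · exact isBigO_regretBound b C hτ estar
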